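/- Let $-\infty<a<b<\infty$, $I=[a,b]$, $1<p\le q<\infty$, $1/p'=1-1/p$, and let $u,v$ be positive functions on $I$ with $u\in L_{p'}(I)$ and $v\in L_q(I)$. Put \[ (Tf)(x)=v(x)\int_a^x f(t)u(t)\,dt,\qquad (T^*f)(x)=u(x)\int_x^b v(y)f(y)\,dy,\qquad x\in I, \] and write $(t)_{(s)}=|t|^{s-1}\operatorname{sgn}t$. For $n\in\mathbb{N}_0$ let $sp_n(T,p,q)$ be the set of all real $\lambda$ for which there are $f\in L_p(I)$ with $\|f\|_{p,I}=1$ and $g=Tf$ such that $f_{(p)}=\lambda\,T^*(g_{(q)})$ a.e. on $I$ and $g$ has exactly $n$ distinct zeros in the open interval $(a,b)$. Then for every $n\in\mathbb{N}_0$ the set $sp_n(T,p,q)$ has a least element $\check\lambda_n$, it is positive, and \[ \lim_{n\to\infty} n\,\check\lambda_n^{-1/q}=c_{pq}\left(\int_I |uv|^{r}\,dt\right)^{1/r}, \] where \[ \frac1r=\frac1{p'}+\frac1q,\qquad c_{pq}=\frac{(p')^{1/q}\,q^{1/p'}\,(p'+q)^{1/p-1/q}}{2\,B(1/q,1/p')},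 \] and $B$ denotes the Beta function. -/

import Mathlib

open MeasureTheory Filter Topology Set

noncomputable section

namespace HardySystem

/-- The signed power `(x)_{(p)} = |x|^{p-1} sgn x`. -/
def spow (p x : ℝ) : ℝ := |x| ^ (p - 1) * Real.sign x

/-- The Hardy-type operator `(T f)(x) = v(x) ∫_a^x f(t) u(t) dt`. -/
def hardyT (a : ℝ) (u v f : ℝ → ℝ) (x : ℝ) : ℝ := v x * ∫ t in a..x, f t * u t

/-- The dual operator `(T* f)(x) = u(x) ∫_x^b v(y) f(y) dy`. -/
def hardyTstar (b : ℝ) (u v f : ℝ → ℝ) (x : ℝ) : ℝ := u x * ∫ y in x..b, v y * f y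

/-- `(g, f, lam)` is a spectral triple on `[a, b]`: `f` lies in `L_p` with norm one, `g = T f`
on `[a, b]`, and `f_{(p)} = lam T*(g_{(q)})` (as elements of a Lebesgue space, i.e. a.e.). -/
structure IsSpectralTriple (a b p q : ℝ) (u v g f : ℝ → ℝ) (lam : ℝ) : Prop where
  memLp : MemLp f (ENNReal.ofReal p) (volume.restrict (Icc a b))
  norm_eq_one : eLpNorm f (ENNReal.ofReal p) (volume.restrict (Icc a b)) = 1
  eq_hardyT : ∀ x ∈ Icc a b, g x = hardyT a u v f x
  eq_hardyTstar : ∀ᵐ x ∂(volume.restrict (Icc a b)),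
    spow p (f x) = lam * hardyTstar b u v (fun y => spow q (g y)) x

/-- The number of distinct zeros of `g` in the open interval `(a, b)`. -/
def numZeros (a b : ℝ) (g : ℝ → ℝ) : ℕ∞ := {x ∈ Ioo a b | g x = 0}.encard

/-- The set `sp_n(T, p, q)` of spectral numbers that belong to a spectral triple whose
function `g` has exactly `n` zeros in `(a, b)`. -/
def spectralNumbers (a b p q : ℝ) (u v : ℝ → ℝ) (n : ℕ) : Set ℝ :=
  {lam | ∃ g f : ℝ → ℝ, IsSpectralTriple a b p q u v g f lam ∧ numZeros a b g = n}

/-- The constant `c_{pq} = (p')^{1/q} q^{1/p'} (p'+q)^{1/p-1/q} / (2 B(1/q, 1/p'))`, where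
`1/p + 1/p' = 1` and `B` is the Beta function. -/
def cConst (p q : ℝ) : ℝ :=
  p.conjExponent ^ (1 / q) * q ^ (1 / p.conjExponent) *
      (p.conjExponent + q) ^ (1 / p - 1 / q) /
    (2 * ProbabilityTheory.beta (1 / q) (1 / p.conjExponent))

end HardySystem

end

namespace HardySystem

/-! ### Signed powers -/

/-! Put `F(x) = ∫_a^x f u`, so that `g = v F`, and `G(x) = λ ∫_x^b v g_{(q)}`. Since `(p - 1)(p' -
1) = 1`, a spectral triple is the same thing as a solution of `F' = u^{p'} G_{(p')}`, `G' = -λ v^q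
F_{(q)}` with `F(a) = 0`, `G(b) = 0` and `∫ u^{p'} |G|^{p'} = 1`, and `g` and `F` have the same
zeros (`mem_spectralNumbers_iff`). Let `N_i` be the integral of `u^{p'} |G|^{p'}` over the `i`-th of
the `n + 1` nodal intervals. The energy identity gives `N_i = λ ∫ v^q |F|^q` there, and Hardy's
inequality gives `N_i ≤ λ κ_i^q N_i^{q/p}`, where `κ_i` is the best constant for primitives
vanishing at both ends (only at the left end for the last interval). Moreover `∑ N_i = 1`.

The least number for `p < q`. With `k = p / (q - p)` these inequalities add up to `∑ κ_i^{-qk} ≤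
λ^k`, so `λ^k` is at least the minimum `E` of this sum over all partitions into `n + 1` intervals. A
minimising partition exists by compactness. Its extremals solve the system and have no interior
zeros (`exists_arc`); they are scaled to the common multiplier `E^{1/k}` and given alternating
signs. At each node the slopes agree: otherwise replacing the corner of `F` by a chord would lower
the energies to first order and the `L_q` masses only to order `q > 1`, against minimality
(`corner_match`). Hence `E^{1/k}` is itself a spectral number.

The least number for `p = q`. The system is homogeneous. On a partition where all `κ_i` equal a
common `θ`, the arcs can be scaled until their slopes match, and every other partition has an
interval with constant at most `θ`; so the least number is `θ^{-p}`.

Asymptotics. For constant weights a conserved Hamiltonian gives the best constants explicitly: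
`c_{pq} |uv| l^{1/r}` on an interval of length `l` with both ends fixed, and twice this with one end
free (`kap_unit`). General weights are compared with step functions. The best constant is stable in
the weights (`hK_perturb`), and the errors over arbitrarily many intervals are added by a
three-factor Hölder inequality whose third factor is the energies (`sum_holder`, `sum_err_le`), so
the total does not grow with `n`. An equalizing partition bounds the least number from above by
`λ^{1/q} θ ≤ (n + 1)^{1/p - 1/q}`, with `θ` bounded below in `le_of_equal_partition`. For the bound
from below every nodal interval but the last is cut at a zero of `G`; this gives `2n + 1` pieces
with one free end, all but boundedly many of them carrying constant step weights
(`le_of_mem_spectralNumbers`). As `1/p - 1/q + 1/r = 1`, both bounds have the same limit. -/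

theorem spow_zero {p : ℝ} : spow p 0 = 0 := by simp [spow]

theorem spow_of_nonneg {p x : ℝ} (hp : 1 < p) (hx : 0 ≤ x) : spow p x = x ^ (p - 1) := by
  rcases hx.eq_or_lt with rfl | hx
  · rw [spow_zero, Real.zero_rpow (by linarith)]
  · rw [spow, Real.sign_of_pos hx, abs_of_pos hx, mul_one]

theorem spow_neg (p x : ℝ) : spow p (-x) = -spow p x := by
  simp [spow, Real.sign_neg]

theorem abs_spow {p x : ℝ} (hp : 1 < p) : |spow p x| = |x| ^ (p - 1) := by
  rcases le_total 0 x with hx | hx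
  · rw [spow_of_nonneg hp hx, abs_of_nonneg hx, abs_of_nonneg (Real.rpow_nonneg hx _)]
  · have h : 0 ≤ -x := by linarith
    rw [← neg_neg x, spow_neg, spow_of_nonneg hp h, abs_neg, abs_neg, abs_of_nonneg h,
      abs_of_nonneg (Real.rpow_nonneg h _)]

theorem spow_pos {p x : ℝ} (hp : 1 < p) (hx : 0 < x) : 0 < spow p x := by
  rw [spow_of_nonneg hp hx.le]; positivity

theorem spow_neg_of_neg {p x : ℝ} (hp : 1 < p) (hx : x < 0) : spow p x < 0 := by
  have := spow_pos hp (neg_pos.2 hx)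
  rw [spow_neg] at this; linarith

theorem spow_eq_zero_iff {p x : ℝ} (hp : 1 < p) : spow p x = 0 ↔ x = 0 := by
  refine ⟨fun h => ?_, fun h => by rw [h, spow_zero]⟩
  rcases lt_trichotomy x 0 with hx | hx | hx
  · exact absurd h (spow_neg_of_neg hp hx).ne
  · exact hx
  · exact absurd h (spow_pos hp hx).ne'

theorem spow_nonneg {p x : ℝ} (hp : 1 < p) (hx : 0 ≤ x) : 0 ≤ spow p x := by
  rw [spow_of_nonneg hp hx]; positivity

theorem spow_mul_self {p x : ℝ} (hp : 1 < p) : spow p x * x = |x| ^ p := by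
  have key : ∀ y : ℝ, 0 ≤ y → spow p y * y = |y| ^ p := fun y hy => by
    rw [spow_of_nonneg hp hy, abs_of_nonneg hy]
    rcases hy.eq_or_lt with rfl | hy
    · rw [mul_zero, Real.zero_rpow (by linarith)]
    · rw [← Real.rpow_add_one hy.ne']; ring_nf
  rcases le_total 0 x with hx | hx
  · exact key x hx
  · have := key (-x) (by linarith)
    rwa [spow_neg, abs_neg, neg_mul_neg] at this

theorem spow_mul (p x y : ℝ) : spow p (x * y) = spow p x * spow p y := by
  have hs : Real.sign (x * y) = Real.sign x * Real.sign y := by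
    rcases lt_trichotomy x 0 with hx | rfl | hx <;> rcases lt_trichotomy y 0 with hy | rfl | hy <;>
      simp [Real.sign_of_pos, Real.sign_of_neg, *, mul_pos_of_neg_of_neg,
        mul_neg_of_neg_of_pos, mul_neg_of_pos_of_neg]
  rw [spow, spow, spow, hs, abs_mul, Real.mul_rpow (abs_nonneg _) (abs_nonneg _)]
  ring

/-- Conjugacy means `(p - 1)(p' - 1) = 1`. This turns `f_{(p)} = u G` into `f = (u G)_{(p')}`. -/
theorem spow_spow {p p' : ℝ} (h : p.HolderConjugate p') (x : ℝ) : spow p (spow p' x) = x := by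
  have key : ∀ y : ℝ, 0 ≤ y → spow p (spow p' y) = y := fun y hy => by
    rw [spow_of_nonneg h.symm.lt hy, spow_of_nonneg h.lt (Real.rpow_nonneg hy _),
      ← Real.rpow_mul hy, show (p' - 1) * (p - 1) = 1 by
        have := h.mul_eq_add; nlinarith, Real.rpow_one]
  rcases le_total 0 x with hx | hx
  · exact key x hx
  · have := key (-x) (by linarith)
    rw [spow_neg, spow_neg] at this; linarith

/-- Since `p (p' - 1) = p'`, the map `w ↦ w_{(p')}` is the duality map from `L_{p'}` to `L_p`; all
energies are converted by this identity. -/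
theorem abs_spow_rpow {p p' : ℝ} (h : p.HolderConjugate p') (x : ℝ) :
    |spow p' x| ^ p = |x| ^ p' := by
  rw [abs_spow h.symm.lt, ← Real.rpow_mul (abs_nonneg _)]
  congr 1
  have := h.mul_eq_add; nlinarith

theorem continuous_spow {p : ℝ} (hp : 1 < p) : Continuous (spow p) := by
  -- Positive and negative parts avoid the discontinuous `Real.sign`.
  have : spow p = fun x => (max x 0) ^ (p - 1) - (max (-x) 0) ^ (p - 1) := by
    ext x
    have h0 : (0 : ℝ) ^ (p - 1) = 0 := Real.zero_rpow (by linarith)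
    rcases le_total 0 x with hx | hx
    · rw [spow_of_nonneg hp hx, max_eq_left hx, max_eq_right (by linarith), h0, sub_zero]
    · have h : 0 ≤ -x := by linarith
      rw [← neg_neg x, spow_neg, spow_of_nonneg hp h, neg_neg, max_eq_right hx, max_eq_left h, h0,
        zero_sub]
  rw [this]
  refine Continuous.sub ?_ ?_
  · exact Continuous.rpow_const (by fun_prop) fun x => Or.inr (by linarith)
  · exact Continuous.rpow_const (by fun_prop) fun x => Or.inr (by linarith)

/-- Equality in Young's inequality forces both `|x| ^ p = |w| ^ p'` and `x * w = |x| * |w|`. This is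
the pointwise source of the Euler-Lagrange equation and of strict convexity. -/
theorem eq_spow_of_young_eq {p p' x w : ℝ} (h : p.HolderConjugate p')
    (e : x * w = |x| ^ p / p + |w| ^ p' / p') : x = spow p' w := by
  have h1 : |x| * |w| ≤ |x| ^ p / p + |w| ^ p' / p' :=
    Real.young_inequality_of_nonneg (abs_nonneg _) (abs_nonneg _) h
  have h2 : x * w ≤ |x| * |w| := by rw [← abs_mul]; exact le_abs_self _
  have h3 : |x| * |w| = |x| ^ p / p + |w| ^ p' / p' := by linarith
  have h4 := (Real.young_inequality_eq_iff_of_nonneg (abs_nonneg x) (abs_nonneg w) h).1 h3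
  have h5 : |x| = |spow p' w| := by
    rw [← abs_spow_rpow h w] at h4
    exact (Real.rpow_left_inj (abs_nonneg _) (abs_nonneg _) h.ne_zero).1 h4
  have h6 : 0 ≤ x * w := by rw [show x * w = |x| * |w| by linarith]; positivity
  rcases lt_trichotomy w 0 with hw | rfl | hw
  · have hx : x ≤ 0 := by nlinarith
    rw [abs_of_nonpos hx, abs_of_neg (spow_neg_of_neg h.symm.lt hw)] at h5
    linarith
  · rw [spow_zero] at *; simpa using h5
  · have hx : 0 ≤ x := by nlinarith
    rwa [abs_of_nonneg hx, abs_of_pos (spow_pos h.symm.lt hw)] at h5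

/-! ### Norms -/

/-- The `L_p` norm on the real line, as a real number. -/
noncomputable def nrm (p : ℝ) (f : ℝ → ℝ) : ℝ := (∫ x, |f x| ^ p) ^ (1 / p)

/-- Membership in `L_p` of the real line for a real exponent. -/
abbrev MemL (p : ℝ) (f : ℝ → ℝ) : Prop := MemLp f (ENNReal.ofReal p) volume

theorem nrm_nonneg (p : ℝ) (f : ℝ → ℝ) : 0 ≤ nrm p f :=
  Real.rpow_nonneg (integral_nonneg fun _ => Real.rpow_nonneg (abs_nonneg _) _) _

theorem nrm_rpow {p : ℝ} (hp : 0 < p) (f : ℝ → ℝ) : nrm p f ^ p = ∫ x, |f x| ^ p := by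
  rw [nrm, ← Real.rpow_mul (integral_nonneg fun _ => Real.rpow_nonneg (abs_nonneg _) _),
    one_div_mul_cancel hp.ne', Real.rpow_one]

theorem nrm_congr {p : ℝ} {f g : ℝ → ℝ} (h : f =ᵐ[volume] g) : nrm p f = nrm p g := by
  unfold nrm
  congr 1
  exact integral_congr_ae (by filter_upwards [h] with x hx; rw [hx])

theorem lpNorm_eq_nrm {p : ℝ} (hp : 0 < p) {f : ℝ → ℝ} (hf : AEStronglyMeasurable f volume) :
    lpNorm f (ENNReal.ofReal p) volume = nrm p f := by
  rw [lpNorm_eq_integral_norm_rpow_toReal (by simpa using hp) (by simp) hf,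
    ENNReal.toReal_ofReal hp.le, nrm, one_div]
  simp [Real.norm_eq_abs]

theorem MemL.integrable_rpow {p : ℝ} (hp : 0 < p) {f : ℝ → ℝ} (hf : MemL p f) :
    Integrable fun x => |f x| ^ p := by
  have := hf.integrable_norm_rpow (by simpa using hp) (by simp)
  simpa [ENNReal.toReal_ofReal hp.le] using this

theorem memL_of_integrable_rpow {p : ℝ} (hp : 0 < p) {f : ℝ → ℝ}
    (hm : AEStronglyMeasurable f volume) (hf : Integrable fun x => |f x| ^ p) : MemL p f := by
  refine (integrable_norm_rpow_iff hm (by simpa using hp) (by simp)).1 ?_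
  simpa [ENNReal.toReal_ofReal hp.le] using hf

theorem nrm_add_le {p : ℝ} (hp : 1 ≤ p) {f g : ℝ → ℝ} (hf : MemL p f) (hg : MemL p g) :
    nrm p (fun x => f x + g x) ≤ nrm p f + nrm p g := by
  have h0 : 0 < p := by linarith
  rw [← lpNorm_eq_nrm h0 hf.1, ← lpNorm_eq_nrm h0 hg.1,
    ← lpNorm_eq_nrm h0 (show AEStronglyMeasurable (fun x => f x + g x) volume from (hf.add hg).1)]
  exact lpNorm_add_le hf (by simpa using hp)

theorem nrm_const_mul {p : ℝ} (hp : 0 < p) (c : ℝ) (f : ℝ → ℝ) :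
    nrm p (fun x => c * f x) = |c| * nrm p f := by
  unfold nrm
  simp_rw [abs_mul, Real.mul_rpow (abs_nonneg c) (abs_nonneg _)]
  rw [integral_const_mul, Real.mul_rpow (by positivity)
    (integral_nonneg fun _ => Real.rpow_nonneg (abs_nonneg _) _), ← Real.rpow_mul (abs_nonneg _),
    mul_one_div_cancel hp.ne', Real.rpow_one]

theorem nrm_sub_comm {p : ℝ} (f g : ℝ → ℝ) :
    nrm p (fun x => f x - g x) = nrm p (fun x => g x - f x) := by
  unfold nrm; simp_rw [abs_sub_comm]

theorem nrm_mono {p : ℝ} (hp : 0 < p) {f g : ℝ → ℝ} (hg : MemL p g)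
    (h : ∀ᵐ x, |f x| ≤ |g x|) : nrm p f ≤ nrm p g := by
  refine Real.rpow_le_rpow (integral_nonneg fun _ => Real.rpow_nonneg (abs_nonneg _) _)
    (integral_mono_of_nonneg (.of_forall fun _ => Real.rpow_nonneg (abs_nonneg _) _)
      (hg.integrable_rpow hp) ?_) (by positivity)
  filter_upwards [h] with x hx
  exact Real.rpow_le_rpow (abs_nonneg _) hx hp.le

theorem nrm_eq_zero_iff {p : ℝ} (hp : 0 < p) {f : ℝ → ℝ} (hf : MemL p f) :
    nrm p f = 0 ↔ f =ᵐ[volume] 0 := by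
  rw [← lpNorm_eq_nrm hp hf.1, lpNorm_eq_zero hf (by simpa using hp)]

theorem MemL.integrable_mul {p p' : ℝ} (h : p.HolderConjugate p') {f g : ℝ → ℝ} (hf : MemL p f)
    (hg : MemL p' g) : Integrable fun x => f x * g x := by
  have : (ENNReal.ofReal p).HolderConjugate (ENNReal.ofReal p') := h.ennrealOfReal
  exact MemLp.integrable_mul hf hg

theorem integral_abs_mul_le {p p' : ℝ} (h : p.HolderConjugate p') {f g : ℝ → ℝ} (hf : MemL p f)
    (hg : MemL p' g) : ∫ x, |f x * g x| ≤ nrm p f * nrm p' g := by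
  simpa [abs_mul, Real.norm_eq_abs, nrm] using integral_mul_norm_le_Lp_mul_Lq h hf hg

theorem abs_integral_mul_le {p p' : ℝ} (h : p.HolderConjugate p') {f g : ℝ → ℝ} (hf : MemL p f)
    (hg : MemL p' g) : |∫ x, f x * g x| ≤ nrm p f * nrm p' g :=
  (abs_integral_le_integral_abs).trans (integral_abs_mul_le h hf hg)

theorem MemL.spow {p p' : ℝ} (h : p.HolderConjugate p') {w : ℝ → ℝ} (hw : MemL p' w) :
    MemL p fun x => spow p' (w x) := by
  refine memL_of_integrable_rpow h.pos
    ((continuous_spow h.symm.lt).comp_aestronglyMeasurable hw.1) ?_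
  simp_rw [abs_spow_rpow h]
  exact hw.integrable_rpow h.symm.pos

theorem nrm_spow {p p' : ℝ} (h : p.HolderConjugate p') (w : ℝ → ℝ) :
    nrm p (fun x => HardySystem.spow p' (w x)) = nrm p' w ^ (p' - 1) := by
  unfold nrm
  simp_rw [abs_spow_rpow h]
  rw [← Real.rpow_mul (integral_nonneg fun _ => Real.rpow_nonneg (abs_nonneg _) _)]
  congr 1
  have := h.mul_eq_add
  have h1 := h.pos; have h2 := h.symm.pos
  field_simp
  linarith

/-! ### Primitives and tails -/

/-- The primitive `x ↦ ∫_{-∞}^x w`. -/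
noncomputable def prim (w : ℝ → ℝ) (x : ℝ) : ℝ := ∫ t in Iic x, w t

/-- The tail `x ↦ ∫_x^∞ w`. -/
noncomputable def tail (w : ℝ → ℝ) (x : ℝ) : ℝ := ∫ t in Ioi x, w t

theorem prim_sub {w : ℝ → ℝ} (hw : Integrable w) (x y : ℝ) :
    prim w y - prim w x = ∫ t in x..y, w t :=
  intervalIntegral.integral_Iic_sub_Iic hw.integrableOn hw.integrableOn

theorem continuous_prim {w : ℝ → ℝ} (hw : Integrable w) : Continuous (prim w) := by
  have : prim w = fun y => prim w 0 + ∫ t in (0:ℝ)..y, w t := by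
    ext y; rw [← prim_sub hw]; ring
  rw [this]
  exact continuous_const.add (intervalIntegral.continuous_primitive
    (fun a b => hw.intervalIntegrable) 0)

theorem abs_prim_le {w : ℝ → ℝ} (hw : Integrable w) (x : ℝ) : |prim w x| ≤ ∫ t, |w t| :=
  (abs_integral_le_integral_abs).trans
    (setIntegral_le_integral hw.abs (.of_forall fun _ => abs_nonneg _))

theorem prim_congr {w w' : ℝ → ℝ} (h : w =ᵐ[volume] w') : prim w = prim w' := by
  ext x
  exact setIntegral_congr_ae measurableSet_Iic (by filter_upwards [h] with t ht _ using ht)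

theorem prim_add_tail {w : ℝ → ℝ} (hw : Integrable w) (x : ℝ) :
    prim w x + tail w x = ∫ t, w t := by
  rw [prim, tail, ← compl_Iic]
  exact integral_add_compl measurableSet_Iic hw

theorem tail_eq {w : ℝ → ℝ} (hw : Integrable w) (x : ℝ) : tail w x = (∫ t, w t) - prim w x := by
  rw [← prim_add_tail hw x]; ring

theorem continuous_tail {w : ℝ → ℝ} (hw : Integrable w) : Continuous (tail w) := by
  have : tail w = fun x => (∫ t, w t) - prim w x := by ext x; exact tail_eq hw x
  rw [this]
  exact continuous_const.sub (continuous_prim hw)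

theorem abs_tail_le {w : ℝ → ℝ} (hw : Integrable w) (x : ℝ) : |tail w x| ≤ ∫ t, |w t| :=
  (abs_integral_le_integral_abs).trans
    (setIntegral_le_integral hw.abs (.of_forall fun _ => abs_nonneg _))

/-- Fubini on the half-plane `t ≤ x`: the tail operator is the adjoint of the primitive. -/
theorem integral_mul_prim {A B : ℝ → ℝ} (hA : Integrable A) (hB : Integrable B) :
    ∫ x, A x * prim B x = ∫ t, B t * tail A t := by
  have hprod : Integrable (fun z : ℝ × ℝ => A z.1 * B z.2) (volume.prod volume) := hA.mul_prod hB
  have hS : MeasurableSet {z : ℝ × ℝ | z.2 ≤ z.1} := measurableSet_le measurable_snd measurable_fst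
  have hI := hprod.indicator hS
  have h1 : ∀ x, A x * prim B x =
      ∫ t, {z : ℝ × ℝ | z.2 ≤ z.1}.indicator (fun z : ℝ × ℝ => A z.1 * B z.2) (x, t) := by
    intro x
    rw [prim, ← integral_const_mul, ← integral_indicator measurableSet_Iic]
    rfl
  have h2 : ∀ t, B t * tail A t =
      ∫ x, {z : ℝ × ℝ | z.2 ≤ z.1}.indicator (fun z : ℝ × ℝ => A z.1 * B z.2) (x, t) := by
    intro t
    rw [tail, ← integral_Ici_eq_integral_Ioi, ← integral_const_mul,
      ← integral_indicator measurableSet_Ici]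
    congr 1; ext x
    simp only [indicator, mem_Ici, mem_ofPred_eq]
    split_ifs <;> ring
  simp_rw [h1, h2]
  exact integral_integral_swap hI

/-! ### The weighted Hardy operator on the line and its best constant -/

/-- The Hardy operator `f ↦ v ∫_{-∞}^x f u` on the whole line. -/
noncomputable def opT (u v f : ℝ → ℝ) (x : ℝ) : ℝ := v x * prim (fun t => f t * u t) x

/-- The competitors in the definition of the best constant. The flag `D` prescribes that the
primitive vanishes at the right end. -/
structure Adm (p : ℝ) (D : Prop) (u f : ℝ → ℝ) : Prop where
  memL : MemL p f
  nrm_le : nrm p f ≤ 1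
  integral_eq : D → ∫ x, f x * u x = 0

/-- The best constant in `‖T f‖_q ≤ C ‖f‖_p`, over all `f` (`D` false) or over all `f` with
`∫ f u = 0` (`D` true). -/
noncomputable def hK (p q : ℝ) (D : Prop) (u v : ℝ → ℝ) : ℝ :=
  sSup {c | ∃ f, Adm p D u f ∧ c = nrm q (opT u v f)}

section basic

variable {p p' q : ℝ} {D : Prop} {u v f : ℝ → ℝ}

theorem abs_prim_mul_le (h : p.HolderConjugate p') (hu : MemL p' u) (hf : MemL p f) (x : ℝ) :
    |prim (fun t => f t * u t) x| ≤ nrm p f * nrm p' u :=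
  (abs_prim_le (hf.integrable_mul h hu) x).trans (integral_abs_mul_le h hf hu)

theorem memL_mul_of_bounded (hv : MemL q v) {F : ℝ → ℝ}
    (hF : AEStronglyMeasurable F volume) {C : ℝ} (hC : ∀ x, |F x| ≤ C) :
    MemL q fun x => v x * F x := by
  refine MemLp.of_le_mul (c := C) hv (hv.1.mul hF) (.of_forall fun x => ?_)
  rw [Real.norm_eq_abs, Real.norm_eq_abs, abs_mul, mul_comm]
  exact mul_le_mul_of_nonneg_right (hC x) (abs_nonneg _)

theorem nrm_mul_le_of_bounded (hq : 0 < q) (hv : MemL q v) {F : ℝ → ℝ} {C : ℝ}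
    (hC : ∀ x, |F x| ≤ C) : nrm q (fun x => v x * F x) ≤ C * nrm q v := by
  have hC0 : 0 ≤ C := (abs_nonneg _).trans (hC 0)
  rw [← abs_of_nonneg hC0, ← nrm_const_mul hq]
  refine nrm_mono hq (hv.const_mul C) (.of_forall fun x => ?_)
  rw [abs_mul, abs_mul, abs_of_nonneg hC0, mul_comm]
  exact mul_le_mul_of_nonneg_right (hC x) (abs_nonneg _)

theorem memL_opT (h : p.HolderConjugate p') (hu : MemL p' u) (hv : MemL q v)
    (hf : MemL p f) : MemL q (opT u v f) :=
  memL_mul_of_bounded hv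
    (continuous_prim (hf.integrable_mul h hu)).aestronglyMeasurable (abs_prim_mul_le h hu hf)

theorem nrm_opT_le (h : p.HolderConjugate p') (hq : 0 < q) (hu : MemL p' u) (hv : MemL q v)
    (hf : MemL p f) : nrm q (opT u v f) ≤ nrm p f * nrm p' u * nrm q v :=
  nrm_mul_le_of_bounded hq hv (abs_prim_mul_le h hu hf)

theorem opT_const_mul (c : ℝ) : opT u v (fun x => c * f x) = fun x => c * opT u v f x := by
  ext x
  simp only [opT, prim, mul_assoc, integral_const_mul]
  ring

theorem opT_add (h : p.HolderConjugate p') (hu : MemL p' u) {g : ℝ → ℝ} (hf : MemL p f)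
    (hg : MemL p g) :
    opT u v (fun x => f x + g x) = fun x => opT u v f x + opT u v g x := by
  ext x
  simp only [opT, prim, add_mul]
  rw [integral_add (hf.integrable_mul h hu).integrableOn (hg.integrable_mul h hu).integrableOn]
  ring

theorem hK_set_nonempty (p q : ℝ) (D : Prop) (u v : ℝ → ℝ) (hp : 0 < p) :
    {c | ∃ f, Adm p D u f ∧ c = nrm q (opT u v f)}.Nonempty := by
  refine ⟨_, fun _ => 0, ⟨MemLp.zero', ?_, fun _ => by simp⟩, rfl⟩
  simp [nrm, Real.zero_rpow hp.ne', Real.zero_rpow (inv_ne_zero hp.ne')]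

theorem hK_bddAbove (h : p.HolderConjugate p') (hq : 0 < q) (hu : MemL p' u) (hv : MemL q v) :
    BddAbove {c | ∃ f, Adm p D u f ∧ c = nrm q (opT u v f)} := by
  refine ⟨nrm p' u * nrm q v, ?_⟩
  rintro _ ⟨f, hf, rfl⟩
  refine (nrm_opT_le h hq hu hv hf.memL).trans ?_
  have := mul_nonneg (nrm_nonneg p' u) (nrm_nonneg q v)
  nlinarith [hf.nrm_le]

theorem le_hK_of_adm (h : p.HolderConjugate p') (hq : 0 < q) (hu : MemL p' u) (hv : MemL q v)
    (hf : Adm p D u f) : nrm q (opT u v f) ≤ hK p q D u v :=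
  le_csSup (hK_bddAbove h hq hu hv) ⟨f, hf, rfl⟩

theorem hK_nonneg : 0 ≤ hK p q D u v := by
  refine Real.sSup_nonneg ?_
  rintro _ ⟨f, -, rfl⟩
  exact nrm_nonneg _ _

theorem hK_le (hp : 0 < p) {C : ℝ} (hC : ∀ f, Adm p D u f → nrm q (opT u v f) ≤ C) :
    hK p q D u v ≤ C := by
  refine csSup_le (hK_set_nonempty p q D u v hp) ?_
  rintro _ ⟨f, hf, rfl⟩
  exact hC f hf

theorem hK_le_mul (h : p.HolderConjugate p') (hq : 0 < q) (hu : MemL p' u) (hv : MemL q v) :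
    hK p q D u v ≤ nrm p' u * nrm q v := by
  refine hK_le h.pos fun f hf => (nrm_opT_le h hq hu hv hf.memL).trans ?_
  have := mul_nonneg (nrm_nonneg p' u) (nrm_nonneg q v)
  nlinarith [hf.nrm_le]

theorem nrm_opT_le_hK (h : p.HolderConjugate p') (hq : 0 < q) (hu : MemL p' u) (hv : MemL q v)
    (hf : MemL p f) (hD : D → ∫ x, f x * u x = 0) :
    nrm q (opT u v f) ≤ hK p q D u v * nrm p f := by
  rcases (nrm_nonneg p f).eq_or_lt with h0 | h0
  · have := nrm_opT_le h hq hu hv hf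
    rw [← h0] at this ⊢; linarith
  · have hadm : Adm p D u (fun x => (nrm p f)⁻¹ * f x) := by
      refine ⟨hf.const_mul _, ?_, fun hd => ?_⟩
      · rw [nrm_const_mul h.pos, abs_of_pos (inv_pos.2 h0), inv_mul_cancel₀ h0.ne']
      · simp_rw [mul_assoc, integral_const_mul, hD hd, mul_zero]
    have := le_hK_of_adm h hq hu hv hadm
    rw [opT_const_mul, nrm_const_mul hq, abs_of_pos (inv_pos.2 h0)] at this
    rwa [inv_mul_le_iff₀ h0, mul_comm] at this

theorem le_hK_true (h : p.HolderConjugate p') (hq : 0 < q) (hu : MemL p' u) (hv : MemL q v) :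
    hK p q True u v ≤ hK p q D u v :=
  hK_le h.pos fun _ hf => le_hK_of_adm h hq hu hv ⟨hf.memL, hf.nrm_le, fun _ => hf.integral_eq trivial⟩

theorem MemL.indicator' {p : ℝ} {f : ℝ → ℝ} (hf : MemL p f) {S : Set ℝ} (hS : MeasurableSet S) :
    MemL p (S.indicator f) := MemLp.indicator hS hf

theorem nrm_indicator_le {p : ℝ} (hp : 0 < p) {f : ℝ → ℝ} (hf : MemL p f) (S : Set ℝ) :
    nrm p (S.indicator f) ≤ nrm p f :=
  nrm_mono hp hf (.of_forall fun x => by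
    simp only [Set.indicator]; split_ifs <;> simp)

/-- A competitor for the restricted weights becomes one for the full weights when it is cut to `S`;
the primitive is unchanged, and removing the cut from `v` only enlarges the image. -/
theorem hK_indicator_le (h : p.HolderConjugate p') (hq : 0 < q) (hu : MemL p' u)
    (hv : MemL q v) {S : Set ℝ} (hS : MeasurableSet S) :
    hK p q D (S.indicator u) (S.indicator v) ≤ hK p q D u v := by
  refine hK_le h.pos fun f hf => ?_
  have e : ∀ x, S.indicator f x * u x = f x * S.indicator u x := fun x => by
    simp only [Set.indicator]; split_ifs <;> simp
  have hadm : Adm p D u (S.indicator f) :=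
    ⟨hf.memL.indicator' hS, (nrm_indicator_le h.pos hf.memL S).trans hf.nrm_le, fun hd => by
      simp_rw [e]; exact hf.integral_eq hd⟩
  refine (nrm_mono hq (memL_opT h hu hv hadm.memL) (.of_forall fun x => ?_)).trans
    (le_hK_of_adm h hq hu hv hadm)
  simp only [opT, e, abs_mul]
  refine mul_le_mul_of_nonneg_right ?_ (abs_nonneg _)
  simp only [Set.indicator]; split_ifs <;> simp

/-- The best constant depends on the weights in a locally Lipschitz way. -/
theorem hK_perturb (h : p.HolderConjugate p') (hq : 1 < q) {u' v' : ℝ → ℝ} (hu : MemL p' u)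
    (hv : MemL q v) (hu' : MemL p' u') (hv' : MemL q v') :
    hK p q D u' v' ≤ hK p q D u v +
      (nrm p' (fun x => u' x - u x) * (nrm q v' + 2 * nrm q v) +
        nrm p' u * nrm q (fun x => v' x - v x)) := by
  have hq0 : 0 < q := by linarith
  refine hK_le h.pos fun f hf => ?_
  set ε := nrm p' (fun x => u' x - u x) with hε
  have hdu : MemL p' fun x => u' x - u x := hu'.sub hu
  have hdv : MemL q fun x => v' x - v x := hv'.sub hv
  have hε0 : 0 ≤ ε := nrm_nonneg _ _
  have nf := hf.nrm_le
  have nf0 := nrm_nonneg p f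
  -- splitting of the operator
  have hsplit : opT u' v' f = fun x => opT u v f x +
      (opT (fun x => u' x - u x) v' f x + opT u (fun x => v' x - v x) f x) := by
    ext x
    simp only [opT, prim, mul_sub]
    rw [integral_sub (hf.memL.integrable_mul h hu').integrableOn
      (hf.memL.integrable_mul h hu).integrableOn]
    ring
  have b1 : nrm q (opT (fun x => u' x - u x) v' f) ≤ ε * nrm q v' := by
    refine (nrm_opT_le h hq0 hdu hv' hf.memL).trans ?_
    have := mul_nonneg hε0 (nrm_nonneg q v')
    rw [mul_assoc]; nlinarith
  have b2 : nrm q (opT u (fun x => v' x - v x) f) ≤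
      nrm p' u * nrm q (fun x => v' x - v x) := by
    refine (nrm_opT_le h hq0 hu hdv hf.memL).trans ?_
    have := mul_nonneg (nrm_nonneg p' u) (nrm_nonneg q (fun x => v' x - v x))
    rw [mul_assoc]; nlinarith
  -- Under the constraint `f` is admissible for `u'`, not for `u`. The defect `e = ∫ f u` is at most
  -- `ε`; subtracting the multiple `k` of the dual function `u_{(p')}` restores the constraint, at a
  -- cost proportional to `ε` both in the norm of the competitor and in its image.
  have b3 : nrm q (opT u v f) ≤ hK p q D u v + 2 * (ε * nrm q v) := by
    by_cases hD : D
    swap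
    · have := le_hK_of_adm h hq0 hu hv (D := D) ⟨hf.memL, hf.nrm_le, fun hd => absurd hd hD⟩
      have := mul_nonneg hε0 (nrm_nonneg q v)
      linarith
    have h0 := hf.integral_eq hD
    rcases (nrm_nonneg p' u).eq_or_lt with hz | hz
    · have := nrm_opT_le h hq0 hu hv hf.memL
      rw [← hz, mul_zero, zero_mul] at this
      have h2 := mul_nonneg hε0 (nrm_nonneg q v)
      have h3 : 0 ≤ hK p q D u v := hK_nonneg
      linarith
    set N := nrm p' u with hN
    set e := ∫ x, f x * u x with he
    have he' : |e| ≤ ε := by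
      have : e = -∫ x, f x * (u' x - u x) := by
        simp_rw [mul_sub]
        rw [integral_sub (hf.memL.integrable_mul h hu') (hf.memL.integrable_mul h hu), h0]
        ring
      rw [this, abs_neg]
      refine (abs_integral_mul_le h hf.memL hdu).trans ?_
      nlinarith
    set f1 : ℝ → ℝ := fun x => spow p' (u x) with hf1
    have mf1 : MemL p f1 := hu.spow h
    have nf1 : nrm p f1 = N ^ (p' - 1) := nrm_spow h u
    have if1 : ∫ x, f1 x * u x = N ^ p' := by
      simp_rw [hf1, spow_mul_self h.symm.lt, hN, nrm_rpow h.symm.pos]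
    set k := e / N ^ p' with hk
    have hNp : 0 < N ^ p' := Real.rpow_pos_of_pos hz _
    have hNN : N ^ (p' - 1) / N ^ p' = N⁻¹ := by
      rw [Real.rpow_sub_one hz.ne']; field_simp
    have hkn : |k| * N ^ (p' - 1) ≤ ε / N := by
      rw [hk, abs_div, abs_of_pos hNp, div_mul_eq_mul_div, mul_div_assoc, hNN, ← div_eq_mul_inv]
      gcongr
    set g : ℝ → ℝ := fun x => f x + (-k) * f1 x with hg
    have mg : MemL p g := hf.memL.add (mf1.const_mul (-k))
    have ng : nrm p g ≤ 1 + ε / N := by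
      refine (nrm_add_le h.lt.le hf.memL (mf1.const_mul (-k))).trans ?_
      rw [nrm_const_mul h.pos, abs_neg, nf1]
      linarith
    have ig : ∫ x, g x * u x = 0 := by
      have : ∀ x, g x * u x = f x * u x + (-k) * (f1 x * u x) := fun x => by simp only [hg]; ring
      simp_rw [this]
      rw [integral_add (hf.memL.integrable_mul h hu) ((mf1.integrable_mul h hu).const_mul _),
        integral_const_mul, if1, ← he, hk]
      field_simp; ring
    have hTg := nrm_opT_le_hK h hq0 hu hv (D := D) mg (fun _ => ig)
    have hdec : opT u v f = fun x => opT u v g x + k * opT u v f1 x := by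
      have : f = fun x => g x + k * f1 x := by ext x; simp only [hg]; ring
      conv_lhs => rw [this]
      rw [opT_add h hu mg (mf1.const_mul k), opT_const_mul]
    have hKle := hK_le_mul h hq0 hu hv (D := D)
    rw [hdec]
    refine (nrm_add_le hq.le (memL_opT h hu hv mg) ((memL_opT h hu hv mf1).const_mul k)).trans ?_
    rw [nrm_const_mul hq0]
    have t1 : nrm q (opT u v g) ≤ hK p q D u v + ε * nrm q v := by
      refine hTg.trans ?_
      have : hK p q D u v * nrm p g ≤ hK p q D u v * (1 + ε / N) :=
        mul_le_mul_of_nonneg_left ng hK_nonneg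
      have h2 : hK p q D u v * (ε / N) ≤ N * nrm q v * (ε / N) :=
        mul_le_mul_of_nonneg_right hKle (by positivity)
      have h3 : N * nrm q v * (ε / N) = ε * nrm q v := by field_simp
      linarith
    have t2 : |k| * nrm q (opT u v f1) ≤ ε * nrm q v := by
      have h1 := nrm_opT_le h hq0 hu hv mf1
      rw [nf1, ← hN] at h1
      calc |k| * nrm q (opT u v f1) ≤ |k| * (N ^ (p' - 1) * N * nrm q v) := by gcongr
        _ = (|k| * N ^ (p' - 1)) * (N * nrm q v) := by ring
        _ ≤ ε / N * (N * nrm q v) :=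
          mul_le_mul_of_nonneg_right hkn (mul_nonneg hz.le (nrm_nonneg _ _))
        _ = ε * nrm q v := by field_simp
    linarith
  have m1 := memL_opT h hu hv hf.memL
  have m2 := memL_opT h hdu hv' hf.memL
  have m3 := memL_opT h hu hdv hf.memL
  rw [hsplit]
  have h1 := nrm_add_le hq.le m2 m3
  have h2 := nrm_add_le hq.le m1 (g := fun x => opT (fun x => u' x - u x) v' f x +
    opT u (fun x => v' x - v x) f x) (m2.add m3)
  linarith

end basic

/-! ### Existence of extremal functions and the Euler-Lagrange equation -/

section extremal

variable {p p' q : ℝ} {D : Prop} {u v f : ℝ → ℝ}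

theorem spow_mul_mul_self (hp : 1 < p) (a b : ℝ) :
    spow p (a * b) * a = |a| ^ p * spow p b := by
  rw [spow_mul, mul_right_comm, spow_mul_self hp]

theorem abs_spow_le (hp : 1 < p) {x C : ℝ} (h : |x| ≤ C) : |spow p x| ≤ C ^ (p - 1) := by
  rw [abs_spow hp]
  exact Real.rpow_le_rpow (abs_nonneg _) h (by linarith)

/-- The Lagrange multiplier of the constraint. -/
theorem exists_multiplier (D : Prop) (hp : 1 < p') (hu : MemL p' u) {A : ℝ → ℝ}
    (hA : Integrable A) :
    ∃ γ : ℝ, (¬ D → γ = 0) ∧ (D → ∫ x, spow p' (u x * (tail A x + γ)) * u x = 0) := by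
  by_cases hD : D
  swap
  · exact ⟨0, fun _ => rfl, fun h => absurd h hD⟩
  simp_rw [spow_mul_mul_self hp]
  have hU := hu.integrable_rpow (by linarith)
  set C := ∫ t, |A t| with hC
  have htail : ∀ x, |tail A x| ≤ C := abs_tail_le hA
  -- `tail A` takes values in `[-C, C]`, so the integrand is nonpositive for `γ = -C` and
  -- nonnegative for `γ = C`; the intermediate value theorem supplies the multiplier.
  set φ : ℝ → ℝ := fun γ => ∫ x, |u x| ^ p' * spow p' (tail A x + γ) with hφ
  have hcont : Continuous φ := by
    refine continuous_iff_continuousAt.2 fun γ0 => ?_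
    refine continuousAt_of_dominated (bound := fun x => |u x| ^ p' * (C + (|γ0| + 1)) ^ (p' - 1))
      (.of_forall fun γ => ?_) ?_ (hU.mul_const _) (.of_forall fun x => ?_)
    · exact hU.1.mul ((continuous_spow hp).comp
        ((continuous_tail hA).add continuous_const)).aestronglyMeasurable
    · filter_upwards [Metric.ball_mem_nhds γ0 one_pos] with γ hγ
      refine .of_forall fun x => ?_
      rw [Real.norm_eq_abs, abs_mul, abs_of_nonneg (Real.rpow_nonneg (abs_nonneg _) _)]
      refine mul_le_mul_of_nonneg_left (abs_spow_le hp ?_) (Real.rpow_nonneg (abs_nonneg _) _)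
      rw [Metric.mem_ball, Real.dist_eq] at hγ
      have h1 := abs_add_le (tail A x) γ
      have h2 := abs_sub_abs_le_abs_sub γ γ0
      linarith [htail x]
    · exact (continuous_const.mul ((continuous_spow hp).comp
        (continuous_const.add continuous_id))).continuousAt
  have hC0 : 0 ≤ C := integral_nonneg fun _ => abs_nonneg _
  have h1 : φ (-C) ≤ 0 := by
    refine integral_nonpos fun x => mul_nonpos_of_nonneg_of_nonpos
      (Real.rpow_nonneg (abs_nonneg _) _) ?_
    have : 0 ≤ -(tail A x + -C) := by linarith [(abs_le.1 (htail x)).2]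
    have := spow_nonneg hp this
    rw [spow_neg] at this; linarith
  have h2 : 0 ≤ φ C :=
    integral_nonneg fun x => mul_nonneg (Real.rpow_nonneg (abs_nonneg _) _)
      (spow_nonneg hp (by linarith [(abs_le.1 (htail x)).1]))
  obtain ⟨γ, -, hγ⟩ := intermediate_value_Icc (by linarith : -C ≤ C) hcont.continuousOn ⟨h1, h2⟩
  exact ⟨γ, fun h => absurd hD h, fun _ => hγ⟩

/-- Hölder's inequality for the dual function of `g`, whose conjugate norm is `nrm q g ^ (q - 1)`.
-/
theorem integral_spow_mul_le (hq : 1 < q) {g k : ℝ → ℝ} (hg : MemL q g) (hk : MemL q k) :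
    ∫ x, spow q (g x) * k x ≤ nrm q g ^ (q - 1) * nrm q k := by
  have hc := (Real.HolderConjugate.conjExponent hq).symm
  have := abs_integral_mul_le hc (hg.spow hc) hk
  rw [nrm_spow hc] at this
  exact (le_abs_self _).trans this

/-- Properties of the dual function attached to an integrable `A`. -/
theorem integral_mul_prim_eq_dual (h : p.HolderConjugate p') (hu : MemL p' u) {A : ℝ → ℝ}
    (hA : Integrable A) {γ : ℝ} (hγ : ¬ D → γ = 0) (hf : MemL p f)
    (hD : D → ∫ x, f x * u x = 0) :
    ∫ x, A x * prim (fun t => f t * u t) x = ∫ x, f x * (u x * (tail A x + γ)) := by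
  have hfu := hf.integrable_mul h hu
  rw [integral_mul_prim hA hfu]
  have e : ∀ x, f x * (u x * (tail A x + γ)) = f x * u x * tail A x + γ * (f x * u x) :=
    fun x => by ring
  have hi : Integrable fun x => f x * u x * tail A x := by
    refine hfu.mul_bdd (c := ∫ t, |A t|) (continuous_tail hA).aestronglyMeasurable (.of_forall fun x => ?_)
    exact abs_tail_le hA x
  simp_rw [e]
  rw [integral_add hi (hfu.const_mul γ), integral_const_mul]
  -- The shift contributes `γ ∫ f u`, which vanishes by the constraint or because `γ = 0`.
  by_cases hd : D
  · rw [hD hd]; simp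
  · rw [hγ hd]; simp

theorem memL_dual (hu : MemL p' u) {A : ℝ → ℝ} (hA : Integrable A) (γ : ℝ) :
    MemL p' fun x => u x * (tail A x + γ) := by
  refine memL_mul_of_bounded hu ((continuous_tail hA).add continuous_const).aestronglyMeasurable
    (C := (∫ t, |A t|) + |γ|) fun x => ?_
  exact (abs_add_le _ _).trans (by linarith [abs_tail_le hA x])

/-- The normalized dual competitor. -/
theorem adm_dual (h : p.HolderConjugate p') {w : ℝ → ℝ} (hw : MemL p' w)
    (hD : D → ∫ x, spow p' (w x) * u x = 0) (hQ : 0 < nrm p' w) :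
    Adm p D u (fun x => (nrm p' w ^ (p' - 1))⁻¹ * spow p' (w x)) ∧
      ∫ x, (nrm p' w ^ (p' - 1))⁻¹ * spow p' (w x) * w x = nrm p' w := by
  have hpos : 0 < nrm p' w ^ (p' - 1) := Real.rpow_pos_of_pos hQ _
  refine ⟨⟨(hw.spow h).const_mul _, ?_, fun hd => ?_⟩, ?_⟩
  · rw [nrm_const_mul h.pos, nrm_spow h, abs_of_pos (inv_pos.2 hpos), inv_mul_cancel₀ hpos.ne']
  · simp_rw [mul_assoc, integral_const_mul, hD hd, mul_zero]
  · simp_rw [mul_assoc, integral_const_mul, spow_mul_self h.symm.lt, ← nrm_rpow h.symm.pos]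
    rw [Real.rpow_sub_one hQ.ne']
    have := (Real.rpow_pos_of_pos hQ p').ne'
    field_simp

theorem integrable_mul_spow (hq : 1 < q) (hv : MemL q v) {F : ℝ → ℝ}
    (hF : AEStronglyMeasurable F volume) {C : ℝ} (hC : ∀ x, |F x| ≤ C) :
    Integrable fun x => v x * spow q (v x * F x) := by
  have hc := (Real.HolderConjugate.conjExponent hq)
  exact hv.integrable_mul hc ((memL_mul_of_bounded hv hF hC).spow hc.symm)

/-- A bounded sequence of competitors has a subsequence with pointwise convergent primitives. -/
theorem exists_subseq_prim (h : p.HolderConjugate p') {a b : ℝ} (hab : a ≤ b) (hu : MemL p' u)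
    (f : ℕ → ℝ → ℝ) (hf : ∀ k, MemL p (f k)) (hf1 : ∀ k, nrm p (f k) ≤ 1) :
    ∃ (φ : ℕ → ℕ) (F : ℝ → ℝ), StrictMono φ ∧ Continuous F ∧ (∀ x, |F x| ≤ nrm p' u) ∧
      ∀ x ∈ Icc a b, Tendsto (fun k => prim (fun t => f (φ k) t * u t) x) atTop (𝓝 (F x)) := by
  have : Nonempty (Icc a b) := ⟨⟨a, left_mem_Icc.2 hab⟩⟩
  have hInt : ∀ k, Integrable fun t => f k t * u t := fun k => (hf k).integrable_mul h hu
  have hbd : ∀ k x, |prim (fun t => f k t * u t) x| ≤ nrm p' u := fun k x =>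
    (abs_prim_mul_le h hu (hf k) x).trans
      (mul_le_of_le_one_left (nrm_nonneg _ _) (hf1 k))
  let Φ : ℕ → BoundedContinuousFunction (Icc a b) ℝ := fun k =>
    BoundedContinuousFunction.mkOfCompact
      ⟨fun x => prim (fun t => f k t * u t) x, (continuous_prim (hInt k)).comp continuous_subtype_val⟩
  have hU := hu.integrable_rpow h.symm.pos
  set M := prim (fun t => |u t| ^ p') with hM
  have hMc : Continuous M := continuous_prim hU
  -- Hölder's inequality between `y` and `x` gives one modulus of continuity for the whole sequence,
  -- so that Arzelà-Ascoli takes the place of weak compactness in `L_p`.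
  have hmod : ∀ k x y, |prim (fun t => f k t * u t) x - prim (fun t => f k t * u t) y| ≤
      |M x - M y| ^ (1 / p') := by
    intro k x y
    rw [prim_sub (hInt k), hM, prim_sub hU]
    have hm : MeasurableSet (uIoc y x) := measurableSet_uIoc
    have e1 : |∫ t in y..x, f k t * u t| = |∫ t, f k t * (uIoc y x).indicator u t| := by
      rw [← Real.norm_eq_abs, intervalIntegral.norm_intervalIntegral_eq, ← integral_indicator hm,
        Real.norm_eq_abs]
      congr 2; ext t
      simp only [Set.indicator]; split_ifs <;> simp
    have e2 : |∫ t in y..x, |u t| ^ p'| = ∫ t, |(uIoc y x).indicator u t| ^ p' := by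
      rw [← Real.norm_eq_abs, intervalIntegral.norm_intervalIntegral_eq, ← integral_indicator hm,
        Real.norm_eq_abs, abs_of_nonneg (integral_nonneg fun t => ?_)]
      · congr 1; ext t
        simp only [Set.indicator]; split_ifs <;> simp [Real.zero_rpow h.symm.ne_zero]
      · simp only [Set.indicator, Pi.zero_apply]; split_ifs <;> positivity
    rw [e1, e2]
    refine (abs_integral_mul_le h (hf k) (hu.indicator' hm)).trans ?_
    exact mul_le_of_le_one_left (nrm_nonneg _ _) (hf1 k)
  have hcomp : IsCompact (closure (range Φ)) := by
    refine BoundedContinuousFunction.arzela_ascoli (Icc (-nrm p' u) (nrm p' u)) isCompact_Icc _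
      ?_ ?_
    · rintro _ x ⟨k, rfl⟩
      exact abs_le.1 (hbd k x)
    · simp_rw [Equicontinuous, Metric.equicontinuousAt_iff_pair]
      intro x0 ε hε
      have hc : ContinuousAt (fun x : Icc a b => |M x - M x0| ^ (1 / p')) x0 := by
        refine (Continuous.rpow_const ?_ fun _ => Or.inr (by
          have := h.symm.pos; positivity)).continuousAt
        exact ((hMc.comp continuous_subtype_val).sub continuous_const).abs
      have h0 : |M x0 - M x0| ^ (1 / p') = 0 := by
        rw [sub_self, abs_zero, Real.zero_rpow (one_div_ne_zero h.symm.ne_zero)]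
      have hev : ∀ᶠ x : Icc a b in 𝓝 x0, |M x - M x0| ^ (1 / p') < ε / 2 := by
        have := hc.tendsto
        rw [h0] at this
        exact this.eventually_lt_const (by linarith)
      refine ⟨_, hev, fun x hx y hy => ?_⟩
      rintro ⟨_, k, rfl⟩
      have h1 := hmod k x x0
      have h2 := hmod k y x0
      rw [Real.dist_eq]
      simp only [mem_ofPred_eq] at hx hy
      have : |prim (fun t => f k t * u t) x - prim (fun t => f k t * u t) y| < ε := by
        have := abs_sub_le (prim (fun t => f k t * u t) x) (prim (fun t => f k t * u t) x0)
          (prim (fun t => f k t * u t) y)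
        rw [abs_sub_comm (prim (fun t => f k t * u t) x0)] at this
        linarith
      exact this
  obtain ⟨F, -, φ, hφ, hF⟩ := hcomp.tendsto_subseq (fun k => subset_closure (mem_range_self k))
  have hpt : ∀ x : Icc a b, Tendsto (fun k => prim (fun t => f (φ k) t * u t) x) atTop (𝓝 (F x)) :=
    fun x => ((BoundedContinuousFunction.lipschitz_eval_const x).continuous.tendsto F).comp hF
  refine ⟨φ, fun x => F (projIcc a b hab x), hφ, F.continuous.comp continuous_projIcc, fun x => ?_,
    fun x hx => ?_⟩
  · exact le_of_tendsto (hpt _).abs (.of_forall fun k => hbd _ _)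
  · simp only [projIcc_of_mem hab hx]
    exact hpt ⟨x, hx⟩

theorem tendsto_nrm_mul (hq : 0 < q) {a b : ℝ} (hv : MemL q v) (hsupp : ∀ x ∉ Icc a b, v x = 0)
    {Fk : ℕ → ℝ → ℝ} {F : ℝ → ℝ} {C : ℝ} (hc : ∀ k, Continuous (Fk k)) (hFk : ∀ k x, |Fk k x| ≤ C)
    (hlim : ∀ x ∈ Icc a b, Tendsto (fun k => Fk k x) atTop (𝓝 (F x))) :
    Tendsto (fun k => nrm q fun x => v x * Fk k x) atTop (𝓝 (nrm q fun x => v x * F x)) := by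
  refine Tendsto.rpow_const ?_ (Or.inr (by positivity))
  have hV := hv.integrable_rpow hq
  refine tendsto_integral_of_dominated_convergence (fun x => |v x| ^ q * C ^ q) (fun k => ?_)
    (hV.mul_const _) (fun k => .of_forall fun x => ?_) (.of_forall fun x => ?_)
  · exact (((hv.1.mul (hc k).aestronglyMeasurable).norm.aemeasurable.pow_const q)).aestronglyMeasurable
  · rw [Real.norm_eq_abs, abs_of_nonneg (Real.rpow_nonneg (abs_nonneg _) _), abs_mul,
      Real.mul_rpow (abs_nonneg _) (abs_nonneg _)]
    exact mul_le_mul_of_nonneg_left (Real.rpow_le_rpow (abs_nonneg _) (hFk k x) hq.le)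
      (Real.rpow_nonneg (abs_nonneg _) _)
  · by_cases hx : x ∈ Icc a b
    · exact ((tendsto_const_nhds.mul (hlim x hx)).abs).rpow_const (Or.inr hq.le)
    · simp [hsupp x hx]

/-- The best constant is attained. -/
theorem exists_extremal (h : p.HolderConjugate p') (hq : 1 < q) {a b : ℝ} (hab : a ≤ b)
    (hu : MemL p' u) (hv : MemL q v) (hsupp : ∀ x ∉ Icc a b, v x = 0)
    (hpos : 0 < hK p q D u v) :
    ∃ f, Adm p D u f ∧ nrm q (opT u v f) = hK p q D u v := by
  have hq0 : 0 < q := by linarith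
  obtain ⟨c, -, hclim, hc⟩ := exists_seq_tendsto_sSup (hK_set_nonempty p q D u v h.pos)
    (hK_bddAbove h hq0 hu hv)
  choose f hadm hcf using hc
  obtain ⟨φ, F, hφ, hFc, hFb, hFlim⟩ := exists_subseq_prim h hab hu f (fun k => (hadm k).memL)
    (fun k => (hadm k).nrm_le)
  have hInt : ∀ k, Integrable fun t => f k t * u t := fun k => (hadm k).memL.integrable_mul h hu
  have hbd : ∀ k x, |prim (fun t => f k t * u t) x| ≤ nrm p' u := fun k x =>
    (abs_prim_mul_le h hu (hadm k).memL x).trans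
      (mul_le_of_le_one_left (nrm_nonneg _ _) (hadm k).nrm_le)
  set K := hK p q D u v with hKdef
  have hnF : nrm q (fun x => v x * F x) = K := by
    refine tendsto_nhds_unique (tendsto_nrm_mul hq0 hv hsupp (fun k => continuous_prim (hInt (φ k)))
      (fun k => hbd (φ k)) hFlim) ?_
    have := hclim.comp hφ.tendsto_atTop
    refine this.congr fun k => ?_
    exact hcf (φ k)
  have mF : MemL q fun x => v x * F x := memL_mul_of_bounded hv hFc.aestronglyMeasurable hFb
  -- The limit `F` is not known to be the primitive of an admissible function. The maximiser is
  -- built from it by duality: `w` is the adjoint image of `(v F)_{(q)}` shifted by the multiplier,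
  -- and the normalized dual function of `w` is admissible.
  set A : ℝ → ℝ := fun x => v x * spow q (v x * F x) with hA
  have hAint : Integrable A := integrable_mul_spow hq hv hFc.aestronglyMeasurable hFb
  obtain ⟨γ, hγ, hγD⟩ := exists_multiplier D h.symm.lt hu hAint
  set w : ℝ → ℝ := fun x => u x * (tail A x + γ) with hw
  have mw : MemL p' w := memL_dual hu hAint γ
  -- `∫ A F = K ^ q` is the limit of the pairings of `w` with the maximising sequence, each at most
  -- the norm of `w`.
  have hlow : K ^ q ≤ nrm p' w := by
    have hlim : Tendsto (fun k => ∫ x, A x * prim (fun t => f (φ k) t * u t) x) atTop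
        (𝓝 (∫ x, A x * F x)) := by
      refine tendsto_integral_of_dominated_convergence (fun x => |A x| * nrm p' u) (fun k => ?_)
        (hAint.abs.mul_const _) (fun k => .of_forall fun x => ?_) (.of_forall fun x => ?_)
      · exact hAint.1.mul (continuous_prim (hInt (φ k))).aestronglyMeasurable
      · rw [Real.norm_eq_abs, abs_mul]
        exact mul_le_mul_of_nonneg_left (hbd _ _) (abs_nonneg _)
      · by_cases hx : x ∈ Icc a b
        · exact tendsto_const_nhds.mul (hFlim x hx)
        · simp [hA, hsupp x hx]
    have e : ∫ x, A x * F x = K ^ q := by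
      rw [← hnF, nrm_rpow hq0]
      congr 1; ext x
      rw [← spow_mul_self hq, hA]; ring
    rw [← e]
    refine le_of_tendsto hlim (.of_forall fun k => ?_)
    rw [integral_mul_prim_eq_dual h hu hAint hγ (hadm (φ k)).memL (hadm (φ k)).integral_eq]
    refine (le_abs_self _).trans ((abs_integral_mul_le h (hadm (φ k)).memL mw).trans ?_)
    exact mul_le_of_le_one_left (nrm_nonneg _ _) (hadm _).nrm_le
  have hQ : 0 < nrm p' w := (Real.rpow_pos_of_pos hpos q).trans_le hlow
  obtain ⟨hf1, hf2⟩ := adm_dual h mw hγD hQ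
  refine ⟨_, hf1, le_antisymm (le_hK_of_adm h hq0 hu hv hf1) ?_⟩
  rw [← integral_mul_prim_eq_dual h hu hAint hγ hf1.memL hf1.integral_eq] at hf2
  have h3 := integral_spow_mul_le hq mF (memL_opT h hu hv hf1.memL)
  rw [hnF] at h3
  -- For the new competitor `f` the chain is `K ^ q ≤ ‖w‖ = ∫ A · prim (f u) ≤ K ^ (q - 1) ‖T f‖`.
  have h4 : K ^ (q - 1) * K ≤ K ^ (q - 1) * nrm q (opT u v fun x =>
      (nrm p' w ^ (p' - 1))⁻¹ * spow p' (w x)) := by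
    rw [← Real.rpow_add_one hpos.ne', sub_add_cancel]
    refine hlow.trans (le_trans (le_of_eq (hf2.symm.trans ?_)) h3)
    congr 1; ext x
    simp only [hA, opT]; ring
  exact le_of_mul_le_mul_left h4 (Real.rpow_pos_of_pos hpos _)

/-- Euler-Lagrange equation for an extremal function. -/
theorem extremal_eq (h : p.HolderConjugate p') (hq : 1 < q)
    (hu : MemL p' u) (hv : MemL q v) (hpos : 0 < hK p q D u v)
    (hf : Adm p D u f) (hmax : nrm q (opT u v f) = hK p q D u v) :
    nrm p f = 1 ∧ ∃ γ : ℝ, (¬ D → γ = 0) ∧ ∀ᵐ x, f x = spow p' (u x * (γ + (hK p q D u v ^ q)⁻¹ *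
      tail (fun y => v y * spow q (opT u v f y)) x)) := by
  have hq0 : 0 < q := by linarith
  set K := hK p q D u v with hKdef
  set F := prim (fun t => f t * u t) with hF
  have hfu := hf.memL.integrable_mul h hu
  have hFc : Continuous F := continuous_prim hfu
  have mF : MemL q (opT u v f) := memL_opT h hu hv hf.memL
  set A : ℝ → ℝ := fun x => v x * spow q (opT u v f x) with hA
  have hAint : Integrable A := integrable_mul_spow hq hv hFc.aestronglyMeasurable
    (abs_prim_mul_le h hu hf.memL)
  obtain ⟨γ, hγ, hγD⟩ := exists_multiplier D h.symm.lt hu hAint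
  set w : ℝ → ℝ := fun x => u x * (tail A x + γ) with hw
  have mw : MemL p' w := memL_dual hu hAint γ
  have hKq : 0 < K ^ q := Real.rpow_pos_of_pos hpos q
  have e1 : ∫ x, f x * w x = K ^ q := by
    rw [← integral_mul_prim_eq_dual h hu hAint hγ hf.memL hf.integral_eq, ← hmax, nrm_rpow hq0]
    congr 1; ext x
    rw [← spow_mul_self hq, hA]
    simp only [opT]; ring
  have hlow : K ^ q ≤ nrm p f * nrm p' w := by
    rw [← e1]; exact (le_abs_self _).trans (abs_integral_mul_le h hf.memL mw)
  have hQ : 0 < nrm p' w := by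
    by_contra hcon
    have : nrm p' w = 0 := le_antisymm (not_lt.1 hcon) (nrm_nonneg _ _)
    rw [this, mul_zero] at hlow; linarith
  obtain ⟨hf1, hf2⟩ := adm_dual h mw hγD hQ
  -- The dual function of `w` competes in the definition of `K`. With `hlow` this forces `‖f‖_p = 1`
  -- and `‖w‖_{p'} = K ^ q`, so that `f` and `w` are in the equality case of Hölder's inequality.
  have hup : nrm p' w ≤ K ^ q := by
    rw [← integral_mul_prim_eq_dual h hu hAint hγ hf1.memL hf1.integral_eq] at hf2
    have h3 := integral_spow_mul_le hq mF (memL_opT h hu hv hf1.memL)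
    rw [hmax] at h3
    have h4 := le_hK_of_adm h hq0 hu hv hf1
    refine le_trans (le_of_eq (hf2.symm.trans ?_)) (h3.trans ((mul_le_mul_of_nonneg_left h4
      (Real.rpow_nonneg hpos.le _)).trans_eq ?_))
    · congr 1; ext x
      simp only [hA, opT]; ring
    · rw [← Real.rpow_add_one hpos.ne', sub_add_cancel]
  have hn1 : nrm p f = 1 := by
    refine le_antisymm hf.nrm_le ?_
    by_contra hcon
    have := mul_lt_mul_of_pos_right (not_le.1 hcon) hQ
    linarith
  have hQe : nrm p' w = K ^ q := le_antisymm hup (by simpa [hn1] using hlow)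
  refine ⟨hn1, (K ^ q)⁻¹ * γ, fun hd => by rw [hγ hd, mul_zero], ?_⟩
  set w1 : ℝ → ℝ := fun x => (K ^ q)⁻¹ * w x with hw1
  have mw1 : MemL p' w1 := mw.const_mul _
  have hw1n : ∫ x, |w1 x| ^ p' = 1 := by
    rw [← nrm_rpow h.symm.pos, hw1, nrm_const_mul h.symm.pos, hQe, abs_of_pos (inv_pos.2 hKq),
      inv_mul_cancel₀ hKq.ne', Real.one_rpow]
  have hfn : ∫ x, |f x| ^ p = 1 := by rw [← nrm_rpow h.pos, hn1, Real.one_rpow]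
  have hfw : ∫ x, f x * w1 x = 1 := by
    have : ∀ x, f x * w1 x = (K ^ q)⁻¹ * (f x * w x) := fun x => by simp only [hw1]; ring
    simp_rw [this]
    rw [integral_const_mul, e1, inv_mul_cancel₀ hKq.ne']
  have i1 := (hf.memL.integrable_rpow h.pos).div_const p
  have i2 := (mw1.integrable_rpow h.symm.pos).div_const p'
  have i3 := hf.memL.integrable_mul h mw1
  have i12 : Integrable fun x => |f x| ^ p / p + |w1 x| ^ p' / p' := i1.add i2
  have i123 : Integrable fun x => |f x| ^ p / p + |w1 x| ^ p' / p' - f x * w1 x := i12.sub i3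
  -- The defect in Young's inequality is nonnegative with integral `1/p + 1/p' - 1 = 0`, so equality
  -- holds almost everywhere.
  have hgap : ∫ x, (|f x| ^ p / p + |w1 x| ^ p' / p' - f x * w1 x) = 0 := by
    rw [integral_sub i12 i3, integral_add i1 i2, integral_div, integral_div, hw1n, hfn, hfw]
    have := h.inv_add_inv_eq_one
    rw [one_div, one_div]; linarith
  have hae := (integral_eq_zero_iff_of_nonneg (fun x => by
    have := Real.young_inequality (f x) (w1 x) h
    simp only [Pi.zero_apply]; linarith) i123).1 hgap
  filter_upwards [hae] with x hx
  have hx' : |f x| ^ p / p + |w1 x| ^ p' / p' - f x * w1 x = 0 := hx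
  rw [eq_spow_of_young_eq h (show f x * w1 x = |f x| ^ p / p + |w1 x| ^ p' / p' by linarith)]
  congr 1
  simp only [hw1, hw]; ring

end extremal

/-! ### The system of integral equations -/

/-- `(F, G)` solves `F' = U G_{(p')}`, `G' = -lam V F_{(q)}` on `[x, y]`. -/
structure Sol (p' q : ℝ) (U V : ℝ → ℝ) (lam x y : ℝ) (F G : ℝ → ℝ) : Prop where
  contF : ContinuousOn F (Icc x y)
  contG : ContinuousOn G (Icc x y)
  eqF : ∀ s ∈ Icc x y, F s = F x + ∫ t in x..s, U t * spow p' (G t)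
  eqG : ∀ s ∈ Icc x y, G s = G x - lam * ∫ t in x..s, V t * spow q (F t)

section sol

variable {p p' q lam x y : ℝ} {U V F G : ℝ → ℝ}

theorem intervalIntegrable_mul_spow {W H : ℝ → ℝ} (hq : 1 < q) (hW : Integrable W) {s t : ℝ}
    (hH : ContinuousOn H (uIcc s t)) :
    IntervalIntegrable (fun r => W r * spow q (H r)) volume s t :=
  hW.intervalIntegrable.mul_continuousOn ((continuous_spow hq).comp_continuousOn hH)

theorem Sol.congr (h : Sol p' q U V lam x y F G) {F' G' : ℝ → ℝ} (hF : EqOn F' F (Icc x y))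
    (hG : EqOn G' G (Icc x y)) : Sol p' q U V lam x y F' G' := by
  refine ⟨h.contF.congr hF, h.contG.congr hG, fun s hs => ?_, fun s hs => ?_⟩
  · have hx : x ∈ Icc x y := ⟨le_rfl, hs.1.trans hs.2⟩
    rw [hF hs, hF hx, h.eqF s hs]
    congr 1
    refine intervalIntegral.integral_congr fun t ht => ?_
    rw [uIcc_of_le hs.1] at ht
    simp only [hG ⟨ht.1, ht.2.trans hs.2⟩]
  · have hx : x ∈ Icc x y := ⟨le_rfl, hs.1.trans hs.2⟩
    rw [hG hs, hG hx, h.eqG s hs]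
    congr 2
    refine intervalIntegral.integral_congr fun t ht => ?_
    rw [uIcc_of_le hs.1] at ht
    simp only [hF ⟨ht.1, ht.2.trans hs.2⟩]

theorem Sol.sub_F (h : Sol p' q U V lam x y F G) (hp' : 1 < p') (hU : Integrable U) {s t : ℝ}
    (hs : s ∈ Icc x y) (ht : t ∈ Icc x y) : F t - F s = ∫ r in s..t, U r * spow p' (G r) := by
  have hi : ∀ r ∈ Icc x y, IntervalIntegrable (fun r => U r * spow p' (G r)) volume x r :=
    fun r hr => intervalIntegrable_mul_spow hp' hU
      (h.contG.mono (by rw [uIcc_of_le hr.1]; exact Icc_subset_Icc_right hr.2))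
  rw [h.eqF s hs, h.eqF t ht, ← intervalIntegral.integral_interval_sub_left (hi t ht) (hi s hs)]
  ring

theorem Sol.sub_G (h : Sol p' q U V lam x y F G) (hq : 1 < q) (hV : Integrable V) {s t : ℝ}
    (hs : s ∈ Icc x y) (ht : t ∈ Icc x y) :
    G t - G s = -lam * ∫ r in s..t, V r * spow q (F r) := by
  have hi : ∀ r ∈ Icc x y, IntervalIntegrable (fun r => V r * spow q (F r)) volume x r :=
    fun r hr => intervalIntegrable_mul_spow hq hV
      (h.contF.mono (by rw [uIcc_of_le hr.1]; exact Icc_subset_Icc_right hr.2))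
  rw [h.eqG s hs, h.eqG t ht, ← intervalIntegral.integral_interval_sub_left (hi t ht) (hi s hs)]
  ring

theorem Sol.mono (h : Sol p' q U V lam x y F G) (hp' : 1 < p') (hq : 1 < q) (hU : Integrable U)
    (hV : Integrable V) {s t : ℝ} (hs : x ≤ s) (hst : s ≤ t) (ht : t ≤ y) :
    Sol p' q U V lam s t F G := by
  have hsub : Icc s t ⊆ Icc x y := Icc_subset_Icc hs ht
  refine ⟨h.contF.mono hsub, h.contG.mono hsub, fun r hr => ?_, fun r hr => ?_⟩
  · rw [← h.sub_F hp' hU (hsub ⟨le_rfl, hst⟩) (hsub hr)]; ring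
  · have := h.sub_G hq hV (hsub ⟨le_rfl, hst⟩) (hsub hr)
    linarith

/-- The two equations have different homogeneities: scaling `F` by `c` forces scaling `G` by
`c_{(p)}`, and `lam` absorbs the mismatch `c_{(p)} / c_{(q)}`, which is `1` when `p = q`. For `p <
q` this brings arcs to a common multiplier. -/
theorem Sol.scale (h : Sol p' q U V lam x y F G) (hpp : p.HolderConjugate p') (hq : 1 < q) {c : ℝ}
    (hc : c ≠ 0) :
    Sol p' q U V (lam * (spow p c / spow q c)) x y (fun t => c * F t)
      (fun t => spow p c * G t) := by
  have hc' : spow q c ≠ 0 := fun h0 => hc ((spow_eq_zero_iff hq).1 h0)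
  refine ⟨continuousOn_const.mul h.contF, continuousOn_const.mul h.contG, fun s hs => ?_,
    fun s hs => ?_⟩
  · simp_rw [spow_mul, spow_spow hpp.symm]
    rw [h.eqF s hs, mul_add, ← intervalIntegral.integral_const_mul]
    congr 2; ext t; ring
  · simp_rw [spow_mul]
    have : ∀ t, V t * (spow q c * spow q (F t)) = spow q c * (V t * spow q (F t)) :=
      fun t => by ring
    simp_rw [this]
    rw [h.eqG s hs, intervalIntegral.integral_const_mul]
    field_simp

theorem Sol.neg (h : Sol p' q U V lam x y F G) :
    Sol p' q U V lam x y (fun t => -F t) (fun t => -G t) := by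
  refine ⟨h.contF.neg, h.contG.neg, fun s hs => ?_, fun s hs => ?_⟩
  · simp_rw [spow_neg, mul_neg]
    rw [intervalIntegral.integral_neg, h.eqF s hs]; ring
  · simp_rw [spow_neg, mul_neg]
    rw [intervalIntegral.integral_neg, h.eqG s hs]; ring

theorem Sol.glue {z : ℝ} {F' G' : ℝ → ℝ} (hp' : 1 < p') (hq : 1 < q) (hU : Integrable U)
    (hV : Integrable V) (hxy : x ≤ y) (hyz : y ≤ z)
    (h : Sol p' q U V lam x y F G) (h' : Sol p' q U V lam y z F' G') (eF : F y = F' y)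
    (eG : G y = G' y) :
    Sol p' q U V lam x z (fun t => if t ≤ y then F t else F' t)
      (fun t => if t ≤ y then G t else G' t) := by
  set F₁ : ℝ → ℝ := fun t => if t ≤ y then F t else F' t with hF₁
  set G₁ : ℝ → ℝ := fun t => if t ≤ y then G t else G' t with hG₁
  have aF : EqOn F₁ F (Icc x y) := fun t ht => if_pos ht.2
  have aG : EqOn G₁ G (Icc x y) := fun t ht => if_pos ht.2
  have bF : EqOn F₁ F' (Icc y z) := fun t ht => by
    rcases ht.1.eq_or_lt with rfl | hlt
    · simp [hF₁, eF]
    · exact if_neg (not_le.2 hlt)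
  have bG : EqOn G₁ G' (Icc y z) := fun t ht => by
    rcases ht.1.eq_or_lt with rfl | hlt
    · simp [hG₁, eG]
    · exact if_neg (not_le.2 hlt)
  have s1 := h.congr aF aG
  have s2 := h'.congr bF bG
  have hun : Icc x y ∪ Icc y z = Icc x z := Icc_union_Icc_eq_Icc hxy hyz
  have cF : ContinuousOn F₁ (Icc x z) :=
    hun ▸ s1.contF.union_of_isClosed s2.contF isClosed_Icc isClosed_Icc
  have cG : ContinuousOn G₁ (Icc x z) :=
    hun ▸ s1.contG.union_of_isClosed s2.contG isClosed_Icc isClosed_Icc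
  have iU : ∀ a b, a ∈ Icc x z → b ∈ Icc x z →
      IntervalIntegrable (fun r => U r * spow p' (G₁ r)) volume a b := fun a b ha hb =>
    intervalIntegrable_mul_spow hp' hU (cG.mono (ordConnected_Icc.uIcc_subset ha hb))
  have iV : ∀ a b, a ∈ Icc x z → b ∈ Icc x z →
      IntervalIntegrable (fun r => V r * spow q (F₁ r)) volume a b := fun a b ha hb =>
    intervalIntegrable_mul_spow hq hV (cF.mono (ordConnected_Icc.uIcc_subset ha hb))
  have mx : x ∈ Icc x z := ⟨le_rfl, hxy.trans hyz⟩
  have my : y ∈ Icc x z := ⟨hxy, hyz⟩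
  refine ⟨cF, cG, fun s hs => ?_, fun s hs => ?_⟩
  · rcases le_total s y with hsy | hsy
    · exact s1.eqF s ⟨hs.1, hsy⟩
    · have e1 := s1.eqF y ⟨hxy, le_rfl⟩
      have e2 := s2.eqF s ⟨hsy, hs.2⟩
      rw [← intervalIntegral.integral_add_adjacent_intervals (iU x y mx my) (iU y s my hs)]
      linarith
  · rcases le_total s y with hsy | hsy
    · exact s1.eqG s ⟨hs.1, hsy⟩
    · have e1 := s1.eqG y ⟨hxy, le_rfl⟩
      have e2 := s2.eqG s ⟨hsy, hs.2⟩
      rw [← intervalIntegral.integral_add_adjacent_intervals (iV x y mx my) (iV y s my hs)]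
      linarith

/-- The energy identity. -/
theorem Sol.energy (h : Sol p' q U V lam x y F G) (hp' : 1 < p') (hq : 1 < q) (hU : Integrable U)
    (hV : Integrable V) (hxy : x ≤ y) :
    ∫ t in x..y, U t * |G t| ^ p' =
      F y * G y - F x * G x + lam * ∫ t in x..y, V t * |F t| ^ q := by
  have hu : uIcc x y = Icc x y := uIcc_of_le hxy
  have iU := intervalIntegrable_mul_spow hp' hU (s := x) (t := y) (hu ▸ h.contG)
  have iV := intervalIntegrable_mul_spow hq hV (s := x) (t := y) (hu ▸ h.contF)
  have acF0 := iU.absolutelyContinuousOnInterval_intervalIntegral (c := x) (by simp)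
  have acG0 := (iV.const_mul lam).absolutelyContinuousOnInterval_intervalIntegral (c := x) (by simp)
  -- On the interval these are `F - F x` and `G x - G`, written as integrals so that integration by
  -- parts for absolutely continuous functions applies.
  set F1 : ℝ → ℝ := fun s => ∫ t in x..s, U t * spow p' (G t) with hF1
  set G1 : ℝ → ℝ := fun s => ∫ t in x..s, lam * (V t * spow q (F t)) with hG1
  have hparts := acF0.integral_deriv_mul_eq_sub acG0
  have d1 : ∫ s in x..y, (deriv F1 s * G1 s + F1 s * deriv G1 s) =
      ∫ s in x..y, (U s * spow p' (G s) * (G x - G s) + (F s - F x) * (lam * (V s * spow q (F s)))) := by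
    refine intervalIntegral.integral_congr_ae ?_
    filter_upwards [iU.ae_hasDerivAt_integral, (iV.const_mul lam).ae_hasDerivAt_integral]
      with s h1 h2 hs
    have hs' : s ∈ uIcc x y := uIoc_subset_uIcc hs
    rw [(h1 hs' x (by simp)).deriv, (h2 hs' x (by simp)).deriv]
    rw [hu] at hs'
    have e1 := h.eqF s hs'
    have e2 := h.eqG s hs'
    rw [← intervalIntegral.integral_const_mul] at e2
    simp only [hF1, hG1]
    rw [show (∫ t in x..s, lam * (V t * spow q (F t))) = G x - G s by linarith,
      show (∫ t in x..s, U t * spow p' (G t)) = F s - F x by linarith]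
  have hy : y ∈ Icc x y := ⟨hxy, le_rfl⟩
  have e1 := h.eqF y hy
  have e2 := h.eqG y hy
  rw [← intervalIntegral.integral_const_mul] at e2
  have f1 : F1 y = F y - F x := by simp only [hF1]; linarith
  have g1 : G1 y = G x - G y := by simp only [hG1]; linarith
  rw [d1, f1, g1] at hparts
  have f0 : F1 x = 0 := by simp [hF1]
  rw [f0] at hparts
  have iA : IntervalIntegrable (fun s => U s * |G s| ^ p') volume x y := by
    refine hU.intervalIntegrable.mul_continuousOn (hu ▸ ?_)
    exact h.contG.abs.rpow_const fun _ _ => Or.inr (by linarith)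
  have iB : IntervalIntegrable (fun s => V s * |F s| ^ q) volume x y := by
    refine hV.intervalIntegrable.mul_continuousOn (hu ▸ ?_)
    exact h.contF.abs.rpow_const fun _ _ => Or.inr (by linarith)
  have e3 : ∀ s, U s * spow p' (G s) * (G x - G s) + (F s - F x) * (lam * (V s * spow q (F s))) =
      (G x * (U s * spow p' (G s)) - U s * |G s| ^ p') +
        (lam * (V s * |F s| ^ q) - F x * (lam * (V s * spow q (F s)))) := fun s => by
    rw [← spow_mul_self hp', ← spow_mul_self hq]; ring
  simp_rw [e3] at hparts
  rw [intervalIntegral.integral_add ((iU.const_mul _).sub iA)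
    ((iB.const_mul lam).sub ((iV.const_mul lam).const_mul _)),
    intervalIntegral.integral_sub (iU.const_mul _) iA,
    intervalIntegral.integral_sub (iB.const_mul lam) ((iV.const_mul lam).const_mul _),
    intervalIntegral.integral_const_mul, intervalIntegral.integral_const_mul,
    intervalIntegral.integral_const_mul] at hparts
  rw [show (∫ t in x..y, lam * (V t * spow q (F t))) = G x - G y by linarith,
    show (∫ t in x..y, U t * spow p' (G t)) = F y - F x by linarith] at hparts
  linarith

/-- The trivial solution is isolated: a solution with a common zero of `F` and `G` vanishes. -/
theorem Sol.eq_zero (h : Sol p' q U V lam x y F G) (hpp : p.HolderConjugate p') (hpq : p ≤ q)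
    (hU : Integrable U) (hV : Integrable V) (hU0 : ∀ t, 0 ≤ U t) (hV0 : ∀ t, 0 ≤ V t)
    {c : ℝ} (hc : c ∈ Icc x y) (hF : F c = 0) (hG : G c = 0) :
    ∀ t ∈ Icc x y, F t = 0 ∧ G t = 0 := by
  have hp' := hpp.symm.lt
  have hq : 1 < q := hpp.lt.trans_le hpq
  have hxy : x ≤ y := hc.1.trans hc.2
  obtain ⟨B, hB⟩ := isCompact_Icc.exists_bound_of_continuousOn h.contF
  set B' := max B 1 with hB'
  have hB1 : 0 < B' := lt_max_of_lt_right one_pos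
  have hBF : ∀ t ∈ Icc x y, |F t| ≤ B' := fun t ht => (hB t ht).trans (le_max_left _ _)
  -- Here `p ≤ q` enters: since `(p - 1) * (p' - 1) = 1`, the composition of the two nonlinearities
  -- is at least linear near zero.
  set θ := (q - 1) * (p' - 1) with hθ
  have hθ1 : 1 ≤ θ := by
    have : (p - 1) * (p' - 1) = 1 := by have := hpp.mul_eq_add; nlinarith
    have := mul_nonneg (sub_nonneg.2 hpq) (sub_pos.2 hp').le
    rw [hθ]; nlinarith
  set ν := |lam| * ∫ t, V t with hν
  have hν0 : 0 ≤ ν := mul_nonneg (abs_nonneg _) (integral_nonneg hV0)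
  -- local vanishing
  have hlocal : ∀ c ∈ Icc x y, F c = 0 → G c = 0 →
      ∃ δ > 0, ∀ t ∈ Icc x y, |t - c| < δ → F t = 0 ∧ G t = 0 := by
    intro c hc hFc hGc
    -- As `m ^ θ ≤ B' ^ (θ - 1) * m`, the constant `κ` bounds one loop through both equations. Where
    -- `U` has mass at most `1 / (2 * κ)`, the maximum `m` of `|F|` is at most half of itself.
    set κ := ν ^ (p' - 1) * B' ^ (θ - 1) + 1 with hκ
    have hκ0 : 0 < κ := by positivity
    have hcont := (continuous_prim hU).continuousAt (x := c)
    obtain ⟨δ, hδ, hδ'⟩ := Metric.continuousAt_iff.1 hcont (1 / (2 * κ)) (by positivity)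
    refine ⟨δ, hδ, fun t ht htc => ?_⟩
    have hsub : uIcc c t ⊆ Icc x y := ordConnected_Icc.uIcc_subset hc ht
    obtain ⟨s, hs, hmax⟩ := isCompact_uIcc.exists_isMaxOn (nonempty_uIcc (a := c) (b := t))
      (h.contF.mono hsub).abs
    set m := |F s| with hm
    have hm0 : 0 ≤ m := abs_nonneg _
    have hmB : m ≤ B' := hBF s (hsub hs)
    have bG : ∀ r ∈ uIcc c t, |G r| ≤ ν * m ^ (q - 1) := by
      intro r hr
      have e := h.sub_G hq hV hc (hsub hr)
      rw [hGc, sub_zero] at e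
      rw [e, abs_mul, abs_neg, hν, mul_assoc]
      refine mul_le_mul_of_nonneg_left ?_ (abs_nonneg _)
      have hle : ∀ τ ∈ uIoc c r, ‖V τ * spow q (F τ)‖ ≤ V τ * m ^ (q - 1) := by
        intro τ hτ
        have hτ' : τ ∈ uIcc c t := uIcc_subset_uIcc left_mem_uIcc hr (uIoc_subset_uIcc hτ)
        rw [Real.norm_eq_abs, abs_mul, abs_of_nonneg (hV0 τ)]
        exact mul_le_mul_of_nonneg_left (abs_spow_le hq (hmax hτ')) (hV0 τ)
      have := intervalIntegral.norm_integral_le_abs_of_norm_le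
        (ae_restrict_of_forall_mem measurableSet_uIoc hle) ((hV.mul_const _).intervalIntegrable)
      rw [Real.norm_eq_abs] at this
      refine this.trans ?_
      rw [intervalIntegral.integral_mul_const, abs_mul,
        abs_of_nonneg (Real.rpow_nonneg hm0 (q - 1))]
      refine mul_le_mul_of_nonneg_right ?_ (Real.rpow_nonneg hm0 _)
      rw [← Real.norm_eq_abs, intervalIntegral.norm_intervalIntegral_eq, Real.norm_eq_abs,
        abs_of_nonneg (integral_nonneg hV0)]
      exact setIntegral_le_integral hV (.of_forall hV0)
    have bm : m ≤ 1 / 2 * m := by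
      have e := h.sub_F hp' hU hc (hsub hs)
      rw [hFc, sub_zero] at e
      have hle : ∀ τ ∈ uIoc c s, ‖U τ * spow p' (G τ)‖ ≤ U τ * (ν * m ^ (q - 1)) ^ (p' - 1) := by
        intro τ hτ
        have hτ' : τ ∈ uIcc c t := uIcc_subset_uIcc left_mem_uIcc hs (uIoc_subset_uIcc hτ)
        rw [Real.norm_eq_abs, abs_mul, abs_of_nonneg (hU0 τ)]
        exact mul_le_mul_of_nonneg_left (abs_spow_le hp' (bG τ hτ')) (hU0 τ)
      have h1 := intervalIntegral.norm_integral_le_abs_of_norm_le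
        (ae_restrict_of_forall_mem measurableSet_uIoc hle) ((hU.mul_const _).intervalIntegrable)
      rw [Real.norm_eq_abs, ← e, intervalIntegral.integral_mul_const, abs_mul,
        ← prim_sub hU] at h1
      have hsc : |s - c| < δ := lt_of_le_of_lt (abs_sub_left_of_mem_uIcc hs) htc
      have h2 := hδ' (by rwa [Real.dist_eq] : dist s c < δ)
      rw [Real.dist_eq] at h2
      rw [Real.mul_rpow hν0 (Real.rpow_nonneg hm0 _), ← Real.rpow_mul hm0, ← hθ,
        abs_of_nonneg (show 0 ≤ ν ^ (p' - 1) * m ^ θ by positivity)] at h1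
      have h3 : m ^ θ ≤ B' ^ (θ - 1) * m := by
        rcases hm0.eq_or_lt with h0 | h0
        · rw [← h0, Real.zero_rpow (by linarith), mul_zero]
        · conv_lhs => rw [show θ = (θ - 1) + 1 by ring, Real.rpow_add_one h0.ne']
          exact mul_le_mul_of_nonneg_right (Real.rpow_le_rpow hm0 hmB (by linarith)) hm0
      calc m ≤ |prim U s - prim U c| * (ν ^ (p' - 1) * m ^ θ) := h1
        _ ≤ 1 / (2 * κ) * (ν ^ (p' - 1) * (B' ^ (θ - 1) * m)) := by gcongr
        _ = 1 / (2 * κ) * ((ν ^ (p' - 1) * B' ^ (θ - 1)) * m) := by ring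
        _ ≤ 1 / (2 * κ) * (κ * m) := by gcongr; linarith
        _ = 1 / 2 * m := by field_simp
    have hm00 : m = 0 := by linarith
    constructor
    · have : |F t| ≤ m := hmax (right_mem_uIcc (a := c) (b := t))
      rw [hm00] at this
      exact abs_eq_zero.1 (le_antisymm this (abs_nonneg _))
    · have := bG t right_mem_uIcc
      rw [hm00, Real.zero_rpow (by linarith), mul_zero] at this
      exact abs_eq_zero.1 (le_antisymm this (abs_nonneg _))
  -- connectedness
  have hcl : IsClopen {t : Icc x y | F t = 0 ∧ G t = 0} := by
    constructor
    · exact (isClosed_eq h.contF.domRestrict continuous_const).inter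
        (isClosed_eq h.contG.domRestrict continuous_const)
    · rw [Metric.isOpen_iff]
      rintro ⟨t, ht⟩ ⟨h1, h2⟩
      obtain ⟨δ, hδ, hδ'⟩ := hlocal t ht h1 h2
      exact ⟨δ, hδ, fun s hs => hδ' s s.2 (by rwa [Metric.mem_ball, Subtype.dist_eq, Real.dist_eq] at hs)⟩
  have : PreconnectedSpace (Icc x y) := isPreconnected_iff_preconnectedSpace.1 isPreconnected_Icc
  rcases isClopen_iff.1 hcl with h0 | h0
  · exact absurd (show (⟨c, hc⟩ : Icc x y) ∈ {t : Icc x y | F t = 0 ∧ G t = 0} from ⟨hF, hG⟩)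
      (by rw [h0]; exact notMem_empty _)
  · intro t ht
    exact (h0 ▸ mem_univ _ : (⟨t, ht⟩ : Icc x y) ∈ {t : Icc x y | F t = 0 ∧ G t = 0})

end sol

/-! ### Best constants on subintervals and extremals as solutions of the system -/

/-- The function `|w|^s`. -/
noncomputable def pw (s : ℝ) (w : ℝ → ℝ) (t : ℝ) : ℝ := |w t| ^ s

/-- Standing assumptions on the weights, which are extended by zero outside `[a, b]`. -/
structure Weights (a b p p' q : ℝ) (u v : ℝ → ℝ) : Prop where
  hab : a < b
  conj : p.HolderConjugate p'
  hpq : p ≤ q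
  hu : MemL p' u
  hv : MemL q v
  upos : ∀ x ∈ Icc a b, 0 < u x
  vpos : ∀ x ∈ Icc a b, 0 < v x
  uzero : ∀ x ∉ Icc a b, u x = 0
  vzero : ∀ x ∉ Icc a b, v x = 0

/-- The best constant of the Hardy operator on `[x, y]`. -/
noncomputable def kap (p q : ℝ) (u v : ℝ → ℝ) (D : Prop) (x y : ℝ) : ℝ :=
  hK p q D ((Icc x y).indicator u) ((Icc x y).indicator v)

section arcs

variable {a b p p' q : ℝ} {u v : ℝ → ℝ} {D : Prop} {x y : ℝ}

theorem Weights.one_lt_p' (W : Weights a b p p' q u v) : 1 < p' := W.conj.symm.lt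

theorem Weights.one_lt_q (W : Weights a b p p' q u v) : 1 < q := W.conj.lt.trans_le W.hpq

theorem Weights.integrable_U (W : Weights a b p p' q u v) : Integrable (pw p' u) :=
  W.hu.integrable_rpow W.conj.symm.pos

theorem Weights.integrable_V (W : Weights a b p p' q u v) : Integrable (pw q v) :=
  W.hv.integrable_rpow (by linarith [W.one_lt_q])

theorem pw_nonneg (s : ℝ) (w : ℝ → ℝ) (t : ℝ) : 0 ≤ pw s w t := Real.rpow_nonneg (abs_nonneg _) _

theorem Weights.U_pos (W : Weights a b p p' q u v) {t : ℝ} (ht : t ∈ Icc a b) : 0 < pw p' u t :=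
  Real.rpow_pos_of_pos (abs_pos.2 (W.upos t ht).ne') _

theorem Weights.V_pos (W : Weights a b p p' q u v) {t : ℝ} (ht : t ∈ Icc a b) : 0 < pw q v t :=
  Real.rpow_pos_of_pos (abs_pos.2 (W.vpos t ht).ne') _

theorem integral_pos_of_pos_on {w : ℝ → ℝ} {s t : ℝ} (hst : s < t)
    (hi : IntervalIntegrable w volume s t) (h : ∀ r ∈ Ioo s t, 0 < w r) : 0 < ∫ r in s..t, w r :=
  intervalIntegral.intervalIntegral_pos_of_pos_on hi h hst

theorem Weights.integral_U_pos (W : Weights a b p p' q u v) {s t : ℝ} (hs : a ≤ s) (hst : s < t)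
    (ht : t ≤ b) : 0 < ∫ r in s..t, pw p' u r :=
  integral_pos_of_pos_on hst W.integrable_U.intervalIntegrable
    fun _ hr => W.U_pos ⟨hs.trans hr.1.le, hr.2.le.trans ht⟩

theorem Weights.integral_V_pos (W : Weights a b p p' q u v) {s t : ℝ} (hs : a ≤ s) (hst : s < t)
    (ht : t ≤ b) : 0 < ∫ r in s..t, pw q v r :=
  integral_pos_of_pos_on hst W.integrable_V.intervalIntegrable
    fun _ hr => W.V_pos ⟨hs.trans hr.1.le, hr.2.le.trans ht⟩

theorem Weights.memU (W : Weights a b p p' q u v) (x y : ℝ) : MemL p' ((Icc x y).indicator u) :=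
  W.hu.indicator' measurableSet_Icc

theorem Weights.memV (W : Weights a b p p' q u v) (x y : ℝ) : MemL q ((Icc x y).indicator v) :=
  W.hv.indicator' measurableSet_Icc

theorem prim_indicator_Icc {w : ℝ → ℝ} {s : ℝ} (hs : s ∈ Icc x y) :
    prim ((Icc x y).indicator w) s = ∫ t in x..s, w t := by
  rw [prim, setIntegral_indicator measurableSet_Icc, intervalIntegral.integral_of_le hs.1,
    ← integral_Icc_eq_integral_Ioc]
  congr 2
  ext t
  simp only [mem_inter_iff, mem_Iic, mem_Icc]
  have := hs.2
  constructor
  · rintro ⟨h1, h2, -⟩; exact ⟨h2, h1⟩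
  · rintro ⟨h1, h2⟩; exact ⟨h2, h1, h2.trans this⟩

theorem integral_indicator_Icc {w : ℝ → ℝ} (hxy : x ≤ y) :
    ∫ t, (Icc x y).indicator w t = ∫ t in x..y, w t := by
  rw [integral_indicator measurableSet_Icc, integral_Icc_eq_integral_Ioc,
    intervalIntegral.integral_of_le hxy]

theorem integral_abs_indicator_rpow {s : ℝ} (hs : 0 < s) {w : ℝ → ℝ} (hxy : x ≤ y) :
    ∫ t, |(Icc x y).indicator w t| ^ s = ∫ t in x..y, |w t| ^ s := by
  rw [← integral_indicator_Icc hxy]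
  congr 1; ext t
  simp only [Set.indicator]; split_ifs <;> simp [Real.zero_rpow hs.ne']

/-- The defining inequality of the best constant, for a function on `[x, y]`. -/
theorem Weights.integral_le_kap (W : Weights a b p p' q u v) (hxy : x ≤ y) {f : ℝ → ℝ}
    (hf : MemL p f) (hD : D → ∫ t in x..y, f t * u t = 0) :
    ∫ s in x..y, pw q v s * |∫ t in x..s, f t * u t| ^ q ≤
      kap p q u v D x y ^ q * (∫ t in x..y, |f t| ^ p) ^ (q / p) := by
  have hq := W.one_lt_q
  have hq0 : 0 < q := by linarith
  have hp0 := W.conj.pos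
  have e : ∀ t, (Icc x y).indicator f t * (Icc x y).indicator u t =
      (Icc x y).indicator (fun t => f t * u t) t := fun t => by
    simp only [Set.indicator]; split_ifs <;> simp
  have hmf : MemL p ((Icc x y).indicator f) := hf.indicator' measurableSet_Icc
  have h1 := nrm_opT_le_hK W.conj hq0 (W.memU x y) (W.memV x y) hmf (D := D) (fun hd => by
    simp_rw [e]; rw [integral_indicator_Icc hxy, hD hd])
  have h2 := Real.rpow_le_rpow (nrm_nonneg _ _) h1 hq0.le
  rw [nrm_rpow hq0, Real.mul_rpow hK_nonneg (nrm_nonneg _ _)] at h2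
  have e2 : nrm p ((Icc x y).indicator f) ^ q = (∫ t in x..y, |f t| ^ p) ^ (q / p) := by
    rw [nrm, integral_abs_indicator_rpow hp0 hxy, ← Real.rpow_mul]
    · congr 1; field_simp
    · exact intervalIntegral.integral_nonneg hxy fun _ _ => Real.rpow_nonneg (abs_nonneg _) _
  rw [e2] at h2
  refine le_trans (le_of_eq ?_) h2
  rw [← integral_indicator_Icc hxy]
  congr 1; ext s
  by_cases hs : s ∈ Icc x y
  · simp only [opT, e]
    rw [prim_indicator_Icc hs, indicator_of_mem hs, indicator_of_mem hs, abs_mul,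
      Real.mul_rpow (abs_nonneg _) (abs_nonneg _), pw]
  · simp [opT, indicator_of_notMem hs, Real.zero_rpow hq0.ne']

theorem memL_spow_mul_indicator (W : Weights a b p p' q u v) {h : ℝ → ℝ}
    (hm : AEStronglyMeasurable h (volume.restrict (Icc x y))) {C : ℝ}
    (hC : ∀ t ∈ Icc x y, |h t| ≤ C) :
    MemL p fun t => spow p' (u t) * (Icc x y).indicator h t := by
  refine memL_mul_of_bounded (W.hu.spow W.conj)
    ((aestronglyMeasurable_indicator_iff measurableSet_Icc).2 hm) (C := max C 0) fun t => ?_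
  by_cases ht : t ∈ Icc x y
  · rw [indicator_of_mem ht]; exact (hC t ht).trans (le_max_left _ _)
  · rw [indicator_of_notMem ht, abs_zero]; exact le_max_right _ _

/-- The same inequality with the competitor written as a density with respect to `u^{p'}`. -/
theorem Weights.integral_le_kap' (W : Weights a b p p' q u v) (hxy : x ≤ y) {h : ℝ → ℝ}
    (hm : AEStronglyMeasurable h (volume.restrict (Icc x y))) {C : ℝ}
    (hC : ∀ t ∈ Icc x y, |h t| ≤ C) (hD : D → ∫ t in x..y, pw p' u t * h t = 0) :
    ∫ s in x..y, pw q v s * |∫ t in x..s, pw p' u t * h t| ^ q ≤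
      kap p q u v D x y ^ q * (∫ t in x..y, pw p' u t * |h t| ^ p) ^ (q / p) := by
  have hp' := W.one_lt_p'
  have key : ∀ s ∈ Icc x y, ∫ t in x..s, spow p' (u t) * (Icc x y).indicator h t * u t =
      ∫ t in x..s, pw p' u t * h t := fun s hs => by
    refine intervalIntegral.integral_congr fun t ht => ?_
    rw [uIcc_of_le hs.1] at ht
    simp only [indicator_of_mem (show t ∈ Icc x y from ⟨ht.1, ht.2.trans hs.2⟩), pw,
      ← spow_mul_self hp']
    ring
  have := W.integral_le_kap (D := D) hxy (memL_spow_mul_indicator W hm hC) (fun hd => by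
    rw [key y ⟨hxy, le_rfl⟩, hD hd])
  refine (le_of_eq ?_).trans (this.trans_eq ?_)
  · refine intervalIntegral.integral_congr fun s hs => ?_
    rw [uIcc_of_le hxy] at hs
    simp only [key s hs]
  · congr 2
    refine intervalIntegral.integral_congr fun t ht => ?_
    rw [uIcc_of_le hxy] at ht
    simp only [indicator_of_mem ht, abs_mul]
    rw [Real.mul_rpow (abs_nonneg _) (abs_nonneg _), abs_spow_rpow W.conj, pw]

/-- Starting from a zero, `F` is the primitive of `f u` with `f = (u G)_{(p')}`, and `|f| ^ p =
u^{p'} |G|^{p'}`; Hardy's inequality thus bounds the mass of `F` by the energy of `G`. -/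
theorem Sol.integral_le_kap (W : Weights a b p p' q u v) (hxy : x ≤ y) {lam : ℝ} {F G : ℝ → ℝ}
    (h : Sol p' q (pw p' u) (pw q v) lam x y F G) (hF : F x = 0) (hD : D → F y = 0) :
    ∫ s in x..y, pw q v s * |F s| ^ q ≤
      kap p q u v D x y ^ q * (∫ t in x..y, pw p' u t * |G t| ^ p') ^ (q / p) := by
  have hc := (continuous_spow W.one_lt_p').comp_continuousOn h.contG
  obtain ⟨C, hC⟩ := isCompact_Icc.exists_bound_of_continuousOn hc
  have e : ∀ s ∈ Icc x y, ∫ t in x..s, pw p' u t * spow p' (G t) = F s := fun s hs => by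
    rw [h.eqF s hs, hF, zero_add]
  have := W.integral_le_kap' (D := D) hxy (h := fun t => spow p' (G t))
    (hc.aestronglyMeasurable measurableSet_Icc) hC (fun hd => by rw [e y ⟨hxy, le_rfl⟩, hD hd])
  simp_rw [abs_spow_rpow W.conj] at this
  refine (le_of_eq ?_).trans this
  refine intervalIntegral.integral_congr fun s hs => ?_
  rw [uIcc_of_le hxy] at hs
  simp only [e s hs]

theorem kap_nonneg : 0 ≤ kap p q u v D x y := hK_nonneg

theorem kap_mono (W : Weights a b p p' q u v) {x' y' : ℝ} (hx : x ≤ x') (hy : y' ≤ y) :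
    kap p q u v D x' y' ≤ kap p q u v D x y := by
  have := hK_indicator_le (D := D) W.conj (by linarith [W.one_lt_q]) (W.memU x y) (W.memV x y)
    (S := Icc x' y') measurableSet_Icc
  rwa [indicator_indicator, indicator_indicator,
    inter_eq_left.2 (Icc_subset_Icc hx hy)] at this

/-- The density `1` on the left half and a balancing constant `-c` on the right half give a
competitor that satisfies even the two-sided condition, with a positive primitive on the left half.
-/
theorem kap_pos (W : Weights a b p p' q u v) (hx : a ≤ x) (hxy : x < y) (hy : y ≤ b) :
    0 < kap p q u v D x y := by
  refine lt_of_lt_of_le ?_ (le_hK_true W.conj (by linarith [W.one_lt_q]) (W.memU x y) (W.memV x y))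
  change 0 < kap p q u v True x y
  have hq0 : 0 < q := by linarith [W.one_lt_q]
  by_contra hcon
  have h0 : kap p q u v True x y = 0 := le_antisymm (not_lt.1 hcon) kap_nonneg
  set m := (x + y) / 2 with hm
  have hxm : x < m := by rw [hm]; linarith
  have hmy : m < y := by rw [hm]; linarith
  set c := (∫ t in x..m, pw p' u t) / ∫ t in m..y, pw p' u t with hc
  have h2 := W.integral_U_pos (hx.trans hxm.le) hmy hy
  set h : ℝ → ℝ := fun t => if t ≤ m then 1 else -c with hh
  have hmeas : Measurable h := Measurable.ite measurableSet_Iic measurable_const measurable_const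
  have hbd : ∀ t, |h t| ≤ 1 + |c| := fun t => by
    simp only [hh]; split_ifs
    · rw [abs_one]; linarith [abs_nonneg c]
    · rw [abs_neg]; linarith
  have hi : ∀ s t, IntervalIntegrable (fun r => pw p' u r * h r) volume s t := fun s t =>
    (W.integrable_U.mul_bdd (c := 1 + |c|) hmeas.aestronglyMeasurable
      (.of_forall hbd)).intervalIntegrable
  have e1 : ∀ s ∈ Icc x m, ∫ t in x..s, pw p' u t * h t = ∫ t in x..s, pw p' u t := by
    intro s hs
    refine intervalIntegral.integral_congr fun t ht => ?_
    rw [uIcc_of_le hs.1] at ht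
    simp [hh, ht.2.trans hs.2]
  have e2 : ∫ t in m..y, pw p' u t * h t = -∫ t in x..m, pw p' u t := by
    have : ∫ t in m..y, pw p' u t * h t = ∫ t in m..y, pw p' u t * (-c) := by
      refine intervalIntegral.integral_congr_ae (.of_forall fun t ht => ?_)
      rw [uIoc_of_le hmy.le] at ht
      simp [hh, not_le.2 ht.1]
    rw [this, intervalIntegral.integral_mul_const, hc]
    field_simp
  have := W.integral_le_kap' (D := True) hxy.le hmeas.aestronglyMeasurable (fun t _ => hbd t)
    (fun _ => by
      rw [← intervalIntegral.integral_add_adjacent_intervals (hi x m) (hi m y),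
        e1 m ⟨hxm.le, le_rfl⟩, e2]
      ring)
  rw [h0, Real.zero_rpow hq0.ne', zero_mul] at this
  have hFc : Continuous fun s => ∫ t in x..s, pw p' u t * h t :=
    intervalIntegral.continuous_primitive hi x
  have hi2 : ∀ s t, IntervalIntegrable (fun s => pw q v s * |∫ t in x..s, pw p' u t * h t| ^ q)
      volume s t := fun s t =>
    W.integrable_V.intervalIntegrable.mul_continuousOn
      (hFc.abs.rpow_const fun _ => Or.inr hq0.le).continuousOn
  have hpos : 0 < ∫ s in x..m, pw q v s * |∫ t in x..s, pw p' u t * h t| ^ q := by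
    refine integral_pos_of_pos_on hxm (hi2 _ _) fun s hs => ?_
    have hsb : s ≤ b := hs.2.le.trans (hmy.le.trans hy)
    rw [e1 s ⟨hs.1.le, hs.2.le⟩]
    have := W.integral_U_pos hx hs.1 hsb
    have h3 := W.V_pos (t := s) ⟨hx.trans hs.1.le, hsb⟩
    positivity
  have hnn : 0 ≤ ∫ s in m..y, pw q v s * |∫ t in x..s, pw p' u t * h t| ^ q :=
    intervalIntegral.integral_nonneg hmy.le fun s _ =>
      mul_nonneg (pw_nonneg _ _ _) (Real.rpow_nonneg (abs_nonneg _) _)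
  rw [← intervalIntegral.integral_add_adjacent_intervals (hi2 x m) (hi2 m y)] at this
  linarith

/-- An extremal function on `[x, y]` yields a solution of the system. -/
theorem extremal_sol (W : Weights a b p p' q u v) (hx : a ≤ x) (hxy : x < y) (hy : y ≤ b)
    {f : ℝ → ℝ} (hf : Adm p D ((Icc x y).indicator u) f)
    (hmax : nrm q (opT ((Icc x y).indicator u) ((Icc x y).indicator v) f) = kap p q u v D x y) :
    ∃ F G : ℝ → ℝ, Sol p' q (pw p' u) (pw q v) (kap p q u v D x y ^ q)⁻¹ x y F G ∧ F x = 0 ∧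
      (D → F y = 0) ∧ (¬ D → G y = 0) ∧ ∫ t in x..y, pw p' u t * |G t| ^ p' = 1 ∧
      (∀ᵐ t, f t = (Icc x y).indicator (fun t => spow p' (u t) * spow p' (G t)) t) := by
  have hq := W.one_lt_q
  have hp' := W.one_lt_p'
  have hK := kap_pos (D := D) W hx hxy hy
  obtain ⟨hn, γ, hγ, hae⟩ := extremal_eq W.conj hq (W.memU x y) (W.memV x y) hK hf hmax
  set K := kap p q u v D x y with hKd
  change ∀ᵐ t, f t = spow p' ((Icc x y).indicator u t * (γ + (K ^ q)⁻¹ * _)) at hae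
  have hfu := hf.memL.integrable_mul W.conj (W.memU x y)
  set F := prim (fun t => f t * (Icc x y).indicator u t) with hF
  have hFc : Continuous F := continuous_prim hfu
  have hA : (fun t => (Icc x y).indicator v t *
      spow q (opT ((Icc x y).indicator u) ((Icc x y).indicator v) f t)) =
      (Icc x y).indicator (fun t => pw q v t * spow q (F t)) := by
    ext t
    by_cases ht : t ∈ Icc x y
    · simp only [opT, indicator_of_mem ht]
      rw [mul_comm, spow_mul_mul_self hq, pw]
    · simp [indicator_of_notMem ht]
  have hAint : Integrable ((Icc x y).indicator (fun t => pw q v t * spow q (F t))) := by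
    rw [← hA]
    exact integrable_mul_spow hq (W.memV x y) hFc.aestronglyMeasurable
      (abs_prim_mul_le W.conj (W.memU x y) hf.memL)
  rw [hA] at hae
  set G : ℝ → ℝ := fun s => γ + (K ^ q)⁻¹ * tail ((Icc x y).indicator
    (fun t => pw q v t * spow q (F t))) s with hG
  have hGc : Continuous G := continuous_const.add (continuous_const.mul (continuous_tail hAint))
  have hfe : ∀ᵐ t, f t = (Icc x y).indicator (fun t => spow p' (u t) * spow p' (G t)) t := by
    filter_upwards [hae] with t ht
    rw [ht]
    by_cases hm : t ∈ Icc x y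
    · simp only [indicator_of_mem hm, spow_mul, hG]
    · simp [indicator_of_notMem hm, spow_zero]
  have hfue : (fun t => f t * (Icc x y).indicator u t) =ᵐ[volume]
      (Icc x y).indicator (fun t => pw p' u t * spow p' (G t)) := by
    filter_upwards [hfe] with t ht
    rw [ht]
    by_cases hm : t ∈ Icc x y
    · simp only [indicator_of_mem hm, pw, ← spow_mul_self hp']; ring
    · simp [indicator_of_notMem hm]
  have hFe : ∀ s ∈ Icc x y, F s = ∫ t in x..s, pw p' u t * spow p' (G t) := fun s hs => by
    rw [hF, prim_congr hfue, prim_indicator_Icc hs]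
  have hFx : F x = 0 := by rw [hFe x ⟨le_rfl, hxy.le⟩, intervalIntegral.integral_same]
  refine ⟨F, G, ⟨hFc.continuousOn, hGc.continuousOn, fun s hs => ?_, fun s hs => ?_⟩, hFx,
    fun hd => ?_, fun hd => ?_, ?_, hfe⟩
  · rw [hFx, zero_add, hFe s hs]
  · simp only [hG]
    rw [tail_eq hAint, tail_eq hAint, prim_indicator_Icc hs,
      prim_indicator_Icc (show x ∈ Icc x y from ⟨le_rfl, hxy.le⟩), intervalIntegral.integral_same]
    ring
  · rw [← hf.integral_eq hd, hFe y ⟨hxy.le, le_rfl⟩, integral_congr_ae hfue,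
      integral_indicator_Icc hxy.le]
  · simp only [hG]
    rw [tail_eq hAint, prim_indicator_Icc (show y ∈ Icc x y from ⟨hxy.le, le_rfl⟩),
      integral_indicator_Icc hxy.le, hγ hd]
    ring
  · have h1 : ∫ t, |f t| ^ p = 1 := by rw [← nrm_rpow W.conj.pos, hn, Real.one_rpow]
    rw [← h1, ← integral_indicator_Icc hxy.le]
    refine integral_congr_ae ?_
    filter_upwards [hfe] with t ht
    rw [ht]
    by_cases hm : t ∈ Icc x y
    · simp only [indicator_of_mem hm, abs_mul]
      rw [Real.mul_rpow (abs_nonneg _) (abs_nonneg _), abs_spow_rpow W.conj,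
        abs_spow_rpow W.conj, pw]
    · simp [indicator_of_notMem hm, Real.zero_rpow W.conj.ne_zero]

theorem ContinuousOn.eq_zero_of_ae {s t : ℝ} {H : ℝ → ℝ} (hst : s < t)
    (hH : ContinuousOn H (Icc s t)) (h : ∀ᵐ r, r ∈ Icc s t → H r = 0) :
    ∀ r ∈ Icc s t, H r = 0 := by
  have h1 : ∫ r in s..t, |H r| = 0 := by
    rw [intervalIntegral.integral_of_le hst.le, ← integral_Icc_eq_integral_Ioc]
    refine (setIntegral_congr_ae (g := fun _ => (0:ℝ)) measurableSet_Icc ?_).trans (by simp)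
    filter_upwards [h] with r hr hm
    rw [hr hm, abs_zero]
  intro r hr
  by_contra hne
  have : 0 < ∫ r in s..t, |H r| :=
    intervalIntegral.integral_pos hst hH.abs (fun _ _ => abs_nonneg _) ⟨r, hr, abs_pos.2 hne⟩
  linarith

/-- An extremal function does not vanish on an interval. -/
theorem extremal_not_vanish (W : Weights a b p p' q u v) (hx : a ≤ x) (hxy : x < y) (hy : y ≤ b)
    {f : ℝ → ℝ} (hf : Adm p D ((Icc x y).indicator u) f)
    (hmax : nrm q (opT ((Icc x y).indicator u) ((Icc x y).indicator v) f) = kap p q u v D x y)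
    {s t : ℝ} (hs : x ≤ s) (hst : s < t) (ht : t ≤ y) (h0 : ∀ᵐ r, r ∈ Icc s t → f r = 0) :
    False := by
  have hq := W.one_lt_q
  have hp' := W.one_lt_p'
  obtain ⟨F, G, hS, -, -, -, hn, hfe⟩ := extremal_sol W hx hxy hy hf hmax
  have hsub : Icc s t ⊆ Icc x y := Icc_subset_Icc hs ht
  -- If `f` vanishes on `[s, t]`, so does `G`; then `F` is constant there, and constancy of `G`
  -- makes that constant zero. The zero solution is isolated, so `G` vanishes throughout `[x, y]`,
  -- against its normalization.
  have hG : ∀ r ∈ Icc s t, G r = 0 := by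
    refine ContinuousOn.eq_zero_of_ae hst (hS.contG.mono hsub) ?_
    filter_upwards [h0, hfe] with r h1 h2 hr
    have h3 := h1 hr
    rw [h2, indicator_of_mem (hsub hr)] at h3
    have hu := spow_pos hp' (W.upos r ⟨hx.trans (hs.trans hr.1), (hr.2.trans ht).trans hy⟩)
    exact (spow_eq_zero_iff hp').1 ((mul_eq_zero.1 h3).resolve_left hu.ne')
  have ms : s ∈ Icc x y := hsub ⟨le_rfl, hst.le⟩
  have hFs : ∀ r ∈ Icc s t, F r = F s := fun r hr => by
    have := hS.sub_F hp' W.integrable_U ms (hsub hr)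
    rw [intervalIntegral.integral_congr (g := fun _ => (0:ℝ)) (fun τ hτ => ?_)] at this
    · simp at this; linarith
    · rw [uIcc_of_le hr.1] at hτ
      simp [hG τ ⟨hτ.1, hτ.2.trans hr.2⟩, spow_zero]
  have hF0 : F s = 0 := by
    have := hS.sub_G hq W.integrable_V ms (hsub ⟨hst.le, le_rfl⟩)
    rw [hG t ⟨hst.le, le_rfl⟩, hG s ⟨le_rfl, hst.le⟩,
      intervalIntegral.integral_congr (g := fun r => pw q v r * spow q (F s)) (fun τ hτ => ?_),
      intervalIntegral.integral_mul_const] at this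
    · have hV := W.integral_V_pos (hx.trans hs) hst (ht.trans hy)
      have hK := kap_pos (D := D) W hx hxy hy
      have hl : (kap p q u v D x y ^ q)⁻¹ ≠ 0 := (inv_pos.2 (Real.rpow_pos_of_pos hK q)).ne'
      simp only [sub_self, zero_eq_mul, neg_eq_zero, hl, false_or] at this
      exact (spow_eq_zero_iff hq).1 ((mul_eq_zero.1 this).resolve_left hV.ne')
    · rw [uIcc_of_le hst.le] at hτ
      simp only [hFs τ hτ]
  have hall := hS.eq_zero W.conj W.hpq W.integrable_U W.integrable_V (pw_nonneg _ _)
    (pw_nonneg _ _) ms hF0 (hG s ⟨le_rfl, hst.le⟩)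
  rw [intervalIntegral.integral_congr (g := fun _ => (0:ℝ)) (fun τ hτ => ?_)] at hn
  · simp at hn
  · rw [uIcc_of_le hxy.le] at hτ
    simp [(hall τ hτ).2, Real.zero_rpow (by linarith : p' ≠ 0)]

end arcs

/-! ### Positivity of extremals and continuity of the best constants in the interval -/

section arcs

variable {a b p p' q : ℝ} {u v : ℝ → ℝ} {D : Prop} {x y : ℝ}

/-- On every interval there is a positive extremal solution. -/
theorem exists_arc (W : Weights a b p p' q u v) (D : Prop) (hx : a ≤ x) (hxy : x < y)
    (hy : y ≤ b) :
    ∃ F G : ℝ → ℝ, Sol p' q (pw p' u) (pw q v) (kap p q u v D x y ^ q)⁻¹ x y F G ∧ F x = 0 ∧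
      (D → F y = 0) ∧ (¬ D → G y = 0) ∧ (∀ t ∈ Ioo x y, 0 < F t) ∧
      ∫ t in x..y, pw p' u t * |G t| ^ p' = 1 := by
  have hq := W.one_lt_q
  have hp' := W.one_lt_p'
  have hq0 : 0 < q := by linarith
  have hp0 := W.conj.pos
  have hK := kap_pos (D := D) W hx hxy hy
  have hsupp : ∀ t ∉ Icc x y, (Icc x y).indicator v t = 0 := fun t ht => indicator_of_notMem ht _
  obtain ⟨f, hf, hmax⟩ := exists_extremal W.conj hq hxy.le (W.memU x y) (W.memV x y) hsupp hK
  change _ = kap p q u v D x y at hmax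
  obtain ⟨F, G, hS, hFx, hFy, hGy, hn, hfe⟩ := extremal_sol W hx hxy hy hf hmax
  set K := kap p q u v D x y with hKd
  have hKq : 0 < K ^ q := Real.rpow_pos_of_pos hK q
  have hGcont : ContinuousOn (fun t => |G t| ^ p') (Icc x y) :=
    hS.contG.abs.rpow_const fun _ _ => Or.inr (by linarith)
  -- At an interior zero `z` the truncation `f1` of `f` would again be extremal: the energy identity
  -- on `[x, z]` gives `‖T f1‖_q = K * N ^ (1 / q)` and `‖f1‖_p = N ^ (1 / p)`, and `N ^ (1 / q) ≥ N
  -- ^ (1 / p)` because `N ≤ 1` and `p ≤ q`. But `f1` vanishes beyond `z`, which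
  -- `extremal_not_vanish` excludes.
  have hne : ∀ z ∈ Ioo x y, F z ≠ 0 := by
    intro z hz hFz
    have hz' : z ∈ Icc x y := ⟨hz.1.le, hz.2.le⟩
    have hE := (hS.mono hp' hq W.integrable_U W.integrable_V le_rfl hz.1.le hz.2.le).energy hp' hq
      W.integrable_U W.integrable_V hz.1.le
    rw [hFz, hFx, zero_mul, zero_mul, sub_zero, zero_add] at hE
    set N := ∫ t in x..z, pw p' u t * |G t| ^ p' with hN
    have hI : ∫ t in x..z, pw q v t * |F t| ^ q = K ^ q * N := by
      rw [hE]; field_simp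
    set f1 : ℝ → ℝ := (Iic z).indicator f with hf1
    have mf1 : MemL p f1 := hf.memL.indicator' measurableSet_Iic
    have hf1e : f1 =ᵐ[volume] (Icc x z).indicator (fun t => spow p' (u t) * spow p' (G t)) := by
      filter_upwards [hfe] with t ht
      by_cases hm : t ∈ Iic z
      · rw [hf1, indicator_of_mem hm, ht]
        by_cases hm2 : x ≤ t
        · rw [indicator_of_mem (show t ∈ Icc x y from ⟨hm2, le_trans hm hz.2.le⟩),
            indicator_of_mem (show t ∈ Icc x z from ⟨hm2, hm⟩)]
        · rw [indicator_of_notMem (fun h => hm2 h.1), indicator_of_notMem (fun h => hm2 h.1)]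
      · rw [hf1, indicator_of_notMem hm, indicator_of_notMem (fun h => hm h.2)]
    have hf1u : (fun t => f1 t * (Icc x y).indicator u t) =ᵐ[volume]
        (Icc x z).indicator (fun t => pw p' u t * spow p' (G t)) := by
      filter_upwards [hf1e] with t ht
      rw [ht]
      by_cases hm : t ∈ Icc x z
      · rw [indicator_of_mem hm, indicator_of_mem hm,
          indicator_of_mem (show t ∈ Icc x y from ⟨hm.1, hm.2.trans hz.2.le⟩), pw,
          ← spow_mul_self hp']
        ring
      · simp [indicator_of_notMem hm]
    have hn1 : nrm p f1 ^ p = N := by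
      rw [nrm_congr hf1e, nrm_rpow hp0, integral_abs_indicator_rpow hp0 hz.1.le]
      refine intervalIntegral.integral_congr fun t _ => ?_
      simp only [abs_mul]
      rw [Real.mul_rpow (abs_nonneg _) (abs_nonneg _), abs_spow_rpow W.conj,
        abs_spow_rpow W.conj, pw]
    have hFz' : ∫ t in x..z, pw p' u t * spow p' (G t) = 0 := by
      have := hS.eqF z hz'
      rw [hFx, hFz] at this; linarith
    have hInt : ∫ t, f1 t * (Icc x y).indicator u t = 0 := by
      rw [integral_congr_ae hf1u, integral_indicator_Icc hz.1.le, hFz']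
    have hop : opT ((Icc x y).indicator u) ((Icc x y).indicator v) f1 =
        (Icc x z).indicator (fun t => v t * F t) := by
      ext s
      simp only [opT]
      rw [prim_congr hf1u]
      by_cases hs : s ∈ Icc x z
      · have hs' : s ∈ Icc x y := ⟨hs.1, hs.2.trans hz.2.le⟩
        rw [prim_indicator_Icc hs, indicator_of_mem hs, indicator_of_mem hs', hS.eqF s hs', hFx,
          zero_add]
      · rw [indicator_of_notMem hs]
        by_cases hs' : s ∈ Icc x y
        · have hzs : z ≤ s := by
            by_contra hcon; exact hs ⟨hs'.1, (not_le.1 hcon).le⟩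
          have : prim ((Icc x z).indicator fun t => pw p' u t * spow p' (G t)) s = 0 := by
            rw [prim, setIntegral_indicator measurableSet_Icc, inter_eq_right.2
              (fun t ht => ht.2.trans hzs), integral_Icc_eq_integral_Ioc,
              ← intervalIntegral.integral_of_le hz.1.le, hFz']
          rw [this, mul_zero]
        · rw [indicator_of_notMem hs', zero_mul]
    have hnop : nrm q (opT ((Icc x y).indicator u) ((Icc x y).indicator v) f1) ^ q = K ^ q * N := by
      rw [hop, nrm_rpow hq0, integral_abs_indicator_rpow hq0 hz.1.le, ← hI]
      refine intervalIntegral.integral_congr fun t _ => ?_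
      simp only [abs_mul]
      rw [Real.mul_rpow (abs_nonneg _) (abs_nonneg _), pw]
    have iN : ∀ s t, s ∈ Icc x y → t ∈ Icc x y →
        IntervalIntegrable (fun t => pw p' u t * |G t| ^ p') volume s t := fun s t hs ht =>
      W.integrable_U.intervalIntegrable.mul_continuousOn
        (hGcont.mono (ordConnected_Icc.uIcc_subset hs ht))
    have hnonneg : ∀ s t, s ≤ t → 0 ≤ ∫ t in s..t, pw p' u t * |G t| ^ p' := fun s t hst =>
      intervalIntegral.integral_nonneg hst fun r _ =>
        mul_nonneg (pw_nonneg _ _ _) (Real.rpow_nonneg (abs_nonneg _) _)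
    have hN1 : N ≤ 1 := by
      rw [← hn, ← intervalIntegral.integral_add_adjacent_intervals
        (iN x z ⟨le_rfl, hxy.le⟩ hz') (iN z y hz' ⟨hxy.le, le_rfl⟩)]
      linarith [hnonneg z y hz.2.le]
    -- If `N = 0` the truncation cannot be normalized, but then `f` itself vanishes on `[x, z]`.
    rcases (hnonneg x z hz.1.le).eq_or_lt with h0 | h0
    · refine extremal_not_vanish W hx hxy hy hf hmax le_rfl hz.1 hz.2.le ?_
      have hf10 : f1 =ᵐ[volume] 0 := by
        rw [← nrm_eq_zero_iff hp0 mf1]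
        have : nrm p f1 ^ p = 0 := by rw [hn1, hN, ← h0]
        exact (Real.rpow_eq_zero (nrm_nonneg _ _) hp0.ne').1 this
      filter_upwards [hf10] with t ht hm
      rwa [hf1, indicator_of_mem (show t ∈ Iic z from hm.2)] at ht
    · change 0 < N at h0
      have hnf : nrm p f1 = N ^ (1 / p) := by
        rw [← hn1, ← Real.rpow_mul (nrm_nonneg _ _), mul_one_div_cancel hp0.ne', Real.rpow_one]
      have hno : nrm q (opT ((Icc x y).indicator u) ((Icc x y).indicator v) f1) =
          K * N ^ (1 / q) := by
        rw [← Real.rpow_left_inj (nrm_nonneg _ _) (by positivity) hq0.ne', hnop,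
          Real.mul_rpow hK.le (by positivity), ← Real.rpow_mul h0.le,
          one_div_mul_cancel hq0.ne', Real.rpow_one]
      have hge : K * N ^ (1 / p) ≤ K * N ^ (1 / q) := by
        refine mul_le_mul_of_nonneg_left ?_ hK.le
        exact Real.rpow_le_rpow_of_exponent_ge h0 hN1 (one_div_le_one_div_of_le hp0 W.hpq)
      have hle := nrm_opT_le_hK W.conj hq0 (W.memU x y) (W.memV x y) (D := D) mf1 (fun _ => hInt)
      change _ ≤ K * _ at hle
      have hpos : 0 < nrm p f1 := by rw [hnf]; positivity
      have heq : nrm q (opT ((Icc x y).indicator u) ((Icc x y).indicator v) f1) =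
          K * nrm p f1 := le_antisymm hle (by rw [hno, hnf]; exact hge)
      have hadm : Adm p D ((Icc x y).indicator u) (fun t => (nrm p f1)⁻¹ * f1 t) := by
        refine ⟨mf1.const_mul _, ?_, fun _ => ?_⟩
        · rw [nrm_const_mul hp0, abs_of_pos (inv_pos.2 hpos), inv_mul_cancel₀ hpos.ne']
        · simp_rw [mul_assoc, integral_const_mul, hInt, mul_zero]
      refine extremal_not_vanish W hx hxy hy hadm ?_ (s := (z + y) / 2) (t := y)
        (by linarith [hz.1, hz.2]) (by linarith [hz.2]) le_rfl (.of_forall fun t ht => ?_)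
      · rw [opT_const_mul, nrm_const_mul hq0, heq, abs_of_pos (inv_pos.2 hpos)]
        field_simp
        exact hKd
      · rw [hf1, indicator_of_notMem, mul_zero]
        intro hm
        have h1 : t ≤ z := hm
        linarith [ht.1, hz.2]
  have hsign : (∀ t ∈ Ioo x y, 0 < F t) ∨ (∀ t ∈ Ioo x y, F t < 0) := by
    have hm : (x + y) / 2 ∈ Ioo x y := ⟨by linarith, by linarith⟩
    have hcF : ContinuousOn F (Ioo x y) := hS.contF.mono Ioo_subset_Icc_self
    rcases lt_or_gt_of_ne (hne _ hm) with h1 | h1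
    · right
      intro t ht
      by_contra hcon
      obtain ⟨s, hs, hs0⟩ := isPreconnected_Ioo.intermediate_value hm ht hcF
        (show (0:ℝ) ∈ Icc _ _ from ⟨h1.le, not_lt.1 hcon⟩)
      exact hne s hs hs0
    · left
      intro t ht
      by_contra hcon
      obtain ⟨s, hs, hs0⟩ := isPreconnected_Ioo.intermediate_value ht hm hcF
        (show (0:ℝ) ∈ Icc _ _ from ⟨not_lt.1 hcon, h1.le⟩)
      exact hne s hs hs0
  rcases hsign with h1 | h1
  · exact ⟨F, G, hS, hFx, hFy, hGy, h1, hn⟩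
  · refine ⟨_, _, hS.neg, by rw [hFx, neg_zero], fun hd => by rw [hFy hd, neg_zero],
      fun hd => by rw [hGy hd, neg_zero], fun t ht => by linarith [h1 t ht], ?_⟩
    simp_rw [abs_neg]; exact hn

/-- For `t` different from both endpoints of the limit interval, the indicators agree at `t` for all
nearby intervals; dominated convergence with majorant `|w| ^ s` concludes. -/
theorem tendsto_nrm_indicator_sub {s : ℝ} (hs : 0 < s) {w : ℝ → ℝ} (hw : MemL s w) (z₀ : ℝ × ℝ) :
    Tendsto (fun z : ℝ × ℝ => nrm s fun t =>
      (Icc z.1 z.2).indicator w t - (Icc z₀.1 z₀.2).indicator w t) (𝓝 z₀) (𝓝 0) := by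
  have h0 : (0 : ℝ) = (∫ _ : ℝ, (0:ℝ)) ^ (1 / s) := by
    rw [integral_zero, Real.zero_rpow (one_div_ne_zero hs.ne')]
  rw [h0]
  refine Tendsto.rpow_const ?_ (Or.inr (by positivity))
  have hbd : ∀ (z : ℝ × ℝ) (t : ℝ),
      |(Icc z.1 z.2).indicator w t - (Icc z₀.1 z₀.2).indicator w t| ≤ |w t| := fun z t => by
    simp only [Set.indicator]; split_ifs <;> simp
  refine tendsto_integral_filter_of_dominated_convergence (fun t => |w t| ^ s)
    (.of_forall fun z => ?_) (.of_forall fun z => .of_forall fun t => ?_)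
    (hw.integrable_rpow hs) ?_
  · exact (((hw.indicator' measurableSet_Icc).1.sub
      (hw.indicator' measurableSet_Icc).1).norm.aemeasurable.pow_const s).aestronglyMeasurable
  · rw [Real.norm_eq_abs, abs_of_nonneg (Real.rpow_nonneg (abs_nonneg _) _)]
    exact Real.rpow_le_rpow (abs_nonneg _) (hbd z t) hs.le
  · filter_upwards [compl_mem_ae_iff.2 (measure_singleton z₀.1),
      compl_mem_ae_iff.2 (measure_singleton z₀.2)] with t h1 h2
    refine tendsto_const_nhds.congr' ?_
    have c1 : ContinuousAt (fun z : ℝ × ℝ => z.1) z₀ := continuous_fst.continuousAt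
    have c2 : ContinuousAt (fun z : ℝ × ℝ => z.2) z₀ := continuous_snd.continuousAt
    have e1 : ∀ᶠ z : ℝ × ℝ in 𝓝 z₀, (z.1 ≤ t ↔ z₀.1 ≤ t) := by
      rcases lt_or_gt_of_ne (show z₀.1 ≠ t from fun h => h1 (by simp [h])) with h | h
      · filter_upwards [c1.eventually_lt_const h] with z hz
        exact ⟨fun _ => h.le, fun _ => hz.le⟩
      · filter_upwards [c1.eventually_const_lt h] with z hz
        exact ⟨fun h' => absurd h' (not_le.2 hz), fun h' => absurd h' (not_le.2 h)⟩
    have e2 : ∀ᶠ z : ℝ × ℝ in 𝓝 z₀, (t ≤ z.2 ↔ t ≤ z₀.2) := by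
      rcases lt_or_gt_of_ne (show z₀.2 ≠ t from fun h => h2 (by simp [h])) with h | h
      · filter_upwards [c2.eventually_lt_const h] with z hz
        exact ⟨fun h' => absurd h' (not_le.2 hz), fun h' => absurd h' (not_le.2 h)⟩
      · filter_upwards [c2.eventually_const_lt h] with z hz
        exact ⟨fun _ => h.le, fun _ => hz.le⟩
    filter_upwards [e1, e2] with z h1 h2
    have : (Icc z.1 z.2).indicator w t = (Icc z₀.1 z₀.2).indicator w t := by
      simp only [Set.indicator, mem_Icc, h1, h2]
    rw [this, sub_self, abs_zero, Real.zero_rpow hs.ne']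

/-- `hK_perturb` is applied in both directions; its constants are uniform because restricting a
weight does not increase its norm. -/
theorem continuous_kap (W : Weights a b p p' q u v) (D : Prop) :
    Continuous fun z : ℝ × ℝ => kap p q u v D z.1 z.2 := by
  have hq := W.one_lt_q
  have hq0 : 0 < q := by linarith
  refine continuous_iff_continuousAt.2 fun z₀ => ?_
  rw [ContinuousAt, tendsto_iff_norm_sub_tendsto_zero]
  set eu : ℝ × ℝ → ℝ := fun z => nrm p' fun t =>
      (Icc z.1 z.2).indicator u t - (Icc z₀.1 z₀.2).indicator u t with heu
  set ev : ℝ × ℝ → ℝ := fun z => nrm q fun t =>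
      (Icc z.1 z.2).indicator v t - (Icc z₀.1 z₀.2).indicator v t with hev
  have hlim : Tendsto (fun z => eu z * (3 * nrm q v) + nrm p' u * ev z) (𝓝 z₀) (𝓝 0) := by
    have := ((tendsto_nrm_indicator_sub W.conj.symm.pos W.hu z₀).mul_const (3 * nrm q v)).add
      ((tendsto_nrm_indicator_sub hq0 W.hv z₀).const_mul (nrm p' u))
    simpa using this
  refine squeeze_zero (fun _ => norm_nonneg _) (fun z => ?_) hlim
  have key : ∀ z z' : ℝ × ℝ, kap p q u v D z.1 z.2 ≤ kap p q u v D z'.1 z'.2 +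
      ((nrm p' fun t => (Icc z.1 z.2).indicator u t - (Icc z'.1 z'.2).indicator u t) *
        (3 * nrm q v) + nrm p' u *
        nrm q fun t => (Icc z.1 z.2).indicator v t - (Icc z'.1 z'.2).indicator v t) := by
    intro z z'
    refine (hK_perturb W.conj hq (W.memU z'.1 z'.2) (W.memV z'.1 z'.2) (W.memU z.1 z.2)
      (W.memV z.1 z.2)).trans ?_
    have h1 := nrm_indicator_le hq0 W.hv (Icc z.1 z.2)
    have h2 := nrm_indicator_le hq0 W.hv (Icc z'.1 z'.2)
    have h3 := nrm_indicator_le W.conj.symm.pos W.hu (Icc z'.1 z'.2)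
    refine add_le_add_right (add_le_add (mul_le_mul_of_nonneg_left (by linarith) (nrm_nonneg _ _))
      (mul_le_mul_of_nonneg_right h3 (nrm_nonneg _ _))) _
  have k1 := key z z₀
  have k2 := key z₀ z
  rw [nrm_sub_comm (p := p'), nrm_sub_comm (p := q)] at k2
  rw [Real.norm_eq_abs, abs_le]
  constructor <;> simp only [heu, hev] <;> linarith

/-- The interval is empty or a single point. The value zero on degenerate intervals starts the
crossing arguments for equalizing partitions. -/
theorem kap_eq_zero (W : Weights a b p p' q u v) (hyx : y ≤ x) : kap p q u v D x y = 0 := by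
  refine le_antisymm ?_ kap_nonneg
  refine (hK_le_mul W.conj (by linarith [W.one_lt_q]) (W.memU x y) (W.memV x y)).trans ?_
  have : nrm p' ((Icc x y).indicator u) = 0 := by
    rw [nrm_eq_zero_iff W.conj.symm.pos (W.memU x y)]
    filter_upwards [compl_mem_ae_iff.2 (measure_singleton x)] with t ht
    refine indicator_of_notMem (fun h => ht ?_) _
    exact le_antisymm (h.2.trans hyx) h.1
  rw [this, zero_mul]

end arcs

/-! ### Partitions and equalization of the best constants -/

/-- A partition of `[a, b]` into the `n + 1` intervals `[z i, z (i + 1)]`. -/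
structure Part (a b : ℝ) (n : ℕ) (z : ℕ → ℝ) : Prop where
  zero : z 0 = a
  last : z (n + 1) = b
  lt : ∀ i ≤ n, z i < z (i + 1)

section equal

theorem le_of_le_succ {z : ℕ → ℝ} {m : ℕ} (h : ∀ i < m, z i ≤ z (i + 1)) {i j : ℕ} (hij : i ≤ j)
    (hj : j ≤ m) : z i ≤ z j := by
  induction j, hij using Nat.le_induction with
  | base => exact le_rfl
  | succ k hk ih => exact (ih (by omega)).trans (h k (by omega))

theorem Part.le {a b : ℝ} {n : ℕ} {z : ℕ → ℝ} (h : Part a b n z) {i j : ℕ} (hij : i ≤ j)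
    (hj : j ≤ n + 1) : z i ≤ z j :=
  le_of_le_succ (m := n + 1) (fun k hk => (h.lt k (by omega)).le) hij hj

theorem Part.mem {a b : ℝ} {n : ℕ} {z : ℕ → ℝ} (h : Part a b n z) {i : ℕ} (hi : i ≤ n + 1) :
    z i ∈ Icc a b :=
  ⟨h.zero ▸ h.le (Nat.zero_le i) hi, h.last ▸ h.le hi le_rfl⟩

/-- Equalization of a monotone interval function over partitions. -/
theorem exists_equalizing {a b : ℝ} {Φ : ℝ → ℝ → ℝ} (hc : Continuous fun z : ℝ × ℝ => Φ z.1 z.2)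
    (hm : ∀ x x' y y', x ≤ x' → y' ≤ y → Φ x' y' ≤ Φ x y) (h0 : ∀ x y, y ≤ x → Φ x y = 0)
    (hn : ∀ x y, 0 ≤ Φ x y) (k : ℕ) :
    ∃ Θ : ℝ → ℝ, Continuous Θ ∧ Monotone Θ ∧ Θ a = 0 ∧ ∀ x ∈ Icc a b, ∃ z : ℕ → ℝ, z 0 = a ∧
      z (k + 1) = x ∧ (∀ i < k + 1, z i ≤ z (i + 1)) ∧ ∀ i < k + 1, Φ (z i) (z (i + 1)) = Θ x := by
  induction k with
  | zero =>
    refine ⟨fun x => Φ a x, hc.comp (continuous_const.prodMk continuous_id),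
      fun x y hxy => hm _ _ _ _ le_rfl hxy, h0 _ _ le_rfl, fun x hx => ?_⟩
    refine ⟨fun i => if i = 0 then a else x, rfl, rfl, fun i hi => ?_, fun i hi => ?_⟩
    · obtain rfl : i = 0 := by omega
      simpa using hx.1
    · obtain rfl : i = 0 := by omega
      simp
  | succ k ih =>
    obtain ⟨Θ, hΘc, hΘm, hΘ0, hΘ⟩ := ih
    -- `Θ` is nondecreasing and `y ↦ Φ y x` nonincreasing, so the maximum over `y` of their minimum
    -- is the common value at a crossing. Unlike a choice of crossing points, this formula is
    -- visibly continuous in `x`.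
    set g : ℝ → ℝ → ℝ := fun x y => min (Θ y) (Φ y x) with hg
    have hgc : Continuous fun z : ℝ × ℝ => g z.1 z.2 :=
      (hΘc.comp continuous_snd).min (hc.comp (continuous_snd.prodMk continuous_fst))
    have hΘn : ∀ y ∈ Icc a b, 0 ≤ Θ y := fun y hy => hΘ0 ▸ hΘm hy.1
    have hcross : ∀ x ∈ Icc a b, ∃ y ∈ Icc a x, Θ y = Φ y x := by
      intro x hx
      have hc2 : ContinuousOn (fun y => Θ y - Φ y x) (Icc a x) :=
        (hΘc.sub (hc.comp (continuous_id.prodMk continuous_const))).continuousOn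
      obtain ⟨y, hy, hy0⟩ := intermediate_value_Icc hx.1 hc2 (show (0:ℝ) ∈ Icc _ _ from
        ⟨by simp only [hΘ0]; linarith [hn a x], by
          simp only [h0 x x le_rfl, sub_zero]; exact hΘn x hx⟩)
      exact ⟨y, hy, by simpa [sub_eq_zero] using hy0⟩
    have hbdd : ∀ x, BddAbove ((fun y => g x y) '' Icc a b) := fun x =>
      isCompact_Icc.bddAbove_image (hgc.comp (continuous_const.prodMk continuous_id)).continuousOn
    by_cases hab : a ≤ b
    swap
    · exact ⟨fun _ => 0, continuous_const, monotone_const, rfl,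
        fun x hx => absurd (hx.1.trans hx.2) hab⟩
    have hne : (Icc a b).Nonempty := nonempty_Icc.2 hab
    have hval : ∀ x ∈ Icc a b, ∀ y ∈ Icc a x, Θ y = Φ y x →
        sSup ((fun y => g x y) '' Icc a b) = Θ y := by
      intro x hx y hy e
      refine le_antisymm (csSup_le (hne.image _) ?_) (le_csSup (hbdd x) ⟨y, ⟨hy.1, hy.2.trans hx.2⟩, ?_⟩)
      · rintro _ ⟨y', hy', rfl⟩
        rcases le_total y' y with h | h
        · exact (min_le_left _ _).trans (hΘm h)
        · exact (min_le_right _ _).trans ((hm _ _ _ _ h le_rfl).trans_eq e.symm)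
      · simp [hg, e]
    refine ⟨fun x => sSup ((fun y => g x y) '' Icc a b), isCompact_Icc.continuous_sSup hgc, ?_, ?_, ?_⟩
    · intro x x' hxx
      refine csSup_le (hne.image _) ?_
      rintro _ ⟨y, hy, rfl⟩
      refine (min_le_min le_rfl (hm _ _ _ _ le_rfl hxx)).trans (le_csSup (hbdd x') ⟨y, hy, rfl⟩)
    · change sSup ((fun y => g a y) '' Icc a b) = 0
      rw [hval a ⟨le_rfl, hab⟩ a ⟨le_rfl, le_rfl⟩ (by rw [hΘ0, h0 a a le_rfl]), hΘ0]
    · intro x hx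
      obtain ⟨y, hy, e⟩ := hcross x hx
      obtain ⟨z, hz0, hzk, hzm, hzv⟩ := hΘ y ⟨hy.1, hy.2.trans hx.2⟩
      refine ⟨fun i => if i ≤ k + 1 then z i else x, by simp [hz0], by simp, fun i hi => ?_,
        fun i hi => ?_⟩
      · rcases Nat.lt_or_ge i (k + 1) with h | h
        · simp [h.le, Nat.succ_le_of_lt h, hzm i h]
        · obtain rfl : i = k + 1 := by omega
          simp [hzk, hy.2]
      · change _ = sSup ((fun y => g x y) '' Icc a b)
        rw [hval x hx y hy e]
        rcases Nat.lt_or_ge i (k + 1) with h | h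
        · simp [h.le, Nat.succ_le_of_lt h, hzv i h]
        · obtain rfl : i = k + 1 := by omega
          simp [hzk, e]

variable {a b p p' q : ℝ} {u v : ℝ → ℝ}

/-- There is a partition on which all best constants coincide; the last interval is free at its
right end. -/
theorem exists_equal_partition (W : Weights a b p p' q u v) (n : ℕ) :
    ∃ (z : ℕ → ℝ) (θ : ℝ), 0 < θ ∧ Part a b n z ∧
      ∀ i ≤ n, kap p q u v (i < n) (z i) (z (i + 1)) = θ := by
  have hmain : ∃ (z : ℕ → ℝ) (θ : ℝ), z 0 = a ∧ z (n + 1) = b ∧ (∀ i < n + 1, z i ≤ z (i + 1)) ∧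
      ∀ i ≤ n, kap p q u v (i < n) (z i) (z (i + 1)) = θ := by
    cases n with
    | zero =>
      refine ⟨fun i => if i = 0 then a else b, kap p q u v False a b, rfl, rfl, fun i hi => ?_,
        fun i hi => ?_⟩
      · obtain rfl : i = 0 := by omega
        simpa using W.hab.le
      · obtain rfl : i = 0 := by omega
        simp
    | succ k =>
      obtain ⟨Θ, hΘc, hΘm, hΘ0, hΘ⟩ := exists_equalizing (a := a) (b := b) (continuous_kap W True)
        (fun x x' y y' hx hy => kap_mono W hx hy) (fun x y hyx => kap_eq_zero W hyx)
        (fun x y => kap_nonneg) k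
      -- The first `k + 1` intervals are equalized over `[a, y]`; one more crossing balances them
      -- against the interval `[y, b]` with free right end.
      have hc2 : ContinuousOn (fun y => Θ y - kap p q u v False y b) (Icc a b) :=
        (hΘc.sub ((continuous_kap W False).comp
          (continuous_id.prodMk continuous_const))).continuousOn
      obtain ⟨y, hy, hy0⟩ := intermediate_value_Icc W.hab.le hc2 (show (0:ℝ) ∈ Icc _ _ from
        ⟨by simp only [hΘ0, zero_sub]; exact neg_nonpos.2 kap_nonneg, by
          simp only [kap_eq_zero (D := False) W (le_refl b), sub_zero]
          exact hΘ0 ▸ hΘm W.hab.le⟩)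
      have e : Θ y = kap p q u v False y b := by simpa [sub_eq_zero] using hy0
      obtain ⟨z, hz0, hzk, hzm, hzv⟩ := hΘ y hy
      refine ⟨fun i => if i ≤ k + 1 then z i else b, Θ y, by simp [hz0], by simp, fun i hi => ?_,
        fun i hi => ?_⟩
      · rcases Nat.lt_or_ge i (k + 1) with h | h
        · simp [h.le, Nat.succ_le_of_lt h, hzm i h]
        · obtain rfl : i = k + 1 := by omega
          simp [hzk, hy.2]
      · rcases Nat.lt_or_ge i (k + 1) with h | h
        · rw [eq_true h]
          simp [h.le, Nat.succ_le_of_lt h, hzv i h]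
        · obtain rfl : i = k + 1 := by omega
          rw [eq_false (lt_irrefl _)]
          simp [hzk, e]
  obtain ⟨z, θ, hz0, hzn, hzm, hzv⟩ := hmain
  have hmem : ∀ i ≤ n + 1, z i ∈ Icc a b := fun i hi =>
    ⟨hz0 ▸ le_of_le_succ hzm (Nat.zero_le i) hi, hzn ▸ le_of_le_succ hzm hi le_rfl⟩
  -- A zero common value would make every interval degenerate, so that all nodes would equal `a`.
  have hθ : 0 < θ := by
    by_contra hcon
    have hθ0 : θ = 0 := le_antisymm (not_lt.1 hcon) (hzv 0 (Nat.zero_le _) ▸ kap_nonneg)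
    have : ∀ i ≤ n + 1, z i = a := by
      intro i
      induction i with
      | zero => exact fun _ => hz0
      | succ i ih =>
        intro hi
        by_contra hne
        have hlt : z i < z (i + 1) := lt_of_le_of_ne (hzm i (by omega)) (by
          rw [ih (by omega)]; exact fun h => hne h.symm)
        have := kap_pos (D := i < n) W (hmem i (by omega)).1 hlt (hmem (i + 1) hi).2
        rw [hzv i (by omega)] at this
        exact hcon this
    have h1 := this (n + 1) le_rfl
    rw [hzn] at h1
    exact W.hab.ne' h1
  refine ⟨z, θ, hθ, ⟨hz0, hzn, fun i hi => ?_⟩, hzv⟩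
  by_contra hcon
  have := hzv i hi
  rw [kap_eq_zero W (not_lt.1 hcon)] at this
  exact hθ.ne this

/-- Among any other partition one of the best constants is at most the common one. -/
theorem exists_kap_le (W : Weights a b p p' q u v) {n : ℕ} {z z' : ℕ → ℝ} {θ : ℝ}
    (hz : Part a b n z) (hz' : Part a b n z')
    (hv : ∀ i ≤ n, kap p q u v (i < n) (z i) (z (i + 1)) = θ) :
    ∃ i ≤ n, kap p q u v (i < n) (z' i) (z' (i + 1)) ≤ θ := by
  by_contra! hcon
  -- If every constant of `z'` exceeded `θ`, monotonicity would push each node of `z'` after the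
  -- first strictly to the right of its counterpart, including the last one, which is `b` for both.
  have key : ∀ i ≤ n + 1, z i ≤ z' i ∧ (i = n + 1 → False) := by
    intro i
    induction i with
    | zero => exact fun _ => ⟨by rw [hz.zero, hz'.zero], by omega⟩
    | succ i ih =>
      intro hi
      have h1 := (ih (by omega)).1
      have hlt : z (i + 1) < z' (i + 1) := by
        by_contra hc
        have := kap_mono (D := i < n) W h1 (not_lt.1 hc)
        rw [hv i (by omega)] at this
        exact absurd this (not_le.2 (hcon i (by omega)))
      refine ⟨hlt.le, fun he => ?_⟩
      obtain rfl : i = n := by omega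
      rw [hz.last, hz'.last] at hlt
      exact lt_irrefl _ hlt
  exact (key (n + 1) le_rfl).2 rfl

end equal

/-! ### Cutting a corner: equal slopes at the nodes of an optimal partition -/

/-- Strict midpoint convexity of `|x|^p`. -/
theorem two_mul_abs_midpoint_rpow_lt {p p' : ℝ} (h : p.HolderConjugate p') {x y : ℝ} (hxy : x ≠ y) :
    2 * |(x + y) / 2| ^ p < |x| ^ p + |y| ^ p := by
  set c := (x + y) / 2 with hc
  -- With `w = c_{(p)}` Young's inequality is an equality at the midpoint `c` and strict at `x ≠ c`;
  -- the inequalities at `x` and `y` are added.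
  set w := spow p c with hw
  have hw1 : |w| ^ p' = |c| ^ p := abs_spow_rpow h.symm c
  have hcw : c * w = |c| ^ p := by rw [mul_comm, hw, spow_mul_self h.lt]
  have y1 := Real.young_inequality x w h
  have y2 := Real.young_inequality y w h
  have hlt : x * w < |x| ^ p / p + |w| ^ p' / p' := by
    refine lt_of_le_of_ne y1 fun he => hxy ?_
    have := eq_spow_of_young_eq h he
    rw [hw, spow_spow h.symm, hc] at this
    linarith
  rw [hw1] at hlt y2
  have hsum : 2 * |c| ^ p < (|x| ^ p + |y| ^ p) / p + 2 * (|c| ^ p / p') := by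
    have : x * w + y * w = 2 * |c| ^ p := by rw [← hcw, hc]; ring
    have e : (|x| ^ p + |y| ^ p) / p = |x| ^ p / p + |y| ^ p / p := by ring
    rw [e]; linarith
  have hp := h.pos
  have hinv : 1 / p' = 1 - 1 / p := by
    have := h.inv_add_inv_eq_one; rw [one_div, one_div]; linarith
  have e2 : |c| ^ p / p' = |c| ^ p - |c| ^ p / p := by
    rw [div_eq_mul_one_div, hinv]; ring
  rw [e2] at hsum
  have h3 : 2 * |c| ^ p / p < (|x| ^ p + |y| ^ p) / p := by
    have : 2 * |c| ^ p / p = 2 * (|c| ^ p / p) := by ring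
    rw [this]; linarith
  exact (div_lt_div_iff_of_pos_right hp).1 h3

/-- First order behaviour of `A^{k+1} B^{-k}` along the diagonal `A = lam B`. -/
theorem eventually_sum_lt {A₁ A₂ B₁ B₂ lam k q C g : ℝ} (hB₁ : 0 < B₁) (hB₂ : 0 < B₂)
    (hlam : 0 < lam) (e₁ : A₁ = lam * B₁) (e₂ : A₂ = lam * B₂) (hk : 0 < k) (hq : 1 < q)
    (hC : 0 < C) (hg : 0 < g) :
    ∀ᶠ δ in 𝓝[>] (0 : ℝ), ∀ A₁' A₂' B₁' B₂' : ℝ, |A₁' - A₁| ≤ C * δ → |A₂' - A₂| ≤ C * δ →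
      A₁' + A₂' ≤ A₁ + A₂ - g * δ → B₁ - C * δ ^ q ≤ B₁' → B₂ - C * δ ^ q ≤ B₂' →
      A₁' ^ (k + 1) * B₁' ^ (-k) + A₂' ^ (k + 1) * B₂' ^ (-k) <
        A₁ ^ (k + 1) * B₁ ^ (-k) + A₂ ^ (k + 1) * B₂ ^ (-k) := by
  have hA₁ : 0 < A₁ := by rw [e₁]; positivity
  have hA₂ : 0 < A₂ := by rw [e₂]; positivity
  -- Because `A = lam * B` in both pairs, `A ^ (k + 1) * B ^ (-k)` has the same partial derivative
  -- `(k + 1) * lam ^ k` in `A`, so only the sum of the `A`'s matters to first order, while the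
  -- `B`'s lose at most order `δ ^ q = o(δ)`. Error budget: the two Taylor errors in `A` together
  -- cost a quarter of the gain `(k + 1) * g * δ`, and the loss in `B` another quarter.
  set ε := (k + 1) * g / (8 * C) with hε
  have hε0 : 0 < ε := by positivity
  set ε' := (k + 1) * g / (4 * (A₁ + A₂)) with hε'
  have hε'0 : 0 < ε' := by positivity
  -- expansion of `x^{k+1}` at `1`
  have hx : ∀ᶠ x in 𝓝 (1 : ℝ), x ^ (k + 1) ≤ 1 + (k + 1) * (x - 1) + ε * |x - 1| := by
    have hd : HasDerivAt (fun x : ℝ => x ^ (k + 1)) (k + 1) 1 := by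
      simpa using Real.hasDerivAt_rpow_const (x := 1) (p := k + 1) (Or.inl one_ne_zero)
    have := (hasDerivAt_iff_isLittleO.1 hd).def hε0
    filter_upwards [this] with x hx
    simp only [Real.one_rpow, smul_eq_mul, Real.norm_eq_abs] at hx
    have := (abs_le.1 hx).2
    linarith
  have hy : ∀ᶠ y in 𝓝 (1 : ℝ), y ^ (-k) ≤ 1 + (k + 1) * |y - 1| := by
    have hd : HasDerivAt (fun x : ℝ => x ^ (-k)) (-k) 1 := by
      simpa using Real.hasDerivAt_rpow_const (x := 1) (p := -k) (Or.inl one_ne_zero)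
    have := (hasDerivAt_iff_isLittleO.1 hd).def one_pos
    filter_upwards [this] with x hx
    simp only [Real.one_rpow, smul_eq_mul, Real.norm_eq_abs] at hx
    have h1 := (abs_le.1 hx).2
    have h2 := neg_abs_le (x - 1)
    nlinarith
  obtain ⟨η₁, hη₁, hx'⟩ := Metric.eventually_nhds_iff.1 hx
  obtain ⟨η₂, hη₂, hy'⟩ := Metric.eventually_nhds_iff.1 hy
  have hδpow : Tendsto (fun δ : ℝ => δ ^ (q - 1)) (𝓝[>] 0) (𝓝 0) := by
    have : Tendsto (fun δ : ℝ => δ ^ (q - 1)) (𝓝 0) (𝓝 ((0:ℝ) ^ (q - 1))) :=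
      (Real.continuousAt_rpow_const 0 (q - 1) (Or.inr (by linarith))).tendsto
    rw [Real.zero_rpow (by linarith)] at this
    exact this.mono_left nhdsWithin_le_nhds
  have hδ : Tendsto (fun δ : ℝ => δ) (𝓝[>] 0) (𝓝 0) := tendsto_id.mono_left nhdsWithin_le_nhds
  set m := min A₁ A₂ with hm
  set mB := min B₁ B₂ with hmB
  have hm0 : 0 < m := lt_min hA₁ hA₂
  have hmB0 : 0 < mB := lt_min hB₁ hB₂
  have ev1 : ∀ᶠ δ in 𝓝[>] (0:ℝ), δ < η₁ * m / C := hδ.eventually_lt_const (by positivity)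
  have ev2 : ∀ᶠ δ in 𝓝[>] (0:ℝ), δ ^ (q - 1) < ε' * mB / ((k + 1) * C) :=
    hδpow.eventually_lt_const (by positivity)
  have ev3 : ∀ᶠ δ in 𝓝[>] (0:ℝ), δ < 1 := hδ.eventually_lt_const one_pos
  have ev4 : ∀ᶠ δ in 𝓝[>] (0:ℝ), δ ^ (q - 1) < min η₂ (1 / 2) * mB / C :=
    hδpow.eventually_lt_const (by positivity)
  have ev5 : ∀ᶠ δ in 𝓝[>] (0:ℝ), δ < m / C := hδ.eventually_lt_const (by positivity)
  filter_upwards [ev1, ev2, ev3, ev4, ev5, self_mem_nhdsWithin] with δ d1 d2 d3 d4 d5 hδ0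
  have hδ0 : 0 < δ := hδ0
  intro A₁' A₂' B₁' B₂' a1 a2 hs b1 b2
  have hpow : δ ^ q = δ * δ ^ (q - 1) := by
    rw [Real.rpow_sub_one hδ0.ne']; field_simp
  -- bound of one summand
  have key : ∀ A B A' B' : ℝ, 0 < A → 0 < B → m ≤ A → mB ≤ B → A = lam * B → |A' - A| ≤ C * δ →
      B - C * δ ^ q ≤ B' → A' ^ (k + 1) * B' ^ (-k) ≤
        lam ^ k * ((A + (k + 1) * (A' - A) + ε * (C * δ)) * (1 + ε' * δ)) ∧
      A ^ (k + 1) * B ^ (-k) = lam ^ k * A ∧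
      0 ≤ A + (k + 1) * (A' - A) + ε * (C * δ) := by
    intro A B A' B' hA hB hmA hmB' e ha hb
    have hxA : |A' / A - 1| < η₁ := by
      rw [div_sub_one hA.ne', abs_div, abs_of_pos hA, div_lt_iff₀ hA]
      rw [lt_div_iff₀ hC] at d1
      have : η₁ * m ≤ η₁ * A := by gcongr
      linarith [mul_comm δ C]
    have hA'0 : 0 < A' := by
      rw [lt_div_iff₀ hC] at d5
      have := (abs_le.1 ha).1
      linarith [mul_comm δ C]
    have t1 := hx' (y := A' / A) (by rwa [Real.dist_eq])
    set B'' := B - C * δ ^ q with hB''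
    have hq1 : δ ^ (q - 1) * C < min η₂ (1 / 2) * mB := by rwa [lt_div_iff₀ hC] at d4
    have hpos1 : 0 < δ ^ (q - 1) := Real.rpow_pos_of_pos hδ0 _
    have hCq : C * δ ^ q < min η₂ (1 / 2) * B := by
      rw [hpow]
      have h1 : C * (δ * δ ^ (q - 1)) ≤ δ ^ (q - 1) * C := by
        have := mul_le_mul_of_nonneg_right d3.le (mul_pos hpos1 hC).le
        linarith
      have h2 : min η₂ (1 / 2) * mB ≤ min η₂ (1 / 2) * B := by gcongr
      linarith
    have hCq0 : 0 < C * δ ^ q := by positivity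
    have hB''0 : 0 < B'' := by
      have : min η₂ (1 / 2) * B ≤ 1 / 2 * B := by gcongr; exact min_le_right _ _
      rw [hB'']; linarith
    have hyB : |B'' / B - 1| = C * δ ^ q / B := by
      rw [div_sub_one hB.ne', hB'', abs_div, abs_of_pos hB]
      congr 1
      rw [show B - C * δ ^ q - B = -(C * δ ^ q) by ring, abs_neg, abs_of_pos hCq0]
    have t2 := hy' (y := B'' / B) (by
      rw [Real.dist_eq, hyB, div_lt_iff₀ hB]
      have : min η₂ (1 / 2) * B ≤ η₂ * B := by gcongr; exact min_le_left _ _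
      linarith)
    rw [hyB] at t2
    have t3 : (k + 1) * (C * δ ^ q / B) ≤ ε' * δ := by
      rw [lt_div_iff₀ (by positivity)] at d2
      rw [hpow, ← mul_div_assoc, div_le_iff₀ hB]
      have h1 : ε' * mB ≤ ε' * B := by gcongr
      have h2 := mul_le_mul_of_nonneg_left (d2.le.trans h1) hδ0.le
      linarith
    have hmono : B' ^ (-k) ≤ B'' ^ (-k) :=
      Real.rpow_le_rpow_of_nonpos hB''0 hb (by linarith)
    have hval : A ^ (k + 1) * B ^ (-k) = lam ^ k * A := by
      rw [Real.rpow_add_one hA.ne', e, Real.mul_rpow hlam.le hB.le, Real.rpow_neg hB.le]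
      have := (Real.rpow_pos_of_pos hB k).ne'
      field_simp
    have hlin : A * (1 + (k + 1) * (A' / A - 1) + ε * |A' / A - 1|) ≤
        A + (k + 1) * (A' - A) + ε * (C * δ) := by
      have h1 : |A' / A - 1| = |A' - A| / A := by
        rw [div_sub_one hA.ne', abs_div, abs_of_pos hA]
      have h2 : A * (1 + (k + 1) * (A' / A - 1) + ε * |A' / A - 1|) =
          A + (k + 1) * (A' - A) + ε * |A' - A| := by
        rw [h1]; field_simp
      rw [h2]
      have := mul_le_mul_of_nonneg_left ha hε0.le
      linarith
    have hnn : 0 ≤ 1 + (k + 1) * (A' / A - 1) + ε * |A' / A - 1| :=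
      (Real.rpow_nonneg (by positivity) _).trans t1
    refine ⟨?_, hval, (mul_nonneg hA.le hnn).trans hlin⟩
    calc A' ^ (k + 1) * B' ^ (-k) ≤ A' ^ (k + 1) * B'' ^ (-k) := by gcongr
      _ = (A ^ (k + 1) * B ^ (-k)) * ((A' / A) ^ (k + 1) * (B'' / B) ^ (-k)) := by
        rw [Real.div_rpow hA'0.le hA.le, Real.div_rpow hB''0.le hB.le]
        have h1 := (Real.rpow_pos_of_pos hA (k + 1)).ne'
        have h2 := (Real.rpow_pos_of_pos hB (-k)).ne'
        field_simp
      _ = lam ^ k * (A * ((A' / A) ^ (k + 1)) * (B'' / B) ^ (-k)) := by rw [hval]; ring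
      _ ≤ lam ^ k * (A * (1 + (k + 1) * (A' / A - 1) + ε * |A' / A - 1|) * (1 + ε' * δ)) := by
        have : (B'' / B) ^ (-k) ≤ 1 + ε' * δ := by linarith
        gcongr
      _ ≤ _ := by gcongr
  obtain ⟨k1, v1, n1⟩ := key A₁ B₁ A₁' B₁' hA₁ hB₁ (min_le_left _ _) (min_le_left _ _) e₁ a1 b1
  obtain ⟨k2, v2, n2⟩ := key A₂ B₂ A₂' B₂' hA₂ hB₂ (min_le_right _ _) (min_le_right _ _) e₂ a2 b2
  rw [v1, v2]
  refine lt_of_le_of_lt (add_le_add k1 k2) ?_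
  rw [← mul_add, ← add_mul, ← mul_add]
  refine mul_lt_mul_of_pos_left ?_ (Real.rpow_pos_of_pos hlam _)
  have hεC : ε * (C * δ) = (k + 1) * g / 8 * δ := by rw [hε]; field_simp
  set S := A₁ + (k + 1) * (A₁' - A₁) + ε * (C * δ) + (A₂ + (k + 1) * (A₂' - A₂) + ε * (C * δ)) with hS
  have hS1 : S ≤ A₁ + A₂ - 3 / 4 * ((k + 1) * g * δ) := by
    rw [hS, hεC]
    have : (k + 1) * ((A₁' + A₂') - (A₁ + A₂)) ≤ (k + 1) * (-(g * δ)) :=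
      mul_le_mul_of_nonneg_left (by linarith) (by linarith)
    linarith
  have hpos : 0 < (k + 1) * g * δ := by positivity
  have hε'e : (A₁ + A₂) * (ε' * δ) = 1 / 4 * ((k + 1) * g * δ) := by rw [hε']; field_simp
  have hSle : S ≤ A₁ + A₂ := by linarith
  have : S * (ε' * δ) ≤ (A₁ + A₂) * (ε' * δ) := mul_le_mul_of_nonneg_right hSle (by positivity)
  linarith [mul_add S 1 (ε' * δ)]

section corner

variable {a b p p' q : ℝ} {u v : ℝ → ℝ} {D : Prop} {x y : ℝ}

theorem Sol.intervalIntegrable_G (W : Weights a b p p' q u v) {lam : ℝ} {F G : ℝ → ℝ}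
    (h : Sol p' q (pw p' u) (pw q v) lam x y F G) {s t : ℝ} (hs : s ∈ Icc x y) (ht : t ∈ Icc x y) :
    IntervalIntegrable (fun r => pw p' u r * |G r| ^ p') volume s t :=
  W.integrable_U.intervalIntegrable.mul_continuousOn
    ((h.contG.abs.rpow_const fun _ _ => Or.inr W.conj.symm.nonneg).mono
      (ordConnected_Icc.uIcc_subset hs ht))

theorem Sol.intervalIntegrable_F (W : Weights a b p p' q u v) {lam : ℝ} {F G : ℝ → ℝ}
    (h : Sol p' q (pw p' u) (pw q v) lam x y F G) {s t : ℝ} (hs : s ∈ Icc x y) (ht : t ∈ Icc x y) :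
    IntervalIntegrable (fun r => pw q v r * |F r| ^ q) volume s t :=
  W.integrable_V.intervalIntegrable.mul_continuousOn
    ((h.contF.abs.rpow_const fun _ _ => Or.inr (by linarith [W.one_lt_q])).mono
      (ordConnected_Icc.uIcc_subset hs ht))

/-- Estimates for a solution on an interval where its slope is nearly constant. -/
theorem Sol.near (W : Weights a b p p' q u v) {lam : ℝ} {F G : ℝ → ℝ}
    (S : Sol p' q (pw p' u) (pw q v) lam x y F G) (hxy : x ≤ y) {h ε ε' δ : ℝ} (hε : 0 ≤ ε)
    (hδ : ∫ t in x..y, pw p' u t = δ) (hG : ∀ t ∈ Icc x y, |spow p' (G t) - h| ≤ ε)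
    (hG' : ∀ t ∈ Icc x y, |(|spow p' (G t)| ^ p) - |h| ^ p| ≤ ε') :
    |F y - F x - h * δ| ≤ ε * δ ∧
    (|h| ^ p - ε') * δ ≤ ∫ t in x..y, pw p' u t * |G t| ^ p' ∧
    ∫ t in x..y, pw p' u t * |G t| ^ p' ≤ (|h| ^ p + ε') * δ ∧
    (F x = 0 ∨ F y = 0 →
      ∫ t in x..y, pw q v t * |F t| ^ q ≤ (∫ t, pw q v t) * (|h| + ε) ^ q * δ ^ q) := by
  have hp' := W.one_lt_p'
  have hq0 : 0 < q := by linarith [W.one_lt_q]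
  have iU := W.integrable_U.intervalIntegrable (a := x) (b := y)
  have hδ0 : 0 ≤ δ := hδ ▸ intervalIntegral.integral_nonneg hxy fun _ _ => pw_nonneg _ _ _
  have iS := intervalIntegrable_mul_spow hp' W.integrable_U (s := x) (t := y)
    (H := G) (by rw [uIcc_of_le hxy]; exact S.contG)
  have iG := S.intervalIntegrable_G W (left_mem_Icc.2 hxy) (right_mem_Icc.2 hxy)
  simp_rw [abs_spow_rpow W.conj] at hG'
  refine ⟨?_, ?_, ?_, fun h0 => ?_⟩
  · rw [S.sub_F hp' W.integrable_U (left_mem_Icc.2 hxy) (right_mem_Icc.2 hxy), ← hδ,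
      ← intervalIntegral.integral_const_mul, ← intervalIntegral.integral_const_mul,
      ← intervalIntegral.integral_sub iS (iU.const_mul h)]
    refine (intervalIntegral.abs_integral_le_integral_abs hxy).trans
      (intervalIntegral.integral_mono_on hxy (iS.sub (iU.const_mul h)).abs (iU.const_mul ε)
        fun t ht => ?_)
    rw [mul_comm h, ← mul_sub, abs_mul, abs_of_nonneg (pw_nonneg _ _ _), mul_comm]
    exact mul_le_mul_of_nonneg_right (hG t ht) (pw_nonneg _ _ _)
  · rw [← hδ, ← intervalIntegral.integral_const_mul]
    refine intervalIntegral.integral_mono_on hxy (iU.const_mul _) iG fun t ht => ?_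
    rw [mul_comm]
    exact mul_le_mul_of_nonneg_left (by linarith [(abs_le.1 (hG' t ht)).1]) (pw_nonneg _ _ _)
  · rw [← hδ, ← intervalIntegral.integral_const_mul]
    refine intervalIntegral.integral_mono_on hxy iG (iU.const_mul _) fun t ht => ?_
    rw [mul_comm _ (pw p' u t)]
    exact mul_le_mul_of_nonneg_left (by linarith [(abs_le.1 (hG' t ht)).2]) (pw_nonneg _ _ _)
  · have hdiff : ∀ s ∈ Icc x y, ∀ t ∈ Icc x y, s ≤ t → |F t - F s| ≤ (|h| + ε) * δ := by
      intro s hs t ht hst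
      rw [S.sub_F hp' W.integrable_U hs ht]
      have h1 : |∫ r in s..t, pw p' u r * spow p' (G r)| ≤ ∫ r in s..t, (|h| + ε) * pw p' u r := by
        rw [← Real.norm_eq_abs]
        refine intervalIntegral.norm_integral_le_of_norm_le (μ := volume) hst
          (Eventually.of_forall fun r hr => ?_) (W.integrable_U.const_mul _).intervalIntegrable
        have hr' : r ∈ Icc x y := ⟨hs.1.trans hr.1.le, hr.2.trans ht.2⟩
        rw [Real.norm_eq_abs, abs_mul, abs_of_nonneg (pw_nonneg _ _ _), mul_comm]
        refine mul_le_mul_of_nonneg_right ?_ (pw_nonneg _ _ _)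
        have := abs_sub_abs_le_abs_sub (spow p' (G r)) h
        linarith [hG r hr']
      refine h1.trans ?_
      rw [intervalIntegral.integral_const_mul]
      refine mul_le_mul_of_nonneg_left ?_ (by positivity)
      rw [← hδ]
      exact intervalIntegral.integral_mono_interval hs.1 hst ht.2
        (.of_forall fun _ => pw_nonneg _ _ _) iU
    have hF : ∀ t ∈ Icc x y, |F t| ≤ (|h| + ε) * δ := by
      intro t ht
      rcases h0 with h0 | h0
      · have := hdiff x (left_mem_Icc.2 hxy) t ht ht.1
        rwa [h0, sub_zero] at this
      · have := hdiff t ht y (right_mem_Icc.2 hxy) ht.2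
        rwa [h0, zero_sub, abs_neg] at this
    have iF := S.intervalIntegrable_F W (left_mem_Icc.2 hxy) (right_mem_Icc.2 hxy)
    have iV := W.integrable_V.intervalIntegrable (a := x) (b := y)
    calc ∫ t in x..y, pw q v t * |F t| ^ q
        ≤ ∫ t in x..y, pw q v t * ((|h| + ε) * δ) ^ q :=
          intervalIntegral.integral_mono_on hxy iF (iV.mul_const _) fun t ht =>
            mul_le_mul_of_nonneg_left (Real.rpow_le_rpow (abs_nonneg _) (hF t ht) hq0.le)
              (pw_nonneg _ _ _)
      _ = (∫ t in x..y, pw q v t) * ((|h| + ε) * δ) ^ q := intervalIntegral.integral_mul_const _ _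
      _ ≤ (∫ t, pw q v t) * ((|h| + ε) * δ) ^ q := by
          refine mul_le_mul_of_nonneg_right ?_ (by positivity)
          rw [intervalIntegral.integral_of_le hxy]
          exact setIntegral_le_integral W.integrable_V (.of_forall fun _ => pw_nonneg _ _ _)
      _ = _ := by rw [Real.mul_rpow (by positivity) hδ0, mul_assoc]

/-- Competitor on `[x, m]` obtained by continuing a solution on `[x, s]` with constant slope. -/
theorem kap_ge_left (W : Weights a b p p' q u v) {lam s m σ : ℝ} {F G : ℝ → ℝ} (hxs : x ≤ s)
    (hsm : s ≤ m) (S : Sol p' q (pw p' u) (pw q v) lam x s F G) (hF : F x = 0)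
    (hσ : F s + σ * ∫ t in s..m, pw p' u t = 0) :
    ∫ t in x..s, pw q v t * |F t| ^ q ≤ kap p q u v True x m ^ q *
      ((∫ t in x..s, pw p' u t * |G t| ^ p') + |σ| ^ p * ∫ t in s..m, pw p' u t) ^ (q / p) := by
  have hp' := W.one_lt_p'
  have hq0 : 0 < q := by linarith [W.one_lt_q]
  set h : ℝ → ℝ := fun t => if t ≤ s then spow p' (G t) else σ with hh
  have hc := (continuous_spow hp').comp_continuousOn S.contG
  obtain ⟨C, hC⟩ := isCompact_Icc.exists_bound_of_continuousOn hc
  have hC' : ∀ t ∈ Icc x m, |h t| ≤ max C |σ| := fun t ht => by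
    simp only [hh]; split_ifs with h1
    · exact (hC t ⟨ht.1, h1⟩).trans (le_max_left _ _)
    · exact le_max_right _ _
  have hm : AEStronglyMeasurable h (volume.restrict (Icc x m)) := by
    have e : h =ᵐ[volume.restrict (Icc x m)]
        (Icc x s).piecewise (fun t => spow p' (G t)) (fun _ => σ) := by
      refine (ae_restrict_iff' measurableSet_Icc).2 (.of_forall fun t ht => ?_)
      simp only [hh, Set.piecewise, mem_Icc, ht.1, true_and]
    refine AEStronglyMeasurable.congr ?_ e.symm
    refine AEStronglyMeasurable.piecewise measurableSet_Icc ?_ aestronglyMeasurable_const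
    refine (hc.aestronglyMeasurable (μ := volume) measurableSet_Icc).mono_measure ?_
    exact Measure.restrict_mono_measure Measure.restrict_le_self _
  have e1 : ∀ r ∈ Icc x s, ∫ t in x..r, pw p' u t * h t = F r := fun r hr => by
    rw [S.eqF r hr, hF, zero_add]
    refine intervalIntegral.integral_congr fun t ht => ?_
    rw [uIcc_of_le hr.1] at ht
    simp [hh, ht.2.trans hr.2]
  have hmul : AEStronglyMeasurable ((Icc x m).indicator h) volume :=
    (aestronglyMeasurable_indicator_iff measurableSet_Icc).2 hm
  have iH : ∀ s t, s ∈ Icc x m → t ∈ Icc x m →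
      IntervalIntegrable (fun r => pw p' u r * h r) volume s t := fun s t hs ht => by
    have : Integrable fun r => pw p' u r * (Icc x m).indicator h r := by
      refine W.integrable_U.mul_bdd (c := max C |σ|) hmul (.of_forall fun r => ?_)
      by_cases hr : r ∈ Icc x m
      · rw [indicator_of_mem hr]; exact hC' r hr
      · rw [indicator_of_notMem hr, norm_zero]; exact le_max_of_le_right (abs_nonneg _)
    refine this.intervalIntegrable.congr (fun r hr => ?_)
    rw [indicator_of_mem (ordConnected_Icc.uIcc_subset hs ht (uIoc_subset_uIcc hr))]
  have mx : x ∈ Icc x m := ⟨le_rfl, hxs.trans hsm⟩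
  have ms : s ∈ Icc x m := ⟨hxs, hsm⟩
  have mm : m ∈ Icc x m := ⟨hxs.trans hsm, le_rfl⟩
  have e2 : ∀ {w : ℝ → ℝ}, (∫ t in s..m, pw p' u t * (if t ≤ s then w t else σ)) =
      σ * ∫ t in s..m, pw p' u t := fun {w} => by
    rw [← intervalIntegral.integral_const_mul]
    refine intervalIntegral.integral_congr_ae (.of_forall fun t ht => ?_)
    rw [uIoc_of_le hsm] at ht
    simp [not_le.2 ht.1, mul_comm]
  have hend : ∫ t in x..m, pw p' u t * h t = 0 := by
    rw [← intervalIntegral.integral_add_adjacent_intervals (iH x s mx ms) (iH s m ms mm),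
      e1 s ⟨hxs, le_rfl⟩, e2, hσ]
  have hmain := W.integral_le_kap' (D := True) (hxs.trans hsm) hm hC' (fun _ => hend)
  have hAe : ∫ t in x..m, pw p' u t * |h t| ^ p =
      (∫ t in x..s, pw p' u t * |G t| ^ p') + |σ| ^ p * ∫ t in s..m, pw p' u t := by
    have i1 : IntervalIntegrable (fun t => pw p' u t * |h t| ^ p) volume x s :=
      (S.intervalIntegrable_G W ⟨le_rfl, hxs⟩ ⟨hxs, le_rfl⟩).congr fun t ht => by
        rw [uIoc_of_le hxs] at ht
        simp only [hh, if_pos ht.2, abs_spow_rpow W.conj]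
    have i2 : IntervalIntegrable (fun t => pw p' u t * |h t| ^ p) volume s m :=
      (W.integrable_U.mul_const (|σ| ^ p)).intervalIntegrable.congr fun t ht => by
        rw [uIoc_of_le hsm] at ht
        simp only [hh, if_neg (not_le.2 ht.1)]
    rw [← intervalIntegral.integral_add_adjacent_intervals i1 i2]
    congr 1
    · refine intervalIntegral.integral_congr fun t ht => ?_
      rw [uIcc_of_le hxs] at ht
      simp only [hh, if_pos ht.2, abs_spow_rpow W.conj]
    · rw [← intervalIntegral.integral_const_mul]
      refine intervalIntegral.integral_congr_ae (.of_forall fun t ht => ?_)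
      rw [uIoc_of_le hsm] at ht
      simp only [hh, if_neg (not_le.2 ht.1), mul_comm]
  rw [hAe] at hmain
  refine le_trans ?_ hmain
  have hcont : ContinuousOn (fun r => ∫ t in x..r, pw p' u t * h t) (Icc x m) :=
    intervalIntegral.continuousOn_primitive_interval' (iH x m mx mm) (by simp) |>.mono
      (by rw [uIcc_of_le (hxs.trans hsm)])
  have iB : ∀ s t, s ∈ Icc x m → t ∈ Icc x m → IntervalIntegrable
      (fun r => pw q v r * |∫ t in x..r, pw p' u t * h t| ^ q) volume s t := fun s t hs ht =>
    W.integrable_V.intervalIntegrable.mul_continuousOn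
      ((hcont.abs.rpow_const fun _ _ => Or.inr hq0.le).mono (ordConnected_Icc.uIcc_subset hs ht))
  rw [← intervalIntegral.integral_add_adjacent_intervals (iB x s mx ms) (iB s m ms mm)]
  have hnn : 0 ≤ ∫ r in s..m, pw q v r * |∫ t in x..r, pw p' u t * h t| ^ q :=
    intervalIntegral.integral_nonneg hsm fun _ _ =>
      mul_nonneg (pw_nonneg _ _ _) (Real.rpow_nonneg (abs_nonneg _) _)
  have he : ∫ t in x..s, pw q v t * |F t| ^ q =
      ∫ r in x..s, pw q v r * |∫ t in x..r, pw p' u t * h t| ^ q := by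
    refine intervalIntegral.integral_congr fun t ht => ?_
    rw [uIcc_of_le hxs] at ht
    simp only [e1 t ht]
  linarith

/-- Competitor on `[m, y]` obtained by continuing a solution on `[s, y]` to the left with constant
slope. -/
theorem kap_ge_right (W : Weights a b p p' q u v) {lam s m σ : ℝ} {F G : ℝ → ℝ} (hms : m ≤ s)
    (hsy : s ≤ y) (S : Sol p' q (pw p' u) (pw q v) lam s y F G) (hF : D → F y = 0)
    (hσ : F s = σ * ∫ t in m..s, pw p' u t) :
    ∫ t in s..y, pw q v t * |F t| ^ q ≤ kap p q u v D m y ^ q *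
      (|σ| ^ p * (∫ t in m..s, pw p' u t) + ∫ t in s..y, pw p' u t * |G t| ^ p') ^ (q / p) := by
  have hp' := W.one_lt_p'
  have hq0 : 0 < q := by linarith [W.one_lt_q]
  set h : ℝ → ℝ := fun t => if t ≤ s then σ else spow p' (G t) with hh
  have hc := (continuous_spow hp').comp_continuousOn S.contG
  obtain ⟨C, hC⟩ := isCompact_Icc.exists_bound_of_continuousOn hc
  have hC' : ∀ t ∈ Icc m y, |h t| ≤ max C |σ| := fun t ht => by
    simp only [hh]; split_ifs with h1
    · exact le_max_right _ _
    · exact (hC t ⟨(not_le.1 h1).le, ht.2⟩).trans (le_max_left _ _)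
  have hm : AEStronglyMeasurable h (volume.restrict (Icc m y)) := by
    have e : h =ᵐ[volume.restrict (Icc m y)]
        (Ioc s y).piecewise (fun t => spow p' (G t)) (fun _ => σ) := by
      refine (ae_restrict_iff' measurableSet_Icc).2 (.of_forall fun t ht => ?_)
      simp only [hh, Set.piecewise, mem_Ioc, ht.2, and_true]
      by_cases h1 : t ≤ s
      · rw [if_pos h1, if_neg (not_lt.2 h1)]
      · rw [if_neg h1, if_pos (not_le.1 h1)]
    refine AEStronglyMeasurable.congr ?_ e.symm
    refine AEStronglyMeasurable.piecewise measurableSet_Ioc ?_ aestronglyMeasurable_const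
    refine ((hc.aestronglyMeasurable (μ := volume) measurableSet_Icc).mono_measure
      (Measure.restrict_mono Ioc_subset_Icc_self le_rfl)).mono_measure ?_
    exact Measure.restrict_mono_measure Measure.restrict_le_self _
  have hmul : AEStronglyMeasurable ((Icc m y).indicator h) volume :=
    (aestronglyMeasurable_indicator_iff measurableSet_Icc).2 hm
  have iH : ∀ s t, s ∈ Icc m y → t ∈ Icc m y →
      IntervalIntegrable (fun r => pw p' u r * h r) volume s t := fun s t hs ht => by
    have : Integrable fun r => pw p' u r * (Icc m y).indicator h r := by
      refine W.integrable_U.mul_bdd (c := max C |σ|) hmul (.of_forall fun r => ?_)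
      by_cases hr : r ∈ Icc m y
      · rw [indicator_of_mem hr]; exact hC' r hr
      · rw [indicator_of_notMem hr, norm_zero]; exact le_max_of_le_right (abs_nonneg _)
    refine this.intervalIntegrable.congr (fun r hr => ?_)
    rw [indicator_of_mem (ordConnected_Icc.uIcc_subset hs ht (uIoc_subset_uIcc hr))]
  have mm : m ∈ Icc m y := ⟨le_rfl, hms.trans hsy⟩
  have ms : s ∈ Icc m y := ⟨hms, hsy⟩
  have my : y ∈ Icc m y := ⟨hms.trans hsy, le_rfl⟩
  have e1 : ∫ t in m..s, pw p' u t * h t = F s := by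
    rw [hσ, ← intervalIntegral.integral_const_mul]
    refine intervalIntegral.integral_congr fun t ht => ?_
    rw [uIcc_of_le hms] at ht
    simp [hh, ht.2, mul_comm]
  have e2 : ∀ r ∈ Icc s y, ∫ t in m..r, pw p' u t * h t = F r := fun r hr => by
    have hr' : r ∈ Icc m y := ⟨hms.trans hr.1, hr.2⟩
    rw [← intervalIntegral.integral_add_adjacent_intervals (iH m s mm ms) (iH s r ms hr'), e1,
      S.eqF r hr]
    congr 1
    refine intervalIntegral.integral_congr_ae (.of_forall fun t ht => ?_)
    rw [uIoc_of_le hr.1] at ht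
    simp [hh, not_le.2 ht.1]
  have hmain := W.integral_le_kap' (D := D) (hms.trans hsy) hm hC' (fun hd => by
    rw [e2 y ⟨hsy, le_rfl⟩, hF hd])
  have hAe : ∫ t in m..y, pw p' u t * |h t| ^ p =
      |σ| ^ p * (∫ t in m..s, pw p' u t) + ∫ t in s..y, pw p' u t * |G t| ^ p' := by
    have i1 : IntervalIntegrable (fun t => pw p' u t * |h t| ^ p) volume s y :=
      (S.intervalIntegrable_G W ⟨le_rfl, hsy⟩ ⟨hsy, le_rfl⟩).congr fun t ht => by
        rw [uIoc_of_le hsy] at ht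
        simp only [hh, if_neg (not_le.2 ht.1), abs_spow_rpow W.conj]
    have i2 : IntervalIntegrable (fun t => pw p' u t * |h t| ^ p) volume m s :=
      (W.integrable_U.mul_const (|σ| ^ p)).intervalIntegrable.congr fun t ht => by
        rw [uIoc_of_le hms] at ht
        simp only [hh, if_pos ht.2]
    rw [← intervalIntegral.integral_add_adjacent_intervals i2 i1]
    congr 1
    · rw [← intervalIntegral.integral_const_mul]
      refine intervalIntegral.integral_congr fun t ht => ?_
      rw [uIcc_of_le hms] at ht
      simp only [hh, if_pos ht.2, mul_comm]
    · refine intervalIntegral.integral_congr_ae (.of_forall fun t ht => ?_)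
      rw [uIoc_of_le hsy] at ht
      simp only [hh, if_neg (not_le.2 ht.1), abs_spow_rpow W.conj]
  rw [hAe] at hmain
  refine le_trans ?_ hmain
  have hcont : ContinuousOn (fun r => ∫ t in m..r, pw p' u t * h t) (Icc m y) :=
    intervalIntegral.continuousOn_primitive_interval' (iH m y mm my) (by simp) |>.mono
      (by rw [uIcc_of_le (hms.trans hsy)])
  have iB : ∀ s t, s ∈ Icc m y → t ∈ Icc m y → IntervalIntegrable
      (fun r => pw q v r * |∫ t in m..r, pw p' u t * h t| ^ q) volume s t := fun s t hs ht =>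
    W.integrable_V.intervalIntegrable.mul_continuousOn
      ((hcont.abs.rpow_const fun _ _ => Or.inr hq0.le).mono (ordConnected_Icc.uIcc_subset hs ht))
  rw [← intervalIntegral.integral_add_adjacent_intervals (iB m s mm ms) (iB s y ms my)]
  have hnn : 0 ≤ ∫ r in m..s, pw q v r * |∫ t in m..r, pw p' u t * h t| ^ q :=
    intervalIntegral.integral_nonneg hms fun _ _ =>
      mul_nonneg (pw_nonneg _ _ _) (Real.rpow_nonneg (abs_nonneg _) _)
  have he : ∫ t in s..y, pw q v t * |F t| ^ q =
      ∫ r in s..y, pw q v r * |∫ t in m..r, pw p' u t * h t| ^ q := by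
    refine intervalIntegral.integral_congr fun t ht => ?_
    rw [uIcc_of_le hsy] at ht
    simp only [e2 t ht]
  linarith

/-- The value of one interval in the partition functional. -/
theorem value_le {A B κ k : ℝ} (hp : 0 < p) (hpq : p < q) (hk : k = p / (q - p)) (hA : 0 ≤ A)
    (hB : 0 < B) (h : B ≤ κ ^ q * A ^ (q / p)) :
    ((κ ^ q)⁻¹) ^ k ≤ A ^ (k + 1) * B ^ (-k) := by
  have hqp : 0 < q - p := by linarith
  have hk0 : 0 < k := by rw [hk]; positivity
  have hq0 : 0 < q := by linarith
  have hApos : 0 < A := by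
    rcases hA.eq_or_lt with h0 | h0
    · rw [← h0, Real.zero_rpow (by positivity), mul_zero] at h; linarith
    · exact h0
  have hAq : 0 < A ^ (q / p) := Real.rpow_pos_of_pos hApos _
  have hκ : 0 < κ ^ q := by
    by_contra hcon
    have := mul_nonpos_of_nonpos_of_nonneg (not_lt.1 hcon) hAq.le
    linarith
  have h1 : (κ ^ q)⁻¹ ≤ A ^ (q / p) / B := by
    rw [le_div_iff₀ hB, inv_mul_le_iff₀ hκ]; exact h
  refine (Real.rpow_le_rpow (inv_pos.2 hκ).le h1 hk0.le).trans_eq ?_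
  -- The choice `k = p / (q - p)` is the one for which `q / p * k = k + 1`.
  rw [Real.div_rpow hAq.le hB.le, ← Real.rpow_mul hA, Real.rpow_neg hB.le, div_eq_mul_inv]
  congr 2
  rw [hk]; field_simp; ring

end corner

section corner

variable {a b p p' q : ℝ} {u v : ℝ → ℝ} {D : Prop} {x y : ℝ}

theorem exists_integral_eq {w : ℝ → ℝ} (hw : Integrable w) {s t τ : ℝ} (hst : s ≤ t) (h0 : 0 < τ)
    (h1 : τ < ∫ r in s..t, w r) : ∃ m ∈ Ioo s t, ∫ r in s..m, w r = τ := by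
  have hc : ContinuousOn (fun m => ∫ r in s..m, w r) (Icc s t) := by
    have := intervalIntegral.continuousOn_primitive_interval' (μ := volume)
      (hw.intervalIntegrable (a := s) (b := t)) left_mem_uIcc
    rwa [uIcc_of_le hst] at this
  have := intermediate_value_Ioo hst hc
  obtain ⟨m, hm, e⟩ := this (show τ ∈ Ioo _ _ from ⟨by simpa using h0, h1⟩)
  exact ⟨m, hm, e⟩

theorem exists_integral_eq_left {w : ℝ → ℝ} (hw : Integrable w) {s t τ : ℝ} (hst : s ≤ t)
    (h0 : 0 < τ) (h1 : τ < ∫ r in s..t, w r) : ∃ m ∈ Ioo s t, ∫ r in m..t, w r = τ := by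
  obtain ⟨m, hm, e⟩ := exists_integral_eq hw hst (sub_pos.2 h1) (by linarith)
  refine ⟨m, hm, ?_⟩
  have := intervalIntegral.integral_add_adjacent_intervals (hw.intervalIntegrable (a := s) (b := m))
    (hw.intervalIntegrable (a := m) (b := t))
  linarith

/-- An extremal arc attains equality in `value_le`, so the optimal value can be compared with `A ^
(k + 1) * B ^ (-k)` for any cut competitor. -/
theorem value_eq {A B κ k : ℝ} (hp : 0 < p) (hpq : p < q) (hk : k = p / (q - p)) (hA : 0 < A)
    (hB : 0 < B) (h : B = κ ^ q * A ^ (q / p)) :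
    ((κ ^ q)⁻¹) ^ k = A ^ (k + 1) * B ^ (-k) := by
  have hqp : 0 < q - p := by linarith
  have hAq : 0 < A ^ (q / p) := Real.rpow_pos_of_pos hA _
  have h1 : (κ ^ q)⁻¹ = A ^ (q / p) / B := by rw [h]; field_simp
  rw [h1, Real.div_rpow hAq.le hB.le, ← Real.rpow_mul hA.le, Real.rpow_neg hB.le, div_eq_mul_inv]
  congr 2
  rw [hk]; field_simp; ring

set_option maxHeartbeats 1000000 in
/-- At a minimiser of the partition functional the arcs on both sides of a node have the same
slope: otherwise the corner could be cut. -/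
theorem corner_match (W : Weights a b p p' q u v) (hpq : p < q) {k lam m : ℝ}
    (hk : k = p / (q - p)) (hlam : 0 < lam) (hx : a ≤ x) (hxm : x < m) (hmy : m < y) (hy : y ≤ b)
    {F₁ G₁ F₂ G₂ : ℝ → ℝ} (S₁ : Sol p' q (pw p' u) (pw q v) lam x m F₁ G₁)
    (S₂ : Sol p' q (pw p' u) (pw q v) lam m y F₂ G₂) (hF₁x : F₁ x = 0) (hF₁m : F₁ m = 0)
    (hF₂m : F₂ m = 0) (hF₂y : D → F₂ y = 0) (hG₂y : ¬ D → G₂ y = 0)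
    (pos₁ : ∀ t ∈ Ioo x m, 0 < F₁ t) (neg₂ : ∀ t ∈ Ioo m y, F₂ t < 0)
    (ext₁ : ∫ t in x..m, pw q v t * |F₁ t| ^ q =
      kap p q u v True x m ^ q * (∫ t in x..m, pw p' u t * |G₁ t| ^ p') ^ (q / p))
    (ext₂ : ∫ t in m..y, pw q v t * |F₂ t| ^ q =
      kap p q u v D m y ^ q * (∫ t in m..y, pw p' u t * |G₂ t| ^ p') ^ (q / p))
    (hmin : ∀ m' ∈ Ioo x y,
      ((kap p q u v True x m ^ q)⁻¹) ^ k + ((kap p q u v D m y ^ q)⁻¹) ^ k ≤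
      ((kap p q u v True x m' ^ q)⁻¹) ^ k + ((kap p q u v D m' y ^ q)⁻¹) ^ k) :
    G₁ m = G₂ m := by
  have hp0 := W.conj.pos
  have hp' := W.one_lt_p'
  have hq := W.one_lt_q
  have hk0 : 0 < k := by rw [hk]; exact div_pos hp0 (by linarith)
  set h₁ := spow p' (G₁ m) with hh₁
  set h₂ := spow p' (G₂ m) with hh₂
  suffices h₁ = h₂ by
    have := congrArg (spow p) this
    rwa [hh₁, hh₂, spow_spow W.conj, spow_spow W.conj] at this
  by_contra hne
  set c := (h₁ + h₂) / 2 with hc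
  -- Measured by the mass of `u^{p'}`, `F` has slopes `h₁` and `h₂` at the two sides of the node.
  -- Replacing both by their mean `c` saves energy at the rate `g`, by strict convexity.
  have hg0 := two_mul_abs_midpoint_rpow_lt W.conj hne
  rw [← hc] at hg0
  set g := |h₁| ^ p + |h₂| ^ p - 2 * |c| ^ p with hg
  have hgpos : 0 < g := by rw [hg]; linarith
  -- Four errors of size `ε'` will consume half of the gain, leaving the rate `g / 2` that is passed
  -- to `eventually_sum_lt`.
  set ε' := g / 8 with hε'
  have hε'0 : 0 < ε' := by positivity
  obtain ⟨ε, hε0, hεh⟩ : ∃ ε > 0, ∀ h ∈ ({h₁, h₂, c} : Set ℝ), ∀ z, |z - h| ≤ ε →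
      |(|z| ^ p) - |h| ^ p| ≤ ε' := by
    have key : ∀ h : ℝ, ∃ ε > 0, ∀ z, |z - h| ≤ ε → |(|z| ^ p) - |h| ^ p| ≤ ε' := fun h => by
      have hcont : ContinuousAt (fun z : ℝ => |z| ^ p) h :=
        (continuous_abs.rpow_const fun _ => Or.inr hp0.le).continuousAt
      obtain ⟨ε, hε, hz⟩ := Metric.continuousAt_iff.1 hcont ε' hε'0
      refine ⟨ε / 2, half_pos hε, fun z hzh => ?_⟩
      have := hz (x := z) (by rw [Real.dist_eq]; linarith)
      rw [Real.dist_eq] at this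
      exact this.le
    obtain ⟨e1, p1, q1⟩ := key h₁
    obtain ⟨e2, p2, q2⟩ := key h₂
    obtain ⟨e3, p3, q3⟩ := key c
    refine ⟨min e1 (min e2 e3), by positivity, ?_⟩
    rintro h (rfl | rfl | rfl) z hz
    · exact q1 z (hz.trans (min_le_left _ _))
    · exact q2 z (hz.trans ((min_le_right _ _).trans (min_le_left _ _)))
    · exact q3 z (hz.trans ((min_le_right _ _).trans (min_le_right _ _)))
  obtain ⟨s₀, hs₀, hs₀'⟩ : ∃ s₀ ∈ Ico x m, ∀ t ∈ Icc s₀ m, |spow p' (G₁ t) - h₁| ≤ ε := by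
    have hcw := ((continuous_spow hp').comp_continuousOn S₁.contG) m ⟨hxm.le, le_rfl⟩
    obtain ⟨η, hη, hη'⟩ := Metric.continuousWithinAt_iff.1 hcw ε hε0
    refine ⟨max x (m - η / 2), ⟨le_max_left _ _, max_lt hxm (by linarith)⟩, fun t ht => ?_⟩
    have h1 := (le_max_left _ _).trans ht.1
    have h2 := (le_max_right _ _).trans ht.1
    have := hη' (x := t) ⟨h1, ht.2⟩ (by rw [Real.dist_eq, abs_lt]; constructor <;> linarith [ht.2])
    rw [Real.dist_eq] at this
    exact this.le
  obtain ⟨t₀, ht₀, ht₀'⟩ : ∃ t₀ ∈ Ioc m y, ∀ t ∈ Icc m t₀, |spow p' (G₂ t) - h₂| ≤ ε := by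
    have hcw := ((continuous_spow hp').comp_continuousOn S₂.contG) m ⟨le_rfl, hmy.le⟩
    obtain ⟨η, hη, hη'⟩ := Metric.continuousWithinAt_iff.1 hcw ε hε0
    refine ⟨min y (m + η / 2), ⟨lt_min hmy (by linarith), min_le_left _ _⟩, fun t ht => ?_⟩
    have h1 := ht.2.trans (min_le_left _ _)
    have h2 := ht.2.trans (min_le_right _ _)
    have := hη' (x := t) ⟨ht.1, h1⟩ (by rw [Real.dist_eq, abs_lt]; constructor <;> linarith [ht.1])
    rw [Real.dist_eq] at this
    exact this.le
  set A₁ := ∫ t in x..m, pw p' u t * |G₁ t| ^ p' with hA₁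
  set A₂ := ∫ t in m..y, pw p' u t * |G₂ t| ^ p' with hA₂
  set B₁ := ∫ t in x..m, pw q v t * |F₁ t| ^ q with hB₁
  set B₂ := ∫ t in m..y, pw q v t * |F₂ t| ^ q with hB₂
  have mxx : x ∈ Icc x m := ⟨le_rfl, hxm.le⟩
  have mm1 : m ∈ Icc x m := ⟨hxm.le, le_rfl⟩
  have mm2 : m ∈ Icc m y := ⟨le_rfl, hmy.le⟩
  have myy : y ∈ Icc m y := ⟨hmy.le, le_rfl⟩
  have Vpos : ∀ t ∈ Icc x y, 0 < pw q v t := fun t ht =>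
    W.V_pos ⟨hx.trans ht.1, ht.2.trans hy⟩
  have posB₁ : ∀ s, x < s → s ≤ m → 0 < ∫ t in x..s, pw q v t * |F₁ t| ^ q := fun s hs hsm =>
    integral_pos_of_pos_on hs (S₁.intervalIntegrable_F W mxx ⟨hs.le, hsm⟩) fun t ht =>
      mul_pos (Vpos t ⟨ht.1.le, by linarith [ht.2]⟩)
        (Real.rpow_pos_of_pos (abs_pos.2 (pos₁ t ⟨ht.1, ht.2.trans_le hsm⟩).ne') _)
  have posB₂ : ∀ s, s < y → m ≤ s → 0 < ∫ t in s..y, pw q v t * |F₂ t| ^ q := fun s hs hsm =>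
    integral_pos_of_pos_on hs (S₂.intervalIntegrable_F W ⟨hsm, hs.le⟩ myy) fun t ht =>
      mul_pos (Vpos t ⟨by linarith [ht.1], ht.2.le⟩)
        (Real.rpow_pos_of_pos (abs_pos.2 (neg₂ t ⟨hsm.trans_lt ht.1, ht.2⟩).ne) _)
  have en₁ : A₁ = lam * B₁ := by
    rw [hA₁, S₁.energy hp' hq W.integrable_U W.integrable_V hxm.le, hF₁m, hF₁x]; ring
  have en₂ : A₂ = lam * B₂ := by
    have h0 : F₂ y * G₂ y = 0 := by
      by_cases hD : D
      · rw [hF₂y hD, zero_mul]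
      · rw [hG₂y hD, mul_zero]
    rw [hA₂, S₂.energy hp' hq W.integrable_U W.integrable_V hmy.le, hF₂m, h0]; ring
  have hB₁0 : 0 < B₁ := posB₁ m hxm le_rfl
  have hB₂0 : 0 < B₂ := posB₂ m hmy le_rfl
  have hA₁0 : 0 < A₁ := by rw [en₁]; positivity
  have hA₂0 : 0 < A₂ := by rw [en₂]; positivity
  set Vt := ∫ t, pw q v t with hVt
  have hVt0 : 0 ≤ Vt := integral_nonneg fun _ => pw_nonneg _ _ _
  set C := 2 * (|c| ^ p + ε') + (|h₁| ^ p + ε') + (|h₂| ^ p + ε') +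
    Vt * (|h₁| + ε) ^ q + Vt * (|h₂| + ε) ^ q + 1 with hC
  have hc0 : 0 ≤ |c| ^ p := by positivity
  have hh10 : 0 ≤ |h₁| ^ p := by positivity
  have hh20 : 0 ≤ |h₂| ^ p := by positivity
  have hq1 : 0 ≤ Vt * (|h₁| + ε) ^ q := by positivity
  have hq2 : 0 ≤ Vt * (|h₂| + ε) ^ q := by positivity
  have hCpos : 0 < C := by rw [hC]; linarith
  have iU : ∀ s t, IntervalIntegrable (pw p' u) volume s t :=
    fun s t => W.integrable_U.intervalIntegrable
  have I₁ : 0 < ∫ t in s₀..m, pw p' u t :=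
    W.integral_U_pos (hx.trans hs₀.1) hs₀.2 (hmy.le.trans hy)
  have I₂ : 0 < ∫ t in m..t₀, pw p' u t :=
    W.integral_U_pos (hx.trans hxm.le) ht₀.1 (ht₀.2.trans hy)
  have hδ : Tendsto (fun δ : ℝ => δ) (𝓝[>] 0) (𝓝 0) := tendsto_id.mono_left nhdsWithin_le_nhds
  obtain ⟨δ, hev, hδ1, hδ2, hδ0⟩ := ((eventually_sum_lt hB₁0 hB₂0 hlam en₁ en₂ hk0 hq hCpos
    (half_pos hgpos)).and ((hδ.eventually_lt_const I₁).and ((hδ.eventually_lt_const I₂).and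
      self_mem_nhdsWithin))).exists
  have hδ0 : 0 < δ := hδ0
  obtain ⟨s, hs, es⟩ := exists_integral_eq_left W.integrable_U hs₀.2.le hδ0 hδ1
  obtain ⟨t, ht, et⟩ := exists_integral_eq W.integrable_U ht₀.1.le hδ0 hδ2
  have hxs : x < s := hs₀.1.trans_lt hs.1
  have hty : t < y := ht.2.trans_le ht₀.2
  have hα : 0 < F₁ s := pos₁ s ⟨hxs, hs.2⟩
  have hβ : F₂ t < 0 := neg₂ t ⟨ht.1, hty⟩
  -- The chord from `F₁ s` to `F₂ t` in the mass variable: the masses of `[s, m]` and `[m, t]` are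
  -- both `δ`, so its slope `σ` is close to `c`. It meets zero after mass `τ`, and this fixes the
  -- new node `m'`.
  set σ := (F₂ t - F₁ s) / (2 * δ) with hσ
  set τ := 2 * δ * F₁ s / (F₁ s - F₂ t) with hτ
  have hαβ : 0 < F₁ s - F₂ t := by linarith
  have hτ0 : 0 < τ := by positivity
  have hτ2 : τ < 2 * δ := by
    rw [hτ, div_lt_iff₀ hαβ]
    exact mul_lt_mul_of_pos_left (by linarith) (by linarith)
  have est : ∫ r in s..t, pw p' u r = 2 * δ := by
    rw [← intervalIntegral.integral_add_adjacent_intervals (iU s m) (iU m t), es, et]; ring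
  have hst : s < t := hs.2.trans ht.1
  obtain ⟨m', hm', em'⟩ := exists_integral_eq W.integrable_U hst.le hτ0 (by rw [est]; exact hτ2)
  have em'' : ∫ r in m'..t, pw p' u r = 2 * δ - τ := by
    have := intervalIntegral.integral_add_adjacent_intervals (iU s m') (iU m' t)
    linarith
  have N₁ := (S₁.mono hp' hq W.integrable_U W.integrable_V hxs.le hs.2.le le_rfl).near W hs.2.le
    hε0.le es (fun r hr => hs₀' r ⟨hs.1.le.trans hr.1, hr.2⟩)
    (fun r hr => hεh h₁ (by simp) _ (hs₀' r ⟨hs.1.le.trans hr.1, hr.2⟩))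
  have N₂ := (S₂.mono hp' hq W.integrable_U W.integrable_V le_rfl ht.1.le hty.le).near W ht.1.le
    hε0.le et (fun r hr => ht₀' r ⟨hr.1, hr.2.trans ht.2.le⟩)
    (fun r hr => hεh h₂ (by simp) _ (ht₀' r ⟨hr.1, hr.2.trans ht.2.le⟩))
  obtain ⟨n₁a, n₁b, n₁c, n₁d⟩ := N₁
  obtain ⟨n₂a, n₂b, n₂c, n₂d⟩ := N₂
  have n₁d := n₁d (Or.inr hF₁m)
  have n₂d := n₂d (Or.inl hF₂m)
  have hσc : |σ - c| ≤ ε := by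
    have e : σ - c = (F₂ t - F₁ s - (h₁ + h₂) * δ) / (2 * δ) := by
      rw [hσ, hc]; field_simp
    rw [e, abs_div, abs_of_pos (show 0 < 2 * δ by linarith), div_le_iff₀ (by linarith)]
    rw [hF₁m] at n₁a
    rw [hF₂m] at n₂a
    rw [abs_le] at n₁a n₂a ⊢
    constructor <;> linarith [n₁a.1, n₁a.2, n₂a.1, n₂a.2]
  have hσp := hεh c (by simp) σ hσc
  have hσp' := (abs_le.1 hσp).2
  have hσ0 : 0 ≤ |σ| ^ p := by positivity
  have hL := kap_ge_left W hxs.le hm'.1.le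
    (S₁.mono hp' hq W.integrable_U W.integrable_V le_rfl hxs.le hs.2.le) hF₁x (σ := σ)
    (by rw [em', hσ, hτ]; field_simp; ring)
  have hR := kap_ge_right (D := D) W hm'.2.le hty.le
    (S₂.mono hp' hq W.integrable_U W.integrable_V ht.1.le hty.le le_rfl) hF₂y (σ := σ)
    (by rw [em'', hσ, hτ]; field_simp; ring)
  rw [em'] at hL
  rw [em''] at hR
  have spA₁ := intervalIntegral.integral_add_adjacent_intervals
    (S₁.intervalIntegrable_G W mxx ⟨hxs.le, hs.2.le⟩)
    (S₁.intervalIntegrable_G W ⟨hxs.le, hs.2.le⟩ mm1)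
  have spB₁ := intervalIntegral.integral_add_adjacent_intervals
    (S₁.intervalIntegrable_F W mxx ⟨hxs.le, hs.2.le⟩)
    (S₁.intervalIntegrable_F W ⟨hxs.le, hs.2.le⟩ mm1)
  have spA₂ := intervalIntegral.integral_add_adjacent_intervals
    (S₂.intervalIntegrable_G W mm2 ⟨ht.1.le, hty.le⟩)
    (S₂.intervalIntegrable_G W ⟨ht.1.le, hty.le⟩ myy)
  have spB₂ := intervalIntegral.integral_add_adjacent_intervals
    (S₂.intervalIntegrable_F W mm2 ⟨ht.1.le, hty.le⟩)
    (S₂.intervalIntegrable_F W ⟨ht.1.le, hty.le⟩ myy)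
  rw [← hA₁] at spA₁
  rw [← hA₂] at spA₂
  rw [← hB₁] at spB₁
  rw [← hB₂] at spB₂
  have pB₁ := posB₁ s hxs hs.2.le
  have pB₂ := posB₂ t hty ht.1.le
  have nnG : ∀ (w : ℝ → ℝ) (r₁ r₂ : ℝ), r₁ ≤ r₂ → 0 ≤ ∫ r in r₁..r₂, pw p' u r * |w r| ^ p' :=
    fun w r₁ r₂ h => intervalIntegral.integral_nonneg h fun _ _ =>
      mul_nonneg (pw_nonneg _ _ _) (Real.rpow_nonneg (abs_nonneg _) _)
  have g1 := nnG G₁ x s hxs.le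
  have g2 := nnG G₂ t y hty.le
  have g3 := nnG G₁ s m hs.2.le
  have g4 := nnG G₂ m t ht.1.le
  set a₁ := ∫ r in x..s, pw p' u r * |G₁ r| ^ p'
  set a₂ := ∫ r in t..y, pw p' u r * |G₂ r| ^ p'
  set b₁ := ∫ r in x..s, pw q v r * |F₁ r| ^ q
  set b₂ := ∫ r in t..y, pw q v r * |F₂ r| ^ q
  have στ : 0 ≤ |σ| ^ p * τ := by positivity
  have στ' : 0 ≤ |σ| ^ p * (2 * δ - τ) := mul_nonneg hσ0 (by linarith)
  have στsum : |σ| ^ p * τ + |σ| ^ p * (2 * δ - τ) ≤ 2 * (|c| ^ p + ε') * δ := by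
    have := mul_le_mul_of_nonneg_right (show |σ| ^ p ≤ |c| ^ p + ε' by linarith)
      (show 0 ≤ 2 * δ by linarith)
    linarith
  have hV1 := value_le hp0 hpq hk (by linarith) pB₁ hL
  have hV2 := value_le hp0 hpq hk (by linarith) pB₂ hR
  have hCδ : C * δ = 2 * (|c| ^ p + ε') * δ + (|h₁| ^ p + ε') * δ + (|h₂| ^ p + ε') * δ +
      Vt * (|h₁| + ε) ^ q * δ + Vt * (|h₂| + ε) ^ q * δ + δ := by rw [hC]; ring
  have hCq : Vt * (|h₁| + ε) ^ q * δ ^ q ≤ C * δ ^ q ∧ Vt * (|h₂| + ε) ^ q * δ ^ q ≤ C * δ ^ q := by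
    constructor <;> refine mul_le_mul_of_nonneg_right ?_ (by positivity) <;> rw [hC] <;> linarith
  have k1 : 0 ≤ 2 * (|c| ^ p + ε') * δ := by positivity
  have k2 : 0 ≤ (|h₁| ^ p + ε') * δ := by positivity
  have k3 : 0 ≤ (|h₂| ^ p + ε') * δ := by positivity
  have k4 : 0 ≤ Vt * (|h₁| + ε) ^ q * δ := by positivity
  have k5 : 0 ≤ Vt * (|h₂| + ε) ^ q * δ := by positivity
  -- The competitors keep the arcs outside `[s, t]`. The masses lost with the removed parts of `F`
  -- are of order `δ ^ q`, since `F` vanishes at `m` with bounded slope.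
  have hlt := hev (a₁ + |σ| ^ p * τ) (|σ| ^ p * (2 * δ - τ) + a₂) b₁ b₂
    (by rw [abs_le]; constructor <;> linarith) (by rw [abs_le]; constructor <;> linarith)
    (by
      have : g / 2 * δ = (|h₁| ^ p - ε') * δ + (|h₂| ^ p - ε') * δ - 2 * (|c| ^ p + ε') * δ := by
        rw [hε', hg]; ring
      linarith)
    (by linarith [hCq.1]) (by linarith [hCq.2])
  have hV1' := value_eq hp0 hpq hk hA₁0 hB₁0 ext₁
  have hV2' := value_eq hp0 hpq hk hA₂0 hB₂0 ext₂
  have := hmin m' ⟨hxs.trans hm'.1, hm'.2.trans hty⟩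
  linarith

end corner

/-! ### Zeros as partitions and gluing along a partition -/

section partition

variable {a b p p' q : ℝ} {u v : ℝ → ℝ} {n : ℕ} {z : ℕ → ℝ}

theorem Part.lt_of_lt (h : Part a b n z) {i j : ℕ} (hij : i < j) (hj : j ≤ n + 1) : z i < z j :=
  (h.lt i (by omega)).trans_le (h.le hij hj)

theorem Part.exists_mem (h : Part a b n z) {t : ℝ} (ht : t ∈ Ico a b) :
    ∃ i ≤ n, t ∈ Ico (z i) (z (i + 1)) := by
  have key : ∀ m ≤ n + 1, t < z m → ∃ i < m, t ∈ Ico (z i) (z (i + 1)) := by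
    intro m
    induction m with
    | zero => exact fun _ hlt => absurd ht.1 (not_le.2 (h.zero ▸ hlt))
    | succ m ih =>
      intro hm hlt
      rcases lt_or_ge t (z m) with h1 | h1
      · obtain ⟨i, hi, hti⟩ := ih (by omega) h1
        exact ⟨i, by omega, hti⟩
      · exact ⟨m, by omega, h1, hlt⟩
  obtain ⟨i, hi, hti⟩ := key (n + 1) le_rfl (h.last ▸ ht.2)
  exact ⟨i, by omega, hti⟩

/-- A function that vanishes exactly at the interior nodes of a partition. -/
theorem Part.encard_zeros (h : Part a b n z) {F : ℝ → ℝ} (h0 : ∀ i, 1 ≤ i → i ≤ n → F (z i) = 0)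
    (hne : ∀ i ≤ n, ∀ t ∈ Ioo (z i) (z (i + 1)), F t ≠ 0) :
    {t ∈ Ioo a b | F t = 0}.encard = n := by
  have e : {t ∈ Ioo a b | F t = 0} = ((Finset.Icc 1 n).image z : Finset ℝ) := by
    ext t
    simp only [mem_ofPred_eq, Finset.coe_image, mem_image, Finset.coe_Icc]
    constructor
    · rintro ⟨ht, hF⟩
      obtain ⟨i, hi, hti⟩ := h.exists_mem ⟨ht.1.le, ht.2⟩
      rcases hti.1.eq_or_lt with h1 | h1
      · refine ⟨i, ⟨?_, hi⟩, h1⟩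
        by_contra hi0
        obtain rfl : i = 0 := by omega
        rw [h.zero] at h1
        exact ht.1.ne h1
      · exact absurd hF (hne i hi t ⟨h1, hti.2⟩)
    · rintro ⟨i, hi, rfl⟩
      have h1 := h.lt_of_lt (i := 0) (j := i) (by have := hi.1; omega) (by have := hi.2; omega)
      have h2 := h.lt_of_lt (i := i) (j := n + 1) (by have := hi.2; omega) le_rfl
      rw [h.zero] at h1
      rw [h.last] at h2
      exact ⟨⟨h1, h2⟩, h0 i hi.1 hi.2⟩
  have hinj : Set.InjOn z (Finset.Icc 1 n : Finset ℕ) := by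
    intro i hi j hj hij
    simp only [Finset.coe_Icc, mem_Icc] at hi hj
    by_contra hne
    rcases Nat.lt_or_gt_of_ne hne with hl | hl
    · exact (h.lt_of_lt hl (by omega)).ne hij
    · exact (h.lt_of_lt hl (by omega)).ne' hij
  rw [e, Set.encard_coe_eq_coe_finsetCard, Finset.card_image_of_injOn hinj]
  simp

/-- The partition at the zeros of a function. -/
theorem exists_part_of_encard (hab : a < b) {F : ℝ → ℝ}
    (hF : {t ∈ Ioo a b | F t = 0}.encard = n) :
    ∃ z, Part a b n z ∧ (∀ i, 1 ≤ i → i ≤ n → F (z i) = 0) ∧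
      ∀ i ≤ n, ∀ t ∈ Ioo (z i) (z (i + 1)), F t ≠ 0 := by
  have hfin : {t ∈ Ioo a b | F t = 0}.Finite := Set.finite_of_encard_eq_coe hF
  set S := hfin.toFinset with hS
  have hcard : S.card = n := by
    have := hfin.encard_eq_coe_toFinset_card
    rw [hF] at this
    exact_mod_cast this.symm
  set e := S.orderEmbOfFin hcard with he
  have hmem : ∀ j, e j ∈ Ioo a b ∧ F (e j) = 0 := fun j => by
    exact hfin.mem_toFinset.1 (S.orderEmbOfFin_mem hcard j)
  set z : ℕ → ℝ := fun i => if i = 0 then a else if h : i - 1 < n then e ⟨i - 1, h⟩ else b with hz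
  have z0 : z 0 = a := by simp [hz]
  have zi : ∀ i (h : i < n), z (i + 1) = e ⟨i, h⟩ := fun i h => by simp [hz, h]
  have zn : z (n + 1) = b := by simp [hz]
  refine ⟨z, ⟨z0, zn, fun i hi => ?_⟩, fun i h1 h2 => ?_, fun i hi t ht hFt => ?_⟩
  · rcases Nat.eq_zero_or_pos i with rfl | h1
    · rw [z0]
      rcases Nat.eq_zero_or_pos n with h2 | h2
      · rw [show 0 + 1 = n + 1 by omega, zn]; exact hab
      · rw [zi 0 h2]; exact (hmem _).1.1
    · obtain ⟨j, rfl⟩ : ∃ j, i = j + 1 := ⟨i - 1, by omega⟩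
      rw [zi j (by omega)]
      rcases hi.eq_or_lt with h2 | h2
      · rw [h2, zn]; exact (hmem _).1.2
      · rw [zi (j + 1) h2]
        exact e.strictMono (by simp)
  · obtain ⟨j, rfl⟩ : ∃ j, i = j + 1 := ⟨i - 1, by omega⟩
    rw [zi j (by omega)]
    exact (hmem _).2
  · have hleft : ∀ i ≤ n, a ≤ z i := fun i hi => by
      rcases Nat.eq_zero_or_pos i with rfl | h1
      · exact z0.ge
      · obtain ⟨j, rfl⟩ : ∃ j, i = j + 1 := ⟨i - 1, by omega⟩
        rw [zi j (by omega)]; exact (hmem _).1.1.le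
    have hright : z (i + 1) ≤ b := by
      rcases hi.eq_or_lt with h2 | h2
      · rw [h2, zn]
      · rw [zi i h2]; exact (hmem _).1.2.le
    have htS : t ∈ S := by
      rw [hS, Set.Finite.mem_toFinset]
      exact ⟨⟨(hleft i hi).trans_lt ht.1, ht.2.trans_le hright⟩, hFt⟩
    have hr : t ∈ Set.range e := by rw [he, Finset.range_orderEmbOfFin]; exact htS
    obtain ⟨⟨j, hj⟩, rfl⟩ := hr
    have h1 : i ≤ j := by
      rcases Nat.eq_zero_or_pos i with rfl | h1
      · exact Nat.zero_le _
      · obtain ⟨k, rfl⟩ : ∃ k, i = k + 1 := ⟨i - 1, by omega⟩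
        have := ht.1
        rw [zi k (by omega), e.lt_iff_lt] at this
        exact this
    have h2 : j < i := by
      have := ht.2
      rw [zi i (by omega), e.lt_iff_lt] at this
      exact this
    omega

/-- Gluing solutions along a partition. -/
theorem Part.glue (W : Weights a b p p' q u v) (hz : Part a b n z) {lam : ℝ} {F G : ℕ → ℝ → ℝ}
    (hS : ∀ i ≤ n, Sol p' q (pw p' u) (pw q v) lam (z i) (z (i + 1)) (F i) (G i))
    (hF : ∀ i < n, F i (z (i + 1)) = F (i + 1) (z (i + 1)))
    (hG : ∀ i < n, G i (z (i + 1)) = G (i + 1) (z (i + 1))) :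
    ∃ F' G' : ℝ → ℝ, Sol p' q (pw p' u) (pw q v) lam a b F' G' ∧
      ∀ i ≤ n, EqOn F' (F i) (Icc (z i) (z (i + 1))) ∧ EqOn G' (G i) (Icc (z i) (z (i + 1))) := by
  have key : ∀ m ≤ n, ∃ F' G' : ℝ → ℝ, Sol p' q (pw p' u) (pw q v) lam (z 0) (z (m + 1)) F' G' ∧
      ∀ i ≤ m, EqOn F' (F i) (Icc (z i) (z (i + 1))) ∧
        EqOn G' (G i) (Icc (z i) (z (i + 1))) := by
    intro m
    induction m with
    | zero =>
      intro _
      refine ⟨F 0, G 0, hS 0 (Nat.zero_le _), fun i hi => ?_⟩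
      obtain rfl : i = 0 := by omega
      exact ⟨fun _ _ => rfl, fun _ _ => rfl⟩
    | succ m ih =>
      intro hm
      obtain ⟨F', G', hS', hE⟩ := ih (by omega)
      have mem : z (m + 1) ∈ Icc (z m) (z (m + 1)) := ⟨(hz.lt m (by omega)).le, le_rfl⟩
      have eF : F' (z (m + 1)) = F (m + 1) (z (m + 1)) := by
        rw [(hE m le_rfl).1 mem, hF m (by omega)]
      have eG : G' (z (m + 1)) = G (m + 1) (z (m + 1)) := by
        rw [(hE m le_rfl).2 mem, hG m (by omega)]
      refine ⟨_, _, Sol.glue W.one_lt_p' W.one_lt_q W.integrable_U W.integrable_V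
        (hz.le (Nat.zero_le _) (by omega)) (hz.lt (m + 1) hm).le hS' (hS (m + 1) hm) eF eG,
        fun i hi => ?_⟩
      rcases hi.eq_or_lt with rfl | hlt
      · constructor <;> intro t ht <;> rcases ht.1.eq_or_lt with rfl | h1
        · simp [eF]
        · simp [not_le.2 h1]
        · simp [eG]
        · simp [not_le.2 h1]
      · have hle : ∀ t ∈ Icc (z i) (z (i + 1)), t ≤ z (m + 1) := fun t ht =>
          ht.2.trans (hz.le (by omega) (by omega))
        constructor <;> intro t ht
        · simpa [hle t ht] using (hE i (by omega)).1 ht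
        · simpa [hle t ht] using (hE i (by omega)).2 ht
  have := key n le_rfl
  rwa [hz.zero, hz.last] at this

theorem Part.integral_eq_sum (hz : Part a b n z) {w : ℝ → ℝ}
    (hw : ∀ i ≤ n, IntervalIntegrable w volume (z i) (z (i + 1))) :
    ∫ t in a..b, w t = ∑ i ∈ Finset.range (n + 1), ∫ t in z i..z (i + 1), w t := by
  rw [intervalIntegral.sum_integral_adjacent_intervals fun i hi => hw i (by omega), hz.zero, hz.last]

end partition

/-! ### Spectral triples as a boundary value problem -/

section triple

variable {a b p p' q : ℝ} {u v : ℝ → ℝ} {n : ℕ}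

/-- Only the values of the weights on `[a, b]` enter, so the weights may be extended by zero to the
line. -/
theorem spectralNumbers_subset_of_eqOn {u' v' : ℝ → ℝ} (hu : EqOn u' u (Icc a b))
    (hv : EqOn v' v (Icc a b)) :
    spectralNumbers a b p q u v n ⊆ spectralNumbers a b p q u' v' n := by
  rintro lam ⟨g, f, h, hn⟩
  refine ⟨g, f, ⟨h.memLp, h.norm_eq_one, fun x hx => ?_, ?_⟩, hn⟩
  · rw [h.eq_hardyT x hx, hardyT, hardyT, hv hx]
    congr 1
    refine intervalIntegral.integral_congr fun t ht => ?_
    rw [uIcc_of_le hx.1] at ht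
    simp only [hu ⟨ht.1, ht.2.trans hx.2⟩]
  · filter_upwards [h.eq_hardyTstar, ae_restrict_mem measurableSet_Icc] with x h1 hx
    rw [h1, hardyTstar, hardyTstar, hu hx]
    congr 2
    refine intervalIntegral.integral_congr fun t ht => ?_
    rw [uIcc_of_le hx.2] at ht
    simp only [hv ⟨hx.1.trans ht.1, ht.2⟩]

theorem spectralNumbers_eq_of_eqOn {u' v' : ℝ → ℝ} (hu : EqOn u' u (Icc a b))
    (hv : EqOn v' v (Icc a b)) :
    spectralNumbers a b p q u v n = spectralNumbers a b p q u' v' n :=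
  (spectralNumbers_subset_of_eqOn hu hv).antisymm
    (spectralNumbers_subset_of_eqOn hu.symm hv.symm)

theorem eLpNorm_restrict_eq_one_iff (hp : 0 < p) (hab : a ≤ b) {f : ℝ → ℝ}
    (hf : MemLp f (ENNReal.ofReal p) (volume.restrict (Icc a b))) :
    eLpNorm f (ENNReal.ofReal p) (volume.restrict (Icc a b)) = 1 ↔ ∫ t in a..b, |f t| ^ p = 1 := by
  rw [hf.eLpNorm_eq_integral_rpow_norm (by simpa using hp) (by simp), ENNReal.toReal_ofReal hp.le,
    intervalIntegral.integral_of_le hab, ← integral_Icc_eq_integral_Ioc, ENNReal.ofReal_eq_one]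
  simp only [Real.norm_eq_abs]
  have h0 : 0 ≤ ∫ t in Icc a b, |f t| ^ p := integral_nonneg fun _ => Real.rpow_nonneg (abs_nonneg _) _
  constructor
  · intro h
    have := congrArg (· ^ p) h
    simpa [← Real.rpow_mul h0, inv_mul_cancel₀ hp.ne'] using this
  · intro h; rw [h, Real.one_rpow]

/-- Spectral triples are the solutions of the boundary value problem. -/
theorem mem_spectralNumbers_iff (W : Weights a b p p' q u v) {lam : ℝ} :
    lam ∈ spectralNumbers a b p q u v n ↔ ∃ F G : ℝ → ℝ,
      Sol p' q (pw p' u) (pw q v) lam a b F G ∧ F a = 0 ∧ G b = 0 ∧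
      ∫ t in a..b, pw p' u t * |G t| ^ p' = 1 ∧ {t ∈ Ioo a b | F t = 0}.encard = n := by
  have hp0 := W.conj.pos
  have hp' := W.one_lt_p'
  have hq := W.one_lt_q
  have hab := W.hab.le
  have hVF : ∀ (F : ℝ → ℝ) (y : ℝ), v y * spow q (v y * F y) = pw q v y * spow q (F y) :=
    fun F y => by rw [spow_mul, ← mul_assoc, mul_comm (v y), spow_mul_self hq, pw]
  have hUG : ∀ (G : ℝ → ℝ) (y : ℝ), spow p' (u y * G y) * u y = pw p' u y * spow p' (G y) :=
    fun G y => by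
      rw [spow_mul, mul_comm (spow p' (u y)), mul_assoc, spow_mul_self hp', pw, mul_comm]
  have hUG' : ∀ (G : ℝ → ℝ) (y : ℝ), |spow p' (u y * G y)| ^ p = pw p' u y * |G y| ^ p' :=
    fun G y => by
      rw [abs_spow_rpow W.conj, abs_mul, Real.mul_rpow (abs_nonneg _) (abs_nonneg _), pw]
  constructor
  · rintro ⟨g, f, h, hn⟩
    have hf' : MemL p ((Icc a b).indicator f) :=
      (memLp_indicator_iff_restrict measurableSet_Icc).2 h.memLp
    have hfu := hf'.integrable_mul W.conj W.hu
    have ifu : ∀ s ∈ Icc a b, ∫ t in a..s, f t * u t =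
        ∫ t in a..s, (Icc a b).indicator f t * u t := fun s hs => by
      refine intervalIntegral.integral_congr fun t ht => ?_
      rw [uIcc_of_le hs.1] at ht
      simp only [indicator_of_mem (show t ∈ Icc a b from ⟨ht.1, ht.2.trans hs.2⟩)]
    set F : ℝ → ℝ := fun x => ∫ t in a..x, (Icc a b).indicator f t * u t with hF
    have cF : Continuous F :=
      intervalIntegral.continuous_primitive (fun _ _ => hfu.intervalIntegrable) a
    have hgF : ∀ x ∈ Icc a b, g x = v x * F x := fun x hx => by
      rw [h.eq_hardyT x hx, hardyT, ifu x hx]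
    have iV : ∀ s t, IntervalIntegrable (fun y => pw q v y * spow q (F y)) volume s t :=
      fun s t => intervalIntegrable_mul_spow hq W.integrable_V cF.continuousOn
    -- On `[a, b]`, `u * G` is `lam` times the dual operator applied to `g_{(q)}`, so the spectral
    -- equation reads `f = (u G)_{(p')}` almost everywhere.
    set G : ℝ → ℝ := fun x => lam * ∫ y in x..b, pw q v y * spow q (F y) with hG
    have eG : ∀ x, G x = G a - lam * ∫ y in a..x, pw q v y * spow q (F y) := fun x => by
      have := intervalIntegral.integral_add_adjacent_intervals (iV a x) (iV x b)
      simp only [hG]; rw [← this]; ring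
    have cG : Continuous G := by
      rw [show G = _ from funext eG]
      exact continuous_const.sub (continuous_const.mul
        (intervalIntegral.continuous_primitive iV a))
    have hfG : ∀ᵐ x ∂(volume.restrict (Icc a b)), f x = spow p' (u x * G x) := by
      filter_upwards [h.eq_hardyTstar, ae_restrict_mem measurableSet_Icc] with x h1 hx
      have : lam * hardyTstar b u v (fun y => spow q (g y)) x = u x * G x := by
        have : ∫ y in x..b, v y * spow q (g y) = ∫ y in x..b, pw q v y * spow q (F y) := by
          refine intervalIntegral.integral_congr fun t ht => ?_
          rw [uIcc_of_le hx.2] at ht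
          simp only [hgF t ⟨hx.1.trans ht.1, ht.2⟩, hVF]
        rw [hardyTstar, this, hG]; ring
      rw [this] at h1
      rw [← h1, spow_spow W.conj.symm]
    have hfG' := (ae_restrict_iff' measurableSet_Icc).1 hfG
    refine ⟨F, G, ⟨cF.continuousOn, cG.continuousOn, fun s hs => ?_, fun s _ => eG s⟩, by simp [hF],
      by simp [hG], ?_, ?_⟩
    · have : F a = 0 := by simp [hF]
      rw [this, zero_add]
      refine intervalIntegral.integral_congr_ae ?_
      filter_upwards [hfG'] with t h1 ht
      rw [uIoc_of_le hs.1] at ht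
      have ht' : t ∈ Icc a b := ⟨ht.1.le, ht.2.trans hs.2⟩
      rw [indicator_of_mem ht', h1 ht', hUG]
    · rw [← (eLpNorm_restrict_eq_one_iff hp0 hab h.memLp).1 h.norm_eq_one]
      refine intervalIntegral.integral_congr_ae ?_
      filter_upwards [hfG'] with t h1 ht
      rw [uIoc_of_le hab] at ht
      rw [h1 ⟨ht.1.le, ht.2⟩, hUG']
    · rw [← hn, numZeros]
      congr 1
      ext t
      simp only [mem_ofPred_eq, and_congr_right_iff]
      intro ht
      have ht' := Ioo_subset_Icc_self ht
      rw [hgF t ht', mul_eq_zero, or_iff_right (W.vpos t ht').ne']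
  · rintro ⟨F, G, hS, hFa, hGb, hN, hn⟩
    have hc := (continuous_spow hp').comp_continuousOn hS.contG
    obtain ⟨C, hC⟩ := isCompact_Icc.exists_bound_of_continuousOn hc
    set f : ℝ → ℝ := fun t => spow p' (u t) * (Icc a b).indicator (fun t => spow p' (G t)) t with hf
    have hm : MemL p f :=
      memL_spow_mul_indicator W (hc.aestronglyMeasurable (μ := volume) measurableSet_Icc) hC
    have hm' : MemLp f (ENNReal.ofReal p) (volume.restrict (Icc a b)) := hm.restrict _
    have hfe : ∀ t ∈ Icc a b, f t = spow p' (u t * G t) := fun t ht => by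
      simp only [hf, indicator_of_mem ht, spow_mul]
    have hfF : ∀ x ∈ Icc a b, hardyT a u v f x = v x * F x := fun x hx => by
      rw [hardyT, hS.eqF x hx, hFa, zero_add]
      congr 1
      refine intervalIntegral.integral_congr fun t ht => ?_
      rw [uIcc_of_le hx.1] at ht
      simp only [hfe t ⟨ht.1, ht.2.trans hx.2⟩, hUG]
    refine ⟨hardyT a u v f, f, ⟨hm', (eLpNorm_restrict_eq_one_iff hp0 hab hm').2 ?_,
      fun x _ => rfl, ?_⟩, ?_⟩
    · rw [← hN]
      refine intervalIntegral.integral_congr fun t ht => ?_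
      rw [uIcc_of_le hab] at ht
      simp only [hfe t ht, hUG']
    · filter_upwards [ae_restrict_mem measurableSet_Icc] with x hx
      have e1 : ∫ y in x..b, v y * spow q (hardyT a u v f y) =
          ∫ y in x..b, pw q v y * spow q (F y) := by
        refine intervalIntegral.integral_congr fun t ht => ?_
        rw [uIcc_of_le hx.2] at ht
        simp only [hfF t ⟨hx.1.trans ht.1, ht.2⟩, hVF]
      have e2 := hS.sub_G hq W.integrable_V hx (right_mem_Icc.2 hab)
      rw [hfe x hx, spow_spow W.conj, hardyTstar, e1]
      rw [hGb] at e2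
      linear_combination (-u x) * e2
    · rw [← hn, numZeros]
      congr 1
      ext t
      simp only [mem_ofPred_eq, and_congr_right_iff]
      intro ht
      have ht' := Ioo_subset_Icc_self ht
      rw [hfF t ht', mul_eq_zero, or_iff_right (W.vpos t ht').ne']

end triple

/-! ### The least spectral number as a minimum over partitions -/

section least

variable {a b p p' q : ℝ} {u v : ℝ → ℝ} {n : ℕ}

/-- The nodal intervals of a spectral triple. -/
theorem exists_nodal (W : Weights a b p p' q u v) {lam : ℝ}
    (h : lam ∈ spectralNumbers a b p q u v n) :
    0 < lam ∧ ∃ (z N : ℕ → ℝ), Part a b n z ∧ (∀ i ≤ n, 0 < N i) ∧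
      ∑ i ∈ Finset.range (n + 1), N i = 1 ∧
      ∀ i ≤ n, N i ≤ lam * (kap p q u v (i < n) (z i) (z (i + 1)) ^ q * N i ^ (q / p)) := by
  have hp' := W.one_lt_p'
  have hq := W.one_lt_q
  obtain ⟨F, G, hS, hFa, hGb, hN, hn⟩ := (mem_spectralNumbers_iff W).1 h
  obtain ⟨z, hz, hz0, hzne⟩ := exists_part_of_encard W.hab hn
  have hSi : ∀ i ≤ n, Sol p' q (pw p' u) (pw q v) lam (z i) (z (i + 1)) F G := fun i hi =>
    hS.mono hp' hq W.integrable_U W.integrable_V (hz.mem (by omega)).1 (hz.lt i hi).le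
      (hz.mem (by omega)).2
  have hF0 : ∀ i ≤ n, F (z i) = 0 := fun i hi => by
    rcases Nat.eq_zero_or_pos i with rfl | h1
    · rw [hz.zero, hFa]
    · exact hz0 i h1 hi
  set N : ℕ → ℝ := fun i => ∫ t in z i..z (i + 1), pw p' u t * |G t| ^ p' with hNdef
  set B : ℕ → ℝ := fun i => ∫ t in z i..z (i + 1), pw q v t * |F t| ^ q with hBdef
  have hsum : ∑ i ∈ Finset.range (n + 1), N i = 1 := by
    rw [← hN, hz.integral_eq_sum fun i hi => hS.intervalIntegrable_G W (hz.mem (by omega))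
      (hz.mem (by omega))]
  -- The boundary terms vanish because `F` is zero at `a` and at the interior nodes, and `G` at `b`.
  have hen : ∀ i ≤ n, N i = lam * B i := fun i hi => by
    have h0 : F (z (i + 1)) * G (z (i + 1)) = 0 := by
      rcases hi.eq_or_lt with rfl | h1
      · rw [hz.last, hGb, mul_zero]
      · rw [hF0 (i + 1) h1, zero_mul]
    simp only [hNdef, hBdef]
    rw [(hSi i hi).energy hp' hq W.integrable_U W.integrable_V (hz.lt i hi).le, h0, hF0 i hi]
    ring
  have hB : ∀ i ≤ n, 0 < B i := fun i hi =>
    integral_pos_of_pos_on (hz.lt i hi) (hS.intervalIntegrable_F W (hz.mem (by omega))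
      (hz.mem (by omega))) fun t ht => mul_pos
        (W.V_pos ⟨(hz.mem (by omega)).1.trans ht.1.le, ht.2.le.trans (hz.mem (by omega)).2⟩)
        (Real.rpow_pos_of_pos (abs_pos.2 (hzne i hi t ht)) _)
  have hlam : 0 < lam := by
    by_contra hcon
    have : ∑ i ∈ Finset.range (n + 1), N i ≤ 0 := Finset.sum_nonpos fun i hi => by
      have hi' : i ≤ n := by simpa [Nat.lt_succ_iff] using hi
      rw [hen i hi']
      exact mul_nonpos_of_nonpos_of_nonneg (not_lt.1 hcon) (hB i hi').le
    linarith
  refine ⟨hlam, z, N, hz, fun i hi => ?_, hsum, fun i hi => ?_⟩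
  · rw [hen i hi]; exact mul_pos hlam (hB i hi)
  · conv_lhs => rw [hen i hi]
    exact mul_le_mul_of_nonneg_left ((hSi i hi).integral_le_kap W (hz.lt i hi).le (hF0 i hi)
      fun h1 => hF0 (i + 1) h1) hlam.le

/-- Arcs with matching slopes give a solution of the boundary value problem. -/
theorem exists_of_arcs (W : Weights a b p p' q u v) {z : ℕ → ℝ} (hz : Part a b n z) {lam : ℝ}
    {F G : ℕ → ℝ → ℝ}
    (hS : ∀ i ≤ n, Sol p' q (pw p' u) (pw q v) lam (z i) (z (i + 1)) (F i) (G i))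
    (hF0 : ∀ i ≤ n, F i (z i) = 0) (hF1 : ∀ i < n, F i (z (i + 1)) = 0) (hGb : G n b = 0)
    (hne : ∀ i ≤ n, ∀ t ∈ Ioo (z i) (z (i + 1)), F i t ≠ 0)
    (hG : ∀ i < n, G i (z (i + 1)) = G (i + 1) (z (i + 1))) :
    ∃ F' G' : ℝ → ℝ, Sol p' q (pw p' u) (pw q v) lam a b F' G' ∧ F' a = 0 ∧ G' b = 0 ∧
      ∫ t in a..b, pw p' u t * |G' t| ^ p' =
        ∑ i ∈ Finset.range (n + 1), ∫ t in z i..z (i + 1), pw p' u t * |G i t| ^ p' ∧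
      {t ∈ Ioo a b | F' t = 0}.encard = n := by
  obtain ⟨F', G', hS', hE⟩ := hz.glue W hS (fun i hi => by rw [hF1 i hi, hF0 (i + 1) hi]) hG
  have hl : ∀ i ≤ n, z i ∈ Icc (z i) (z (i + 1)) := fun i hi => ⟨le_rfl, (hz.lt i hi).le⟩
  refine ⟨F', G', hS', ?_, ?_, ?_, hz.encard_zeros (fun i h1 h2 => ?_) fun i hi t ht => ?_⟩
  · rw [← hz.zero, (hE 0 (Nat.zero_le _)).1 (hl 0 (Nat.zero_le _)), hF0 0 (Nat.zero_le _)]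
  · have := (hE n le_rfl).2 (show z (n + 1) ∈ _ from ⟨(hz.lt n le_rfl).le, le_rfl⟩)
    rwa [hz.last, hGb] at this
  · rw [hz.integral_eq_sum fun i hi => hS'.intervalIntegrable_G W (hz.mem (by omega))
      (hz.mem (by omega))]
    refine Finset.sum_congr rfl fun i hi => ?_
    have hi' : i ≤ n := by simpa [Nat.lt_succ_iff] using hi
    refine intervalIntegral.integral_congr fun t ht => ?_
    rw [uIcc_of_le (hz.lt i hi').le] at ht
    simp only [(hE i hi').2 ht]
  · rw [(hE i h2).1 (hl i h2), hF0 i h2]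
  · rw [(hE i hi).1 (Ioo_subset_Icc_self ht)]
    exact hne i hi t ht

theorem integral_scale (h : p.HolderConjugate p') {U G : ℝ → ℝ} {c x y : ℝ} :
    ∫ t in x..y, U t * |spow p c * G t| ^ p' = |c| ^ p * ∫ t in x..y, U t * |G t| ^ p' := by
  rw [← intervalIntegral.integral_const_mul]
  congr 1; ext t
  rw [abs_mul, Real.mul_rpow (abs_nonneg _) (abs_nonneg _), abs_spow_rpow h.symm]
  ring

theorem exists_arcs (W : Weights a b p p' q u v) {z : ℕ → ℝ} (hz : Part a b n z) :
    ∃ F G : ℕ → ℝ → ℝ, ∀ i ≤ n, Sol p' q (pw p' u) (pw q v)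
      (kap p q u v (i < n) (z i) (z (i + 1)) ^ q)⁻¹ (z i) (z (i + 1)) (F i) (G i) ∧
      F i (z i) = 0 ∧ (i < n → F i (z (i + 1)) = 0) ∧ (¬ i < n → G i (z (i + 1)) = 0) ∧
      (∀ t ∈ Ioo (z i) (z (i + 1)), 0 < F i t) ∧
      ∫ t in z i..z (i + 1), pw p' u t * |G i t| ^ p' = 1 := by
  have key : ∀ i, ∃ F G : ℝ → ℝ, i ≤ n → Sol p' q (pw p' u) (pw q v)
      (kap p q u v (i < n) (z i) (z (i + 1)) ^ q)⁻¹ (z i) (z (i + 1)) F G ∧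
      F (z i) = 0 ∧ (i < n → F (z (i + 1)) = 0) ∧ (¬ i < n → G (z (i + 1)) = 0) ∧
      (∀ t ∈ Ioo (z i) (z (i + 1)), 0 < F t) ∧
      ∫ t in z i..z (i + 1), pw p' u t * |G t| ^ p' = 1 := fun i => by
    by_cases hi : i ≤ n
    · obtain ⟨F, G, h⟩ := exists_arc W (i < n) (hz.mem (i := i) (by omega)).1 (hz.lt i hi)
        (hz.mem (i := i + 1) (by omega)).2
      exact ⟨F, G, fun _ => h⟩
    · exact ⟨0, 0, fun h => absurd h hi⟩
  choose F G h using key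
  exact ⟨F, G, h⟩

/-- A common zero of `F` and `G` would annihilate the arc by `Sol.eq_zero`; hence slopes at nodes
may be used as divisors. -/
theorem Sol.G_ne_zero (W : Weights a b p p' q u v) {lam x y c : ℝ} {F G : ℝ → ℝ} (hxy : x < y)
    (S : Sol p' q (pw p' u) (pw q v) lam x y F G) (pos : ∀ t ∈ Ioo x y, 0 < F t)
    (hc : c ∈ Icc x y) (hF : F c = 0) : G c ≠ 0 := fun hG => by
  have := S.eq_zero W.conj W.hpq W.integrable_U W.integrable_V (pw_nonneg _ _) (pw_nonneg _ _)
    hc hF hG ((x + y) / 2) ⟨by linarith, by linarith⟩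
  have h2 := pos ((x + y) / 2) ⟨by linarith, by linarith⟩
  exact h2.ne' this.1

/-- For equal exponents arcs of a common constant can be rescaled to match. -/
theorem mem_spectralNumbers_of_equal (W : Weights a b p p' p u v) {z : ℕ → ℝ} {θ : ℝ}
    (hz : Part a b n z) (hθ : ∀ i ≤ n, kap p p u v (i < n) (z i) (z (i + 1)) = θ) :
    (θ ^ p)⁻¹ ∈ spectralNumbers a b p p u v n := by
  have hp := W.conj.lt
  have hp' := W.one_lt_p'
  obtain ⟨F, G, hA⟩ := exists_arcs W hz
  -- For equal exponents scaling leaves `lam` unchanged, so each arc is scaled to take up the slope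
  -- of its predecessor. The signs of the factors come out by themselves.
  set c : ℕ → ℝ := fun i => Nat.rec (1 : ℝ) (fun i ci =>
    spow p' (spow p ci * G i (z (i + 1)) / G (i + 1) (z (i + 1)))) i with hc
  have hc1 : ∀ i, c (i + 1) = spow p' (spow p (c i) * G i (z (i + 1)) / G (i + 1) (z (i + 1))) :=
    fun i => rfl
  have hGl : ∀ i < n, G i (z (i + 1)) ≠ 0 := fun i hi =>
    (hA i hi.le).1.G_ne_zero W (hz.lt i hi.le) (hA i hi.le).2.2.2.2.1
      ⟨(hz.lt i hi.le).le, le_rfl⟩ ((hA i hi.le).2.2.1 hi)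
  have hGr : ∀ i ≤ n, G i (z i) ≠ 0 := fun i hi =>
    (hA i hi).1.G_ne_zero W (hz.lt i hi) (hA i hi).2.2.2.2.1
      ⟨le_rfl, (hz.lt i hi).le⟩ (hA i hi).2.1
  have hc0 : ∀ i ≤ n, c i ≠ 0 := by
    intro i
    induction i with
    | zero => exact fun _ => one_ne_zero
    | succ i ih =>
      intro hi
      rw [hc1]
      intro h0
      rw [spow_eq_zero_iff hp'] at h0
      have h1 : spow p (c i) ≠ 0 := fun h => ih (by omega) ((spow_eq_zero_iff hp).1 h)
      exact div_ne_zero (mul_ne_zero h1 (hGl i (by omega))) (hGr (i + 1) hi) h0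
  have hsc : ∀ d : ℝ, d ≠ 0 → ∀ l : ℝ, l * (spow p d / spow p d) = l := fun d hd l => by
    rw [div_self fun h => hd ((spow_eq_zero_iff hp).1 h), mul_one]
  obtain ⟨F', G', hS', hFa, hGb, hN, hn⟩ := exists_of_arcs W hz (lam := (θ ^ p)⁻¹)
    (F := fun i t => c i * F i t) (G := fun i t => spow p (c i) * G i t)
    (fun i hi => by
      have := (hA i hi).1.scale W.conj hp (hc0 i hi)
      rwa [hsc _ (hc0 i hi), hθ i hi] at this)
    (fun i hi => by simp only [(hA i hi).2.1, mul_zero])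
    (fun i hi => by simp only [(hA i hi.le).2.2.1 hi, mul_zero])
    (by
      have := (hA n le_rfl).2.2.2.1 (lt_irrefl n)
      rw [hz.last] at this
      simp only [this, mul_zero])
    (fun i hi t ht => mul_ne_zero (hc0 i hi) ((hA i hi).2.2.2.2.1 t ht).ne')
    (fun i hi => by
      have := hGr (i + 1) hi
      simp only [hc1, spow_spow W.conj]
      field_simp)
  set N := ∫ t in a..b, pw p' u t * |G' t| ^ p' with hNdef
  have hNpos : 0 < N := by
    rw [hN]
    refine Finset.sum_pos (fun i hi => ?_) ⟨0, by simp⟩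
    have hi' : i ≤ n := by simpa [Nat.lt_succ_iff] using hi
    rw [integral_scale W.conj, (hA i hi').2.2.2.2.2, mul_one]
    exact Real.rpow_pos_of_pos (abs_pos.2 (hc0 i hi')) _
  -- Scaling by `d` multiplies the energy by `d ^ p`.
  set d := N ^ (-(1 / p)) with hd
  have hd0 : 0 < d := Real.rpow_pos_of_pos hNpos _
  refine (mem_spectralNumbers_iff W).2 ⟨fun t => d * F' t, fun t => spow p d * G' t, ?_,
    by simp only [hFa, mul_zero], by simp only [hGb, mul_zero], ?_, ?_⟩
  · have := hS'.scale W.conj hp hd0.ne'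
    rwa [hsc _ hd0.ne'] at this
  · rw [integral_scale W.conj, ← hNdef, abs_of_pos hd0, hd, ← Real.rpow_mul hNpos.le,
      show -(1 / p) * p = -1 by field_simp, Real.rpow_neg_one, inv_mul_cancel₀ hNpos.ne']
  · rw [← hn]; simp [hd0.ne']

/-- The value of one interval in the partition functional is strictly decreasing. -/
theorem value_lt_value {κ κ' k : ℝ} (hq : 0 < q) (hk : 0 < k) (hκ : 0 < κ) (h : κ < κ') :
    ((κ' ^ q)⁻¹) ^ k < ((κ ^ q)⁻¹) ^ k := by
  have h1 := Real.rpow_pos_of_pos hκ q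
  have h2 := Real.rpow_lt_rpow hκ.le h hq
  exact Real.rpow_lt_rpow (inv_pos.2 (h1.trans h2)).le (inv_strictAnti₀ h1 h2) hk

/-- The partition functional attains its minimum. -/
theorem exists_min_partition (W : Weights a b p p' q u v) {k : ℝ} (hk : 0 < k) (n : ℕ) :
    ∃ z, Part a b n z ∧ ∀ z', Part a b n z' →
      ∑ i ∈ Finset.range (n + 1), ((kap p q u v (i < n) (z i) (z (i + 1)) ^ q)⁻¹) ^ k ≤
      ∑ i ∈ Finset.range (n + 1), ((kap p q u v (i < n) (z' i) (z' (i + 1)) ^ q)⁻¹) ^ k := by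
  have hq0 : 0 < q := by linarith [W.one_lt_q]
  obtain ⟨z₀, θ, hθ, hz₀, hθv⟩ := exists_equal_partition W n
  set E : (ℕ → ℝ) → ℝ := fun z =>
    ∑ i ∈ Finset.range (n + 1), ((kap p q u v (i < n) (z i) (z (i + 1)) ^ q)⁻¹) ^ k with hE
  have hnn : ∀ (z : ℕ → ℝ) (i : ℕ), 0 ≤ ((kap p q u v (i < n) (z i) (z (i + 1)) ^ q)⁻¹) ^ k :=
    fun z i => Real.rpow_nonneg (inv_nonneg.2 (Real.rpow_nonneg kap_nonneg _)) _
  have hle : ∀ (z : ℕ → ℝ), ∀ i ≤ n,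
      ((kap p q u v (i < n) (z i) (z (i + 1)) ^ q)⁻¹) ^ k ≤ E z := fun z i hi =>
    Finset.single_le_sum (f := fun i => ((kap p q u v (i < n) (z i) (z (i + 1)) ^ q)⁻¹) ^ k)
      (fun j _ => hnn z j) (by simp; omega)
  have hE0 : 0 < E z₀ := lt_of_lt_of_le (by rw [hθv 0 (Nat.zero_le _)]; positivity)
    (hle z₀ 0 (Nat.zero_le _))
  -- A best constant below `ε` would by itself contribute more than `E z₀`. Requiring all constants
  -- to be at least `ε` is a closed condition that excludes degenerate partitions.
  set ε := E z₀ ^ (-(1 / (q * k))) with hε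
  have hε0 : 0 < ε := Real.rpow_pos_of_pos hE0 _
  have hεE : ((ε ^ q)⁻¹) ^ k = E z₀ := by
    rw [hε, ← Real.rpow_mul hE0.le, ← Real.rpow_neg hE0.le, ← Real.rpow_mul hE0.le,
      show -(-(1 / (q * k)) * q) * k = 1 by field_simp, Real.rpow_one]
  have hbig : ∀ z : ℕ → ℝ, E z ≤ E z₀ → Part a b n z → ∀ i ≤ n,
      ε ≤ kap p q u v (i < n) (z i) (z (i + 1)) := fun z hEz hz i hi => by
    by_contra hcon
    have := value_lt_value hq0 hk (kap_pos (D := i < n) W (hz.mem (i := i) (by omega)).1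
      (hz.lt i hi) (hz.mem (i := i + 1) (by omega)).2) (not_le.1 hcon)
    rw [hεE] at this
    linarith [hle z i hi]
  set K : Set (ℕ → ℝ) := {z | (∀ i, z i ∈ Icc a b) ∧ z 0 = a ∧ z (n + 1) = b ∧
    ∀ i ≤ n, z i ≤ z (i + 1) ∧ ε ≤ kap p q u v (i < n) (z i) (z (i + 1))} with hK
  have hcont : ∀ i, Continuous fun z : ℕ → ℝ => kap p q u v (i < n) (z i) (z (i + 1)) := fun i =>
    (continuous_kap W (i < n)).comp (f := fun z : ℕ → ℝ => (z i, z (i + 1)))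
      ((continuous_apply i).prodMk (continuous_apply (i + 1)))
  have hKc : IsCompact K := by
    have h1 : IsCompact (Set.univ.pi fun _ : ℕ => Icc a b) := isCompact_univ_pi fun _ => isCompact_Icc
    refine h1.of_isClosed_subset ?_ fun z hz i _ => hz.1 i
    have e : K = (Set.univ.pi fun _ : ℕ => Icc a b) ∩ ({z | z 0 = a} ∩ ({z | z (n + 1) = b} ∩
        ⋂ i ∈ Set.Iic n, ({z | z i ≤ z (i + 1)} ∩
          {z | ε ≤ kap p q u v (i < n) (z i) (z (i + 1))}))) := by
      ext z
      simp only [hK, mem_ofPred_eq, mem_inter_iff, mem_univ_pi, mem_iInter, mem_Iic]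
    rw [e]
    refine h1.isClosed.inter ((isClosed_eq (continuous_apply _) continuous_const).inter
      ((isClosed_eq (continuous_apply _) continuous_const).inter ?_))
    exact isClosed_biInter fun i _ => (isClosed_le (continuous_apply i) (continuous_apply (i + 1))).inter
      (isClosed_le continuous_const (hcont i))
  have hKpart : ∀ z ∈ K, Part a b n z := fun z hz => ⟨hz.2.1, hz.2.2.1, fun i hi => by
    refine lt_of_le_of_ne (hz.2.2.2 i hi).1 fun he => ?_
    have := (hz.2.2.2 i hi).2
    rw [kap_eq_zero W he.ge] at this
    linarith⟩
  have hEc : ContinuousOn E K := by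
    refine continuousOn_finsetSum _ fun i hi => ?_
    have hi' : i ≤ n := by simpa [Nat.lt_succ_iff] using hi
    refine ContinuousOn.rpow_const ?_ fun _ _ => Or.inr hk.le
    refine ContinuousOn.inv₀ ?_ fun z hz => ?_
    · exact ((hcont i).rpow_const fun _ => Or.inr hq0.le).continuousOn
    · exact (Real.rpow_pos_of_pos (hε0.trans_le (hz.2.2.2 i hi').2) _).ne'
  -- The functional reads only the nodes up to `n + 1`; setting the others to `b` places competitors
  -- in the compact product.
  set t : (ℕ → ℝ) → ℕ → ℝ := fun z i => if i ≤ n + 1 then z i else b with ht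
  have htE : ∀ z, E (t z) = E z := fun z => by
    refine Finset.sum_congr rfl fun i hi => ?_
    have hi' : i ≤ n := by simpa [Nat.lt_succ_iff] using hi
    simp [ht, hi', show i ≤ n + 1 by omega]
  have htP : ∀ z, Part a b n z → Part a b n (t z) := fun z hz =>
    ⟨by simp [ht, hz.zero], by simp [ht, hz.last], fun i hi => by
      simp [ht, hi, show i ≤ n + 1 by omega, hz.lt i hi]⟩
  have htK : ∀ z, E z ≤ E z₀ → Part a b n z → t z ∈ K := fun z hEz hz =>
    ⟨fun i => by
      by_cases hi : i ≤ n + 1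
      · simp only [ht, if_pos hi]; exact hz.mem hi
      · simp only [ht, if_neg hi]; exact ⟨W.hab.le, le_rfl⟩,
      (htP z hz).zero, (htP z hz).last, fun i hi => ⟨((htP z hz).lt i hi).le,
        hbig _ (by rw [htE]; exact hEz) (htP z hz) i hi⟩⟩
  obtain ⟨z, hzK, hzmin⟩ := hKc.exists_isMinOn ⟨t z₀, htK z₀ le_rfl hz₀⟩ hEc
  refine ⟨z, hKpart z hzK, fun z' hz' => ?_⟩
  change E z ≤ E z'
  rcases le_total (E z') (E z₀) with h | h
  · have := hzmin (htK z' h hz')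
    simp only [mem_ofPred_eq, htE] at this
    exact this
  · have := hzmin (htK z₀ le_rfl hz₀)
    simp only [mem_ofPred_eq, htE] at this
    exact this.trans h

end least

section least

variable {a b p p' q : ℝ} {u v : ℝ → ℝ} {n : ℕ}

/-- Moving one node of a minimising partition does not decrease the functional. -/
theorem min_partition_adjacent {φ : ℕ → ℝ → ℝ → ℝ} {z : ℕ → ℝ} (hz : Part a b n z)
    (hmin : ∀ z', Part a b n z' → ∑ i ∈ Finset.range (n + 1), φ i (z i) (z (i + 1)) ≤
      ∑ i ∈ Finset.range (n + 1), φ i (z' i) (z' (i + 1))) {i : ℕ} (hi : i < n) {m : ℝ}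
    (hm : m ∈ Ioo (z i) (z (i + 1 + 1))) :
    φ i (z i) (z (i + 1)) + φ (i + 1) (z (i + 1)) (z (i + 1 + 1)) ≤
      φ i (z i) m + φ (i + 1) m (z (i + 1 + 1)) := by
  set z' := Function.update z (i + 1) m with hz'
  have hself : z' (i + 1) = m := by simp [hz']
  have hother : ∀ j, j ≠ i + 1 → z' j = z j := fun j hj => by simp [hz', hj]
  have hP : Part a b n z' := by
    refine ⟨by rw [hother 0 (by omega), hz.zero], by rw [hother (n + 1) (by omega), hz.last],
      fun j hj => ?_⟩
    by_cases h1 : j = i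
    · subst h1; rw [hself, hother j (by omega)]; exact hm.1
    · by_cases h2 : j = i + 1
      · subst h2; rw [hself, hother _ (by omega)]; exact hm.2
      · rw [hother j h2, hother (j + 1) (by omega)]; exact hz.lt j hj
  have h := hmin z' hP
  have h2 : 0 ≤ ∑ j ∈ Finset.range (n + 1),
      (φ j (z' j) (z' (j + 1)) - φ j (z j) (z (j + 1))) := by
    rw [Finset.sum_sub_distrib]; linarith
  rw [Finset.sum_eq_add_of_mem i (i + 1) (by simp; omega) (by simp; omega) (by omega)
    (fun j _ hj => by rw [hother j hj.2, hother (j + 1) (by omega), sub_self]), hself,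
    hother i (by omega), hother (i + 1 + 1) (by omega)] at h2
  linarith

set_option maxHeartbeats 400000 in
/-- For `p < q` a minimiser of the partition functional yields a spectral number. -/
theorem mem_spectralNumbers_of_min (W : Weights a b p p' q u v) (hpq : p < q) {k : ℝ}
    (hk : k = p / (q - p)) {z : ℕ → ℝ} (hz : Part a b n z)
    (hmin : ∀ z', Part a b n z' →
      ∑ i ∈ Finset.range (n + 1), ((kap p q u v (i < n) (z i) (z (i + 1)) ^ q)⁻¹) ^ k ≤
      ∑ i ∈ Finset.range (n + 1), ((kap p q u v (i < n) (z' i) (z' (i + 1)) ^ q)⁻¹) ^ k) :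
    (∑ i ∈ Finset.range (n + 1), ((kap p q u v (i < n) (z i) (z (i + 1)) ^ q)⁻¹) ^ k) ^ (1 / k) ∈
      spectralNumbers a b p q u v n := by
  have hp := W.conj.lt
  have hp0 := W.conj.pos
  have hp' := W.one_lt_p'
  have hq := W.one_lt_q
  have hq0 : 0 < q := by linarith
  have hqp : 0 < q - p := by linarith
  have hk0 : 0 < k := by rw [hk]; positivity
  set κ : ℕ → ℝ := fun i => kap p q u v (i < n) (z i) (z (i + 1)) with hκ
  have hκ0 : ∀ i ≤ n, 0 < κ i ^ q := fun i hi => Real.rpow_pos_of_pos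
    (kap_pos W (hz.mem (by omega)).1 (hz.lt i hi) (hz.mem (by omega)).2) _
  set E := ∑ i ∈ Finset.range (n + 1), ((κ i ^ q)⁻¹) ^ k with hE
  have hE0 : 0 < E := Finset.sum_pos (fun i hi => Real.rpow_pos_of_pos (inv_pos.2 (hκ0 i
    (by simpa [Nat.lt_succ_iff] using hi))) _) ⟨0, by simp⟩
  set lam := E ^ (1 / k) with hlam
  have hlam0 : 0 < lam := Real.rpow_pos_of_pos hE0 _
  have hlamk : lam ^ k = E := by
    rw [hlam, ← Real.rpow_mul hE0.le, one_div_mul_cancel hk0.ne', Real.rpow_one]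
  obtain ⟨F, G, hA⟩ := exists_arcs W hz
  -- Scaling by `d` multiplies the multiplier `(κ ^ q)⁻¹` by `d ^ (p - q)`, and this value makes it
  -- `lam`. The energies become `d ^ p = (lam * κ ^ q) ^ (-k)`, the shares of the summands in `E`,
  -- with sum `1`.
  set d : ℕ → ℝ := fun i => (lam * κ i ^ q) ^ (-(1 / (q - p))) with hd
  have hd0 : ∀ i ≤ n, 0 < d i := fun i hi => Real.rpow_pos_of_pos (mul_pos hlam0 (hκ0 i hi)) _
  set P : ℕ → ℝ → ℝ := fun i t => d i * F i t with hP
  set Q : ℕ → ℝ → ℝ := fun i t => spow p (d i) * G i t with hQ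
  have hS : ∀ i ≤ n, Sol p' q (pw p' u) (pw q v) lam (z i) (z (i + 1)) (P i) (Q i) := by
    intro i hi
    have := (hA i hi).1.scale W.conj hq (hd0 i hi).ne'
    have e : (κ i ^ q)⁻¹ * (spow p (d i) / spow q (d i)) = lam := by
      have hm := mul_pos hlam0 (hκ0 i hi)
      rw [spow_of_nonneg hp (hd0 i hi).le, spow_of_nonneg hq (hd0 i hi).le,
        ← Real.rpow_sub (hd0 i hi), hd, ← Real.rpow_mul hm.le,
        show -(1 / (q - p)) * (p - 1 - (q - 1)) = 1 by field_simp; ring, Real.rpow_one]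
      have := (hκ0 i hi).ne'
      field_simp
    rw [e] at this
    exact this
  have hP0 : ∀ i ≤ n, P i (z i) = 0 := fun i hi => by simp only [hP, (hA i hi).2.1, mul_zero]
  have hP1 : ∀ i ≤ n, i < n → P i (z (i + 1)) = 0 := fun i hi h => by
    simp only [hP, (hA i hi).2.2.1 h, mul_zero]
  have hQ1 : ∀ i ≤ n, ¬ i < n → Q i (z (i + 1)) = 0 := fun i hi h => by
    simp only [hQ, (hA i hi).2.2.2.1 h, mul_zero]
  have hpos : ∀ i ≤ n, ∀ t ∈ Ioo (z i) (z (i + 1)), 0 < P i t := fun i hi t ht =>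
    mul_pos (hd0 i hi) ((hA i hi).2.2.2.2.1 t ht)
  have hNi : ∀ i ≤ n, ∫ t in z i..z (i + 1), pw p' u t * |Q i t| ^ p' = d i ^ p := fun i hi => by
    simp only [hQ]
    rw [integral_scale W.conj, (hA i hi).2.2.2.2.2, mul_one, abs_of_pos (hd0 i hi)]
  have hext : ∀ i ≤ n, ∫ t in z i..z (i + 1), pw q v t * |P i t| ^ q =
      κ i ^ q * (∫ t in z i..z (i + 1), pw p' u t * |Q i t| ^ p') ^ (q / p) := fun i hi => by
    have hen := (hA i hi).1.energy hp' hq W.integrable_U W.integrable_V (hz.lt i hi).le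
    have h0 : F i (z (i + 1)) * G i (z (i + 1)) = 0 := by
      by_cases h : i < n
      · rw [(hA i hi).2.2.1 h, zero_mul]
      · rw [(hA i hi).2.2.2.1 h, mul_zero]
    rw [h0, (hA i hi).2.1, (hA i hi).2.2.2.2.2, zero_mul, sub_zero, zero_add, eq_comm,
      inv_mul_eq_one₀ (hκ0 i hi).ne'] at hen
    rw [hNi i hi, ← Real.rpow_mul (hd0 i hi).le, mul_div_cancel₀ _ hp0.ne']
    change _ = kap p q u v (i < n) (z i) (z (i + 1)) ^ q * _
    rw [hen, mul_comm, ← intervalIntegral.integral_const_mul]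
    congr 1; ext t
    simp only [hP]
    rw [abs_mul, abs_of_pos (hd0 i hi), Real.mul_rpow (hd0 i hi).le (abs_nonneg _)]
    ring
  -- `corner_match` joins a positive arc to a negative one, so it is applied to arc `i` and the
  -- negative of arc `i + 1`; the glued solution then carries the signs `(-1) ^ i`.
  have hmatch : ∀ i < n, Q i (z (i + 1)) = -Q (i + 1) (z (i + 1)) := by
    intro i hi
    have mem1 := (hz.mem (i := i) (by omega)).1
    have mem2 := (hz.mem (i := i + 1 + 1) (by omega)).2
    have e1 := hext i hi.le
    have e2 := hext (i + 1) hi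
    have hadj := fun m hm => min_partition_adjacent
      (φ := fun i x y => ((kap p q u v (i < n) x y ^ q)⁻¹) ^ k) hz hmin hi (m := m) hm
    simp only [hκ] at e1 e2
    rw [eq_true hi] at e1
    simp only [eq_true hi] at hadj
    refine corner_match (D := i + 1 < n) (F₂ := fun t => -P (i + 1) t)
      (G₂ := fun t => -Q (i + 1) t) W hpq hk hlam0 mem1 (hz.lt i hi.le) (hz.lt (i + 1) hi) mem2
      (hS i hi.le) (hS (i + 1) hi).neg (hP0 i hi.le) (hP1 i hi.le hi)
      (by rw [hP0 (i + 1) hi, neg_zero]) (fun h => by rw [hP1 (i + 1) hi h, neg_zero])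
      (fun h => by rw [hQ1 (i + 1) hi h, neg_zero]) (hpos i hi.le)
      (fun t ht => neg_neg_of_pos (hpos (i + 1) hi t ht)) e1 ?_ hadj
    simpa only [abs_neg] using e2
  have hsg : ∀ i : ℕ, ((-1 : ℝ) ^ i = 1 ∨ (-1 : ℝ) ^ i = -1) := neg_one_pow_eq_or ℝ
  obtain ⟨F', G', hS', hFa, hGb, hN, hn⟩ := exists_of_arcs W hz (lam := lam)
    (F := fun i t => (-1) ^ i * P i t) (G := fun i t => (-1) ^ i * Q i t)
    (fun i hi => by
      rcases hsg i with h | h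
      · simpa only [h, one_mul] using hS i hi
      · simpa only [h, neg_mul, one_mul] using (hS i hi).neg)
    (fun i hi => by simp only [hP0 i hi, mul_zero])
    (fun i hi => by simp only [hP1 i hi.le hi, mul_zero])
    (by
      have := hQ1 n le_rfl (lt_irrefl n)
      rw [hz.last] at this
      simp only [this, mul_zero])
    (fun i hi t ht => mul_ne_zero (pow_ne_zero _ (by norm_num)) (hpos i hi t ht).ne')
    (fun i hi => by simp only [hmatch i hi, pow_succ]; ring)
  refine (mem_spectralNumbers_iff W).2 ⟨F', G', hS', hFa, hGb, ?_, hn⟩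
  rw [hN]
  have e : ∀ i ∈ Finset.range (n + 1), ∫ t in z i..z (i + 1), pw p' u t * |(-1) ^ i * Q i t| ^ p' =
      ((κ i ^ q)⁻¹) ^ k / E := fun i hi => by
    have hi' : i ≤ n := by simpa [Nat.lt_succ_iff] using hi
    simp only [abs_mul, abs_pow, abs_neg, abs_one, one_pow, one_mul]
    rw [hNi i hi', hd, ← Real.rpow_mul (mul_pos hlam0 (hκ0 i hi')).le,
      show -(1 / (q - p)) * p = -k by rw [hk]; ring,
      Real.mul_rpow hlam0.le (hκ0 i hi').le, Real.rpow_neg hlam0.le, hlamk,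
      Real.rpow_neg (hκ0 i hi').le, Real.inv_rpow (hκ0 i hi').le]
    ring
  rw [Finset.sum_congr rfl e, ← Finset.sum_div, ← hE, div_self hE0.ne']

/-- The least spectral number and its comparison with the equalizing partition. -/
theorem exists_least (W : Weights a b p p' q u v) (n : ℕ) :
    ∃ lam, IsLeast (spectralNumbers a b p q u v n) lam ∧ 0 < lam ∧ ∃ (z : ℕ → ℝ) (θ : ℝ), 0 < θ ∧
      Part a b n z ∧ (∀ i ≤ n, kap p q u v (i < n) (z i) (z (i + 1)) = θ) ∧
      lam ^ (1 / q) * θ ≤ (n + 1 : ℝ) ^ (1 / p - 1 / q) := by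
  have hp := W.conj.lt
  have hp0 := W.conj.pos
  have hq := W.one_lt_q
  have hq0 : 0 < q := by linarith
  obtain ⟨z, θ, hθ, hz, hzv⟩ := exists_equal_partition W n
  have hθq : 0 < θ ^ q := Real.rpow_pos_of_pos hθ _
  have hroot : ((θ ^ q)⁻¹) ^ (1 / q) = θ⁻¹ := by
    rw [← Real.inv_rpow hθ.le, ← Real.rpow_mul (inv_pos.2 hθ).le, mul_one_div_cancel hq0.ne',
      Real.rpow_one]
  rcases W.hpq.eq_or_lt with rfl | hpq
  · refine ⟨(θ ^ p)⁻¹, ⟨mem_spectralNumbers_of_equal W hz hzv, fun lam hlam => ?_⟩, inv_pos.2 hθq,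
      z, θ, hθ, hz, hzv, ?_⟩
    · obtain ⟨hl, z', N, hz', hN, -, hle⟩ := exists_nodal W hlam
      obtain ⟨i, hi, hik⟩ := exists_kap_le W hz hz' hzv
      have h1 := hle i hi
      -- For `p = q` the energy cancels: `1 ≤ lam * κ ^ p` on each nodal interval, in particular on
      -- one where `κ ≤ θ`.
      rw [div_self hp0.ne', Real.rpow_one, ← mul_assoc] at h1
      have h2 : 1 ≤ lam * kap p p u v (i < n) (z' i) (z' (i + 1)) ^ p := by
        by_contra hcon
        have := mul_lt_mul_of_pos_right (not_le.1 hcon) (hN i hi)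
        linarith
      rw [inv_le_iff_one_le_mul₀ hθq]
      exact h2.trans (mul_le_mul_of_nonneg_left (Real.rpow_le_rpow kap_nonneg hik hp0.le) hl.le)
    · rw [hroot, inv_mul_cancel₀ hθ.ne', sub_self, Real.rpow_zero]
  · set k := p / (q - p) with hk
    have hqp : 0 < q - p := by linarith
    have hk0 : 0 < k := by rw [hk]; positivity
    obtain ⟨y, hy, hmin⟩ := exists_min_partition W hk0 n
    set E := ∑ i ∈ Finset.range (n + 1), ((kap p q u v (i < n) (y i) (y (i + 1)) ^ q)⁻¹) ^ k with hE
    have hE0 : 0 < E := Finset.sum_pos (fun i hi => by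
      have hi' : i ≤ n := by simpa [Nat.lt_succ_iff] using hi
      have := kap_pos (D := i < n) W (hy.mem (i := i) (by omega)).1 (hy.lt i hi')
        (hy.mem (i := i + 1) (by omega)).2
      positivity) ⟨0, by simp⟩
    refine ⟨E ^ (1 / k), ⟨mem_spectralNumbers_of_min W hpq hk hy hmin, fun lam hlam => ?_⟩,
      Real.rpow_pos_of_pos hE0 _, z, θ, hθ, hz, hzv, ?_⟩
    · obtain ⟨hl, z', N, hz', hN, hsum, hle⟩ := exists_nodal W hlam
      -- Taking `B = N i / lam` in `value_le` bounds each summand by `lam ^ k * N i`, and the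
      -- energies add up to one.
      have h1 : E ≤ lam ^ k := by
        refine (hmin z' hz').trans ?_
        calc _ ≤ ∑ i ∈ Finset.range (n + 1), lam ^ k * N i := Finset.sum_le_sum fun i hi => ?_
          _ = lam ^ k := by rw [← Finset.mul_sum, hsum, mul_one]
        have hi' : i ≤ n := by simpa [Nat.lt_succ_iff] using hi
        have hNi := hN i hi'
        have := value_le hp0 hpq hk hNi.le (div_pos hNi hl)
          (by rw [div_le_iff₀ hl, mul_comm]; exact hle i hi')
        refine this.trans_eq ?_
        rw [Real.rpow_neg (div_pos hNi hl).le, Real.div_rpow hNi.le hl.le,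
          Real.rpow_add_one hNi.ne']
        have h2 := (Real.rpow_pos_of_pos hNi k).ne'
        have h3 := (Real.rpow_pos_of_pos hl k).ne'
        field_simp
      refine (Real.rpow_le_rpow hE0.le h1 (by positivity)).trans_eq ?_
      rw [← Real.rpow_mul hl.le, mul_one_div_cancel hk0.ne', Real.rpow_one]
    · have h1 : E ≤ (n + 1) * ((θ ^ q)⁻¹) ^ k := by
        refine (hmin z hz).trans_eq ?_
        rw [Finset.sum_congr rfl fun i hi => by
          rw [hzv i (by simpa [Nat.lt_succ_iff] using hi)]]
        simp
      have h2 : E ^ (1 / k) ≤ (n + 1 : ℝ) ^ (1 / k) * (θ ^ q)⁻¹ := by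
        refine (Real.rpow_le_rpow hE0.le h1 (by positivity)).trans_eq ?_
        rw [Real.mul_rpow (by positivity) (by positivity), ← Real.rpow_mul (inv_pos.2 hθq).le,
          mul_one_div_cancel hk0.ne', Real.rpow_one]
      have h3 : (E ^ (1 / k)) ^ (1 / q) ≤ (n + 1 : ℝ) ^ (1 / p - 1 / q) * θ⁻¹ := by
        refine (Real.rpow_le_rpow (by positivity) h2 (by positivity)).trans_eq ?_
        rw [Real.mul_rpow (by positivity) (by positivity), hroot, ← Real.rpow_mul (by positivity)]
        congr 2
        rw [hk]; field_simp
      calc _ ≤ (n + 1 : ℝ) ^ (1 / p - 1 / q) * θ⁻¹ * θ := mul_le_mul_of_nonneg_right h3 hθ.le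
        _ = _ := by rw [mul_assoc, inv_mul_cancel₀ hθ.ne', mul_one]

end least

/-! ### Constant weights and the value of `cConst` -/

section constant

/-- The Beta integral in the form in which it arises from the substitution `σ = F t`. -/
theorem integral_one_sub_rpow {p' q : ℝ} (hp' : 0 < p') (hq : 0 < q) :
    ∫ s in (0:ℝ)..1, (1 - s ^ q) ^ (1 / p') =
      ProbabilityTheory.beta (1 / q) (1 / p') / (p' + q) := by
  have hx : 0 < 1 / q := by positivity
  have hy : 0 < 1 / p' := by positivity
  have h1 : ProbabilityTheory.beta (1 / q) (1 / p' + 1) =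
      ProbabilityTheory.beta (1 / q) (1 / p') * (q / (p' + q)) := by
    rw [ProbabilityTheory.beta, ProbabilityTheory.beta, Real.Gamma_add_one hy.ne', ← add_assoc,
      Real.Gamma_add_one (by positivity)]
    have := (Real.Gamma_pos_of_pos (add_pos hx hy)).ne'
    field_simp
  have h2 : ProbabilityTheory.beta (1 / q) (1 / p' + 1) =
      ∫ t in (0:ℝ)..1, t ^ (1 / q - 1) * (1 - t) ^ (1 / p') := by
    rw [ProbabilityTheory.beta_eq_betaIntegralReal _ _ hx (by positivity), Complex.betaIntegral]
    have e : ∫ t in (0:ℝ)..1, (t:ℂ) ^ (((1 / q : ℝ) : ℂ) - 1) *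
          (1 - (t:ℂ)) ^ (((1 / p' + 1 : ℝ) : ℂ) - 1) =
        ∫ t in (0:ℝ)..1, ((t ^ (1 / q - 1) * (1 - t) ^ (1 / p') : ℝ) : ℂ) := by
      refine intervalIntegral.integral_congr fun t ht => ?_
      rw [uIcc_of_le zero_le_one] at ht
      rw [Complex.ofReal_mul, Complex.ofReal_cpow ht.1, Complex.ofReal_cpow (by linarith [ht.2])]
      push_cast
      congr 2
      ring
    rw [e, intervalIntegral.integral_ofReal, Complex.ofReal_re]
  have h3 : ∫ s in (0:ℝ)..1, (1 - s ^ q) ^ (1 / p') =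
      ∫ t in (0:ℝ)..1, 1 / q * (t ^ (1 / q - 1) * (1 - t) ^ (1 / p')) := by
    -- The substitution `s = t ^ (1 / q)` is made on the half-line, so the integrand is cut off
    -- beyond `1`.
    set g : ℝ → ℝ := (Ioc (0:ℝ) 1).indicator fun s => (1 - s ^ q) ^ (1 / p') with hg
    have := integral_comp_rpow_Ioi_of_pos (g := g) hx
    rw [intervalIntegral.integral_of_le zero_le_one, intervalIntegral.integral_of_le zero_le_one]
    have e1 : ∫ s in Ioi (0:ℝ), g s = ∫ s in Ioc (0:ℝ) 1, (1 - s ^ q) ^ (1 / p') := by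
      rw [hg, setIntegral_indicator measurableSet_Ioc]
      congr 2
      ext t; simp only [mem_inter_iff, mem_Ioi, mem_Ioc]; tauto
    rw [← e1, ← this]
    have e2 : ∀ t ∈ Ioi (0:ℝ), (1 / q * t ^ (1 / q - 1)) • g (t ^ (1 / q)) =
        (Ioc (0:ℝ) 1).indicator (fun t => 1 / q * (t ^ (1 / q - 1) * (1 - t) ^ (1 / p'))) t := by
      intro t ht
      have ht : 0 < t := ht
      by_cases h : t ≤ 1
      · have h' : t ^ (1 / q) ≤ 1 := Real.rpow_le_one ht.le h hx.le
        rw [hg, indicator_of_mem (show t ^ (1 / q) ∈ Ioc (0:ℝ) 1 from ⟨by positivity, h'⟩),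
          indicator_of_mem (show t ∈ Ioc (0:ℝ) 1 from ⟨ht, h⟩), ← Real.rpow_mul ht.le,
          one_div_mul_cancel hq.ne', Real.rpow_one, smul_eq_mul, mul_assoc]
      · have h' : 1 < t ^ (1 / q) := Real.one_lt_rpow (not_le.1 h) hx
        rw [hg, indicator_of_notMem (fun hm => not_lt.2 hm.2 h'),
          indicator_of_notMem (fun hm => h hm.2), smul_zero]
    rw [setIntegral_congr_fun measurableSet_Ioi e2, setIntegral_indicator measurableSet_Ioc]
    congr 2
    ext t; simp only [mem_inter_iff, mem_Ioi, mem_Ioc]; tauto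
  rw [h3, intervalIntegral.integral_const_mul, ← h2, h1]
  field_simp

theorem integral_sub_rpow {p' q M : ℝ} (hp' : 0 < p') (hq : 0 < q) (hM : 0 < M) :
    ∫ s in (0:ℝ)..M, (M ^ q - s ^ q) ^ (1 / p') = M ^ (1 + q / p') *
      (ProbabilityTheory.beta (1 / q) (1 / p') / (p' + q)) := by
  have h := intervalIntegral.smul_integral_comp_mul_left (a := 0) (b := 1)
    (fun s => (M ^ q - s ^ q) ^ (1 / p')) M
  rw [mul_zero, mul_one] at h
  rw [← h, ← integral_one_sub_rpow hp' hq, Real.rpow_add hM, Real.rpow_one, smul_eq_mul, mul_assoc]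
  congr 1
  rw [← intervalIntegral.integral_const_mul]
  refine intervalIntegral.integral_congr fun s hs => ?_
  rw [uIcc_of_le zero_le_one] at hs
  have h1 : s ^ q ≤ 1 := Real.rpow_le_one hs.1 hs.2 hq.le
  rw [Real.mul_rpow hM.le hs.1, show M ^ q - M ^ q * s ^ q = M ^ q * (1 - s ^ q) by ring,
    Real.mul_rpow (by positivity) (by linarith), ← Real.rpow_mul hM.le, mul_one_div]

variable {p p' q x y lam : ℝ} {F G : ℝ → ℝ}

/-- The weight `1` on `[x, y]`. -/
noncomputable def unit (x y : ℝ) : ℝ → ℝ := (Icc x y).indicator fun _ => 1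

theorem pw_unit {s t : ℝ} (ht : t ∈ Icc x y) : pw s (unit x y) t = 1 := by
  simp [pw, unit, indicator_of_mem ht]

theorem memL_indicator_const {s c : ℝ} : MemL s ((Icc x y).indicator fun _ => c) :=
  memLp_indicator_const _ measurableSet_Icc c (Or.inr (by simp))

theorem weights_unit (hxy : x < y) (h : p.HolderConjugate p') (hpq : p ≤ q) :
    Weights x y p p' q (unit x y) (unit x y) :=
  ⟨hxy, h, hpq, memL_indicator_const, memL_indicator_const,
    fun t ht => by simp [unit, indicator_of_mem ht],
    fun t ht => by simp [unit, indicator_of_mem ht],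
    fun t ht => by simp [unit, indicator_of_notMem ht],
    fun t ht => by simp [unit, indicator_of_notMem ht]⟩

theorem hasDerivAt_of_integral_eq {f w : ℝ → ℝ} {c : ℝ} (hw : ContinuousOn w (Icc x y))
    (h : ∀ s ∈ Icc x y, f s = c + ∫ t in x..s, w t) {s : ℝ} (hs : s ∈ Ioo x y) :
    HasDerivAt f (w s) s := by
  have hi : IntervalIntegrable w volume x s :=
    (hw.mono (by rw [uIcc_of_le hs.1.le]; exact Icc_subset_Icc_right hs.2.le)).intervalIntegrable
  have hn := Icc_mem_nhds hs.1 hs.2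
  have hmeas := hw.stronglyMeasurableAtFilter_nhdsWithin (μ := volume) measurableSet_Icc s
  rw [nhdsWithin_eq_nhds.2 hn] at hmeas
  have h1 := intervalIntegral.integral_hasDerivAt_right hi hmeas (hw.continuousAt hn)
  refine (h1.const_add c).congr_of_eventuallyEq ?_
  filter_upwards [Icc_mem_nhds hs.1 hs.2] with r hr using h r hr

theorem Sol.hasDerivAt_unit (hp' : 1 < p') (hq : 1 < q)
    (S : Sol p' q (pw p' (unit x y)) (pw q (unit x y)) lam x y F G) {s : ℝ} (hs : s ∈ Ioo x y) :
    HasDerivAt F (spow p' (G s)) s ∧ HasDerivAt G (-lam * spow q (F s)) s := by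
  constructor
  · refine hasDerivAt_of_integral_eq (c := F x)
      ((continuous_spow hp').comp_continuousOn S.contG) (fun s hs => ?_) hs
    rw [S.eqF s hs]
    congr 1
    refine intervalIntegral.integral_congr fun t ht => ?_
    rw [uIcc_of_le hs.1] at ht
    simp [pw_unit (s := p') (show t ∈ Icc x y from ⟨ht.1, ht.2.trans hs.2⟩)]
  · refine hasDerivAt_of_integral_eq (c := G x)
      (continuousOn_const.mul ((continuous_spow hq).comp_continuousOn S.contF)) (fun s hs => ?_) hs
    rw [S.eqG s hs, sub_eq_add_neg, ← neg_mul, ← intervalIntegral.integral_const_mul]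
    congr 1
    refine intervalIntegral.integral_congr fun t ht => ?_
    rw [uIcc_of_le hs.1] at ht
    simp [pw_unit (s := q) (show t ∈ Icc x y from ⟨ht.1, ht.2.trans hs.2⟩)]

theorem hasDerivAt_abs_rpow_spow {s : ℝ} (hs : 1 < s) (z : ℝ) :
    HasDerivAt (fun z => |z| ^ s) (s * spow s z) z := by
  convert hasDerivAt_abs_rpow z hs using 1
  rcases lt_trichotomy z 0 with h | rfl | h
  · rw [← neg_neg z, spow_neg, spow_of_nonneg hs (by linarith), abs_neg, abs_of_pos (by linarith),
      mul_assoc]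
    congr 1
    rw [mul_neg, ← Real.rpow_add_one (by linarith)]; ring_nf
  · simp [spow_zero]
  · rw [spow_of_nonneg hs h.le, abs_of_pos h, mul_assoc, ← Real.rpow_add_one h.ne']; ring_nf

/-- For constant weights the Hamiltonian is constant along solutions. -/
theorem Sol.hamiltonian (hp' : 1 < p') (hq : 1 < q)
    (S : Sol p' q (pw p' (unit x y)) (pw q (unit x y)) lam x y F G) {s t : ℝ} (hs : s ∈ Icc x y)
    (ht : t ∈ Icc x y) :
    |G s| ^ p' / p' + lam * (|F s| ^ q / q) = |G t| ^ p' / p' + lam * (|F t| ^ q / q) := by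
  set e : ℝ → ℝ := fun s => |G s| ^ p' / p' + lam * (|F s| ^ q / q) with he
  have hc : ContinuousOn e (Icc x y) :=
    ((S.contG.abs.rpow_const fun _ _ => Or.inr (by linarith)).div_const _).add
      (continuousOn_const.mul ((S.contF.abs.rpow_const fun _ _ => Or.inr (by linarith)).div_const _))
  have hd : ∀ s ∈ interior (Icc x y), HasDerivAt e 0 s := fun s hs => by
    rw [interior_Icc] at hs
    obtain ⟨h1, h2⟩ := S.hasDerivAt_unit hp' hq hs
    have := (((hasDerivAt_abs_rpow_spow hp' (G s)).comp s h2).div_const p').add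
      ((((hasDerivAt_abs_rpow_spow hq (F s)).comp s h1).div_const q).const_mul lam)
    refine HasDerivAt.congr_deriv (f := e) this ?_
    field_simp
    ring
  have m1 := monotoneOn_of_deriv_nonneg (convex_Icc x y) hc
    (fun s hs => (hd s hs).differentiableAt.differentiableWithinAt) (fun s hs => (hd s hs).deriv.ge)
  have m2 := antitoneOn_of_deriv_nonpos (convex_Icc x y) hc
    (fun s hs => (hd s hs).differentiableAt.differentiableWithinAt) (fun s hs => (hd s hs).deriv.le)
  rcases le_total s t with h | h
  · exact le_antisymm (m1 hs ht h) (m2 hs ht h)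
  · exact le_antisymm (m2 ht hs h) (m1 ht hs h)

/-- Substitution `σ = F t` on an interval where `G` has constant sign. -/
theorem Sol.integral_subst (hp' : 1 < p') (hq : 1 < q)
    (S : Sol p' q (pw p' (unit x y)) (pw q (unit x y)) lam x y F G) {s t k M ε : ℝ}
    (hs : x ≤ s) (hst : s ≤ t) (ht : t ≤ y) (hk : 0 < k)
    (hF : ∀ r ∈ Icc s t, F r ∈ Icc 0 M)
    (hG : ∀ r ∈ Icc s t, |G r| ^ p' = k * (M ^ q - F r ^ q)) (hε : ∀ r ∈ Icc s t, |G r| = ε * G r) :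
    ε * ∫ r in s..t, |G r| ^ p' =
      k ^ (1 / p') * ∫ σ in F s..F t, (M ^ q - σ ^ q) ^ (1 / p') := by
  have hsub : Icc s t ⊆ Icc x y := Icc_subset_Icc hs ht
  have hM : ∀ σ ∈ Icc 0 M, 0 ≤ M ^ q - σ ^ q := fun σ hσ => by
    have := Real.rpow_le_rpow hσ.1 hσ.2 (by linarith : 0 ≤ q); linarith
  have hg : Continuous fun σ : ℝ => (M ^ q - σ ^ q) ^ (1 / p') :=
    (continuous_const.sub (continuous_id.rpow_const fun _ => Or.inr (by linarith))).rpow_const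
      fun _ => Or.inr (by positivity)
  have h := intervalIntegral.integral_comp_mul_deriv'' (a := s) (b := t) (f := F)
    (f' := fun r => spow p' (G r)) (g := fun σ : ℝ => (M ^ q - σ ^ q) ^ (1 / p'))
    (by rw [uIcc_of_le hst]; exact S.contF.mono hsub)
    (fun r hr => by
      rw [min_eq_left hst, max_eq_right hst] at hr
      exact (S.hasDerivAt_unit hp' hq
        ⟨hs.trans_lt hr.1, hr.2.trans_le ht⟩).1.hasDerivWithinAt)
    (by
      rw [uIcc_of_le hst]
      exact (continuous_spow hp').comp_continuousOn (S.contG.mono hsub))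
    hg.continuousOn
  rw [← h, ← intervalIntegral.integral_const_mul, ← intervalIntegral.integral_const_mul]
  refine intervalIntegral.integral_congr fun r hr => ?_
  rw [uIcc_of_le hst] at hr
  have h1 : k ^ (1 / p') * (M ^ q - F r ^ q) ^ (1 / p') = |G r| := by
    rw [← Real.mul_rpow hk.le (hM _ (hF r hr)), ← hG r hr, ← Real.rpow_mul (abs_nonneg _),
      mul_one_div_cancel (by linarith), Real.rpow_one]
  simp only [Function.comp]
  rw [← mul_assoc, h1, ← spow_mul_self hp', hε r hr]
  ring

end constant

section constant

variable {p p' q x y : ℝ}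

theorem cConst_pos (h : p.HolderConjugate p') (hq : 0 < q) : 0 < cConst p q := by
  have h1 := h.symm.pos
  rw [cConst, h.conjExponent_eq]
  have := ProbabilityTheory.beta_pos (show 0 < 1 / q by positivity) (show 0 < 1 / p' by positivity)
  positivity

/-- Elimination of the amplitude from the two integral identities. -/
theorem solve_amplitude (h : p.HolderConjugate p') (hq : 0 < q) {l M κ K m : ℝ} (hl : 0 < l)
    (hM : 0 < M) (hκ : 0 < κ) (hm : 0 < m) (hK : K = p' * (κ ^ q)⁻¹ / q)
    (h1 : K * M ^ q * l = (p' + q) / q)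
    (h2 : 1 = m * (K ^ (1 / p') * (M ^ (1 + q / p') *
      (ProbabilityTheory.beta (1 / q) (1 / p') / (p' + q))))) :
    κ = 2 / m * cConst p q * l ^ (1 / p' + 1 / q) := by
  -- In the application `m` is the number of monotone branches of the arc: two if both ends are
  -- zeros, one if the right end is free. The first identity determines `K * M ^ q`, the second then
  -- `M`, and hence `κ`.
  have hp' := h.symm.pos
  have hB := ProbabilityTheory.beta_pos (show 0 < 1 / q by positivity)
    (show 0 < 1 / p' by positivity)
  set B := ProbabilityTheory.beta (1 / q) (1 / p') with hBdef
  have hs : 0 < p' + q := by positivity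
  have hK0 : 0 < K := by rw [hK]; positivity
  have hMq : 0 < M ^ q := by positivity
  have e1 : K * M ^ q = (p' + q) / (q * l) := by field_simp at h1 ⊢; linarith
  have e2 : K ^ (1 / p') * M ^ (q / p') = ((p' + q) / (q * l)) ^ (1 / p') := by
    rw [← e1, Real.mul_rpow hK0.le hMq.le, ← Real.rpow_mul hM.le, mul_one_div]
  have e3 : M = (p' + q) / (m * B) * ((q * l) ^ (1 / p') / (p' + q) ^ (1 / p')) := by
    rw [Real.rpow_add hM, Real.rpow_one] at h2
    have e4 : 1 = m * M * (B / (p' + q)) * (K ^ (1 / p') * M ^ (q / p')) := by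
      linear_combination h2
    rw [e2, Real.div_rpow hs.le (by positivity)] at e4
    have a1 : 0 < (q * l) ^ (1 / p') := by positivity
    have a2 : 0 < (p' + q) ^ (1 / p') := by positivity
    field_simp at e4 ⊢
    linarith
  have e5 : κ ^ q = p' * l / (p' + q) * M ^ q := by
    rw [hK] at e1
    have : 0 < κ ^ q := by positivity
    field_simp at e1 ⊢
    linarith
  have e6 : κ = (p' * l / (p' + q)) ^ (1 / q) * M := by
    have := congrArg (· ^ (1 / q)) e5
    rwa [← Real.rpow_mul hκ.le, mul_one_div_cancel hq.ne', Real.rpow_one,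
      Real.mul_rpow (by positivity) hMq.le, ← Real.rpow_mul hM.le, mul_one_div_cancel hq.ne',
      Real.rpow_one] at this
  rw [e6, e3, cConst, h.conjExponent_eq, ← hBdef, Real.div_rpow (by positivity) hs.le,
    Real.mul_rpow hp'.le hl.le, Real.mul_rpow hq.le hl.le, Real.rpow_add hl]
  have e7 : (p' + q) ^ (1 / p - 1 / q) =
      (p' + q) / ((p' + q) ^ (1 / p') * (p' + q) ^ (1 / q)) := by
    rw [← Real.rpow_add hs, eq_div_iff (by positivity), ← Real.rpow_add hs]
    have := h.inv_add_inv_eq_one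
    rw [show 1 / p - 1 / q + (1 / p' + 1 / q) = 1 by
      rw [one_div, one_div, one_div]; linarith, Real.rpow_one]
  rw [e7]
  field_simp

/-- The best constants for constant weights. -/
theorem kap_unit (h : p.HolderConjugate p') (hpq : p ≤ q) (hxy : x < y) (D : Prop) :
    (D → kap p q (unit x y) (unit x y) D x y = cConst p q * (y - x) ^ (1 / p' + 1 / q)) ∧
    (¬ D → kap p q (unit x y) (unit x y) D x y =
      2 * cConst p q * (y - x) ^ (1 / p' + 1 / q)) := by
  have W := weights_unit hxy h hpq
  have hp' := W.one_lt_p'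
  have hp'0 : 0 < p' := by linarith
  have hq := W.one_lt_q
  have hq0 : 0 < q := by linarith
  have hκ := kap_pos (D := D) W le_rfl hxy le_rfl
  obtain ⟨F, G, S, hFx, hFy, hGy, hpos, hN⟩ := exists_arc W D le_rfl hxy le_rfl
  set κ := kap p q (unit x y) (unit x y) D x y with hκdef
  set lam := (κ ^ q)⁻¹ with hlam
  have hlam0 : 0 < lam := by positivity
  have mx : x ∈ Icc x y := ⟨le_rfl, hxy.le⟩
  have my : y ∈ Icc x y := ⟨hxy.le, le_rfl⟩
  have hN' : ∫ t in x..y, |G t| ^ p' = 1 := by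
    rw [← hN]
    refine intervalIntegral.integral_congr fun t ht => ?_
    rw [uIcc_of_le hxy.le] at ht
    simp [pw_unit ht]
  have hFnn : ∀ t ∈ Icc x y, 0 ≤ F t := by
    have := le_on_closure (s := Ioo x y) (f := fun _ => (0:ℝ)) (g := F)
      (fun t ht => (hpos t ht).le) continuousOn_const (by rw [closure_Ioo hxy.ne]; exact S.contF)
    intro t ht
    exact this (by rw [closure_Ioo hxy.ne]; exact ht)
  have hX : lam * ∫ t in x..y, F t ^ q = 1 := by
    have h0 : F y * G y = 0 := by
      by_cases hD : D
      · rw [hFy hD, zero_mul]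
      · rw [hGy hD, mul_zero]
    have := S.energy hp' hq W.integrable_U W.integrable_V hxy.le
    rw [hN, h0, hFx, zero_mul, sub_zero, zero_add] at this
    rw [this]
    congr 1
    refine intervalIntegral.integral_congr fun t ht => ?_
    rw [uIcc_of_le hxy.le] at ht
    simp [pw_unit ht, abs_of_nonneg (hFnn t ht)]
  have hanti : AntitoneOn G (Icc x y) := by
    refine antitoneOn_of_deriv_nonpos (convex_Icc x y) S.contG (fun s hs => ?_) fun s hs => ?_
    all_goals rw [interior_Icc] at hs
    · exact (S.hasDerivAt_unit hp' hq hs).2.differentiableAt.differentiableWithinAt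
    · rw [(S.hasDerivAt_unit hp' hq hs).2.deriv]
      have := spow_pos hq (hpos s hs)
      nlinarith
  -- With zeros at both ends `∫ G_{(p')} = 0`, so `G` cannot keep one sign; with a free end `G`
  -- vanishes at `y`.
  have hτ : ∃ τ ∈ Icc x y, G τ = 0 := by
    by_contra! hcon
    have hne : ∀ t ∈ Ioo x y, G t ≠ 0 := fun t ht => hcon t (Ioo_subset_Icc_self ht)
    by_cases hD : D
    · have e := S.sub_F hp' W.integrable_U mx my
      rw [hFy hD, hFx, sub_zero] at e
      have hi := intervalIntegrable_mul_spow hp' W.integrable_U (s := x) (t := y) (H := G)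
        (by rw [uIcc_of_le hxy.le]; exact S.contG)
      rcases lt_or_gt_of_ne (hcon x mx) with h1 | h1
      · have : 0 < ∫ t in x..y, -(pw p' (unit x y) t * spow p' (G t)) :=
          integral_pos_of_pos_on hxy hi.neg fun t ht => by
            have ht' := Ioo_subset_Icc_self ht
            rw [pw_unit ht', one_mul, neg_pos]
            exact spow_neg_of_neg hp' ((hanti mx ht' ht'.1).trans_lt h1)
        rw [intervalIntegral.integral_neg] at this
        linarith
      · have hy1 : 0 < G y := by
          by_contra hle
          obtain ⟨t, ht, h0⟩ := intermediate_value_Icc' hxy.le S.contG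
            (show (0:ℝ) ∈ Icc (G y) (G x) from ⟨not_lt.1 hle, h1.le⟩)
          exact hcon t ht h0
        have : 0 < ∫ t in x..y, pw p' (unit x y) t * spow p' (G t) :=
          integral_pos_of_pos_on hxy hi fun t ht => by
            have ht' := Ioo_subset_Icc_self ht
            rw [pw_unit ht', one_mul]
            exact spow_pos hp' (hy1.trans_le (hanti ht' my ht'.2))
        linarith
    · exact hcon y my (hGy hD)
  obtain ⟨τ, hτm, hGτ, hτy⟩ : ∃ τ ∈ Icc x y, G τ = 0 ∧ (¬ D → τ = y) := by
    by_cases hD : D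
    · obtain ⟨τ, h1, h2⟩ := hτ
      exact ⟨τ, h1, h2, fun h => absurd hD h⟩
    · exact ⟨y, my, hGy hD, fun _ => rfl⟩
  -- Comparing the Hamiltonian with its value at `τ` gives `|G| ^ p' = K * (M ^ q - F ^ q)`; in
  -- particular `M` is the maximum of `F`.
  set M := F τ with hM
  set K := p' * lam / q with hK
  have hK0 : 0 < K := by positivity
  have hGF : ∀ r ∈ Icc x y, |G r| ^ p' = K * (M ^ q - F r ^ q) := fun r hr => by
    have := S.hamiltonian hp' hq hr hτm
    rw [hGτ, abs_zero, Real.zero_rpow hp'0.ne', abs_of_nonneg (hFnn r hr), ← hM,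
      abs_of_nonneg (hFnn τ hτm), zero_div, zero_add] at this
    rw [hK]; field_simp at this ⊢; linarith
  have hFM : ∀ r ∈ Icc x y, F r ∈ Icc 0 M := fun r hr => ⟨hFnn r hr, by
    have h1 : 0 ≤ K * (M ^ q - F r ^ q) := by rw [← hGF r hr]; positivity
    have h2 : F r ^ q ≤ M ^ q := by
      have := nonneg_of_mul_nonneg_right h1 hK0
      linarith
    exact (Real.rpow_le_rpow_iff (hFnn r hr) (hFnn τ hτm) hq0).1 h2⟩
  have hM0 : 0 < M := by
    have hmid : (x + y) / 2 ∈ Ioo x y := ⟨by linarith, by linarith⟩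
    exact (hpos _ hmid).trans_le (hFM _ (Ioo_subset_Icc_self hmid)).2
  have iF : IntervalIntegrable (fun t => F t ^ q) volume x y :=
    (S.contF.rpow_const fun _ _ => Or.inr hq0.le).intervalIntegrable_of_Icc hxy.le
  -- The Hamiltonian relation is integrated, using the two normalizations `∫ |G| ^ p' = 1` and `lam
  -- * ∫ F ^ q = 1`.
  have id1 : K * M ^ q * (y - x) = (p' + q) / q := by
    have e : ∫ t in x..y, |G t| ^ p' = ∫ t in x..y, K * (M ^ q - F t ^ q) :=
      intervalIntegral.integral_congr fun t ht => by
        rw [uIcc_of_le hxy.le] at ht; exact hGF t ht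
    rw [hN', intervalIntegral.integral_const_mul,
      intervalIntegral.integral_sub intervalIntegrable_const iF, intervalIntegral.integral_const,
      smul_eq_mul] at e
    have e2 : K * ∫ t in x..y, F t ^ q = p' / q := by
      rw [hK]
      calc p' * lam / q * ∫ t in x..y, F t ^ q = p' / q * (lam * ∫ t in x..y, F t ^ q) := by ring
        _ = p' / q := by rw [hX, mul_one]
    have e3 : (p' + q) / q = p' / q + 1 := by field_simp
    rw [e3]; linarith
  set Φ := ∫ σ in (0:ℝ)..M, (M ^ q - σ ^ q) ^ (1 / p') with hΦ
  have hΦv := integral_sub_rpow hp'0 hq0 hM0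
  rw [← hΦ] at hΦv
  have iG : ∀ s t, s ∈ Icc x y → t ∈ Icc x y →
      IntervalIntegrable (fun t => |G t| ^ p') volume s t := fun s t hs ht =>
    ((S.contG.abs.rpow_const fun _ _ => Or.inr hp'0.le).mono
      (ordConnected_Icc.uIcc_subset hs ht)).intervalIntegrable
  -- On a branch where `G` keeps its sign, `|G| ^ p'` is `|G|` times `|F'|`, so its integral becomes
  -- one over the values of `F`.
  have half1 : ∫ t in x..τ, |G t| ^ p' = K ^ (1 / p') * Φ := by
    have hsub : Icc x τ ⊆ Icc x y := Icc_subset_Icc_right hτm.2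
    have := S.integral_subst hp' hq (ε := 1) le_rfl hτm.1 hτm.2 hK0
      (fun r hr => hFM r (hsub hr)) (fun r hr => hGF r (hsub hr)) (fun r hr => by
        rw [one_mul, abs_of_nonneg]
        rw [← hGτ]; exact hanti (hsub hr) hτm hr.2)
    rwa [one_mul, hFx] at this
  have hsum := intervalIntegral.integral_add_adjacent_intervals (iG x τ mx hτm) (iG τ y hτm my)
  rw [hN', half1] at hsum
  refine ⟨fun hD => ?_, fun hD => ?_⟩
  · have half2 : ∫ t in τ..y, |G t| ^ p' = K ^ (1 / p') * Φ := by
      have hsub : Icc τ y ⊆ Icc x y := Icc_subset_Icc_left hτm.1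
      have := S.integral_subst hp' hq (ε := -1) hτm.1 hτm.2 le_rfl hK0
        (fun r hr => hFM r (hsub hr)) (fun r hr => hGF r (hsub hr)) (fun r hr => by
          rw [neg_one_mul, abs_of_nonpos]
          rw [← hGτ]; exact hanti hτm (hsub hr) hr.1)
      rw [hFy hD, ← hM, intervalIntegral.integral_symm 0 M, ← hΦ] at this
      linarith
    rw [half2, hΦv] at hsum
    have := solve_amplitude h hq0 (m := 2) (sub_pos.2 hxy) hM0 hκ two_pos hK id1 (by linarith)
    rw [this]; ring
  · rw [hτy hD, intervalIntegral.integral_same, hΦv] at hsum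
    have := solve_amplitude h hq0 (m := 1) (sub_pos.2 hxy) hM0 hκ one_pos hK id1 (by linarith)
    rw [this]; ring

theorem opT_smul {u v f : ℝ → ℝ} (c d : ℝ) :
    opT (fun t => c * u t) (fun t => d * v t) f = fun t => c * d * opT u v f t := by
  ext t
  simp only [opT, prim, mul_left_comm _ c, integral_const_mul]
  ring

/-- Stated without the constraint, which for `c = 0` does not pass back from `c * u` to `u`. -/
theorem hK_false_smul_le (h : p.HolderConjugate p') (hq : 0 < q) {u v : ℝ → ℝ} (hu : MemL p' u)
    (hv : MemL q v) (c d : ℝ) :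
    hK p q False (fun t => c * u t) (fun t => d * v t) ≤ |c * d| * hK p q False u v := by
  refine hK_le h.pos fun f hf => ?_
  rw [opT_smul, nrm_const_mul hq]
  exact mul_le_mul_of_nonneg_left (le_hK_of_adm h hq hu hv ⟨hf.memL, hf.nrm_le, False.elim⟩)
    (abs_nonneg _)

theorem smul_hK_le (h : p.HolderConjugate p') (hq : 0 < q) {D : Prop} {u v : ℝ → ℝ}
    (hu : MemL p' u) (hv : MemL q v) (c d : ℝ) :
    |c * d| * hK p q D u v ≤ hK p q D (fun t => c * u t) (fun t => d * v t) := by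
  rcases (abs_nonneg (c * d)).eq_or_lt with h0 | h0
  · rw [← h0, zero_mul]; exact hK_nonneg
  · rw [← le_div_iff₀' h0]
    refine hK_le h.pos fun f hf => ?_
    rw [le_div_iff₀' h0, ← nrm_const_mul hq, ← opT_smul]
    refine le_hK_of_adm h hq (hu.const_mul c) (hv.const_mul d) ⟨hf.memL, hf.nrm_le, fun hD => ?_⟩
    simp_rw [mul_left_comm _ c, integral_const_mul, hf.integral_eq hD, mul_zero]

theorem indicator_const_eq (c : ℝ) :
    ((Icc x y).indicator fun _ => c) = fun t => c * unit x y t := by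
  ext t
  simp only [unit, Set.indicator]; split_ifs <;> simp

/-- The best constants for weights that are constant on an interval. -/
theorem hK_const (h : p.HolderConjugate p') (hpq : p ≤ q) (hxy : x < y) (c d : ℝ) :
    hK p q False ((Icc x y).indicator fun _ => c) ((Icc x y).indicator fun _ => d) ≤
      2 * cConst p q * |c * d| * (y - x) ^ (1 / p' + 1 / q) ∧
    cConst p q * |c * d| * (y - x) ^ (1 / p' + 1 / q) ≤
      hK p q True ((Icc x y).indicator fun _ => c) ((Icc x y).indicator fun _ => d) := by
  have hq0 : 0 < q := by linarith [h.pos]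
  have hU : ∀ s, MemL s (unit x y) := fun s => memL_indicator_const
  have e : ∀ D, kap p q (unit x y) (unit x y) D x y = hK p q D (unit x y) (unit x y) := fun D => by
    rw [kap, unit, indicator_indicator, inter_self]
  rw [indicator_const_eq, indicator_const_eq]
  constructor
  · refine (hK_false_smul_le h hq0 (hU p') (hU q) c d).trans_eq ?_
    rw [← e, (kap_unit h hpq hxy False).2 id]; ring
  · refine le_trans (le_of_eq ?_) (smul_hK_le h hq0 (hU p') (hU q) c d)
    rw [← e, (kap_unit h hpq hxy True).1 trivial]; ring

end constant

/-! ### Local norms and summation of errors over many intervals -/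

section local_norms

variable {p p' q r : ℝ} {D : Prop} {u v u' v' : ℝ → ℝ} {x y : ℝ}

/-- A three-factor Hölder inequality for finite sums. -/
theorem sum_holder {ι : Type*} (h : p.HolderConjugate p') (hpq : p ≤ q) (g : Finset ι)
    {N A B : ι → ℝ} (hN : ∀ j ∈ g, 0 ≤ N j) (hA : ∀ j ∈ g, 0 ≤ A j) (hB : ∀ j ∈ g, 0 ≤ B j)
    (hs : ∑ j ∈ g, N j ≤ 1) :
    ∑ j ∈ g, N j ^ (1 / p - 1 / q) * (A j ^ (1 / p') * B j ^ (1 / q)) ≤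
      (∑ j ∈ g, A j) ^ (1 / p') * (∑ j ∈ g, B j) ^ (1 / q) := by
  have hp := h.pos
  have hp' := h.symm.pos
  have hq : 0 < q := by linarith
  have w1 : 0 ≤ 1 / p - 1 / q := sub_nonneg.2 (one_div_le_one_div_of_le hp hpq)
  -- Exponents with sum one allow the weighted arithmetic-geometric mean inequality for each
  -- normalized term.
  have hw : (1 / p - 1 / q) + 1 / p' + 1 / q = 1 := by
    have := h.inv_add_inv_eq_one
    rw [one_div, one_div, one_div]; linarith
  set X := ∑ j ∈ g, A j with hX
  set Y := ∑ j ∈ g, B j with hY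
  have hX0 : 0 ≤ X := Finset.sum_nonneg hA
  have hY0 : 0 ≤ Y := Finset.sum_nonneg hB
  rcases hX0.eq_or_lt with h0 | hX0
  · have : ∀ j ∈ g, A j = 0 := (Finset.sum_eq_zero_iff_of_nonneg hA).1 h0.symm
    rw [← h0, Real.zero_rpow (by positivity), zero_mul]
    refine (Finset.sum_eq_zero fun j hj => ?_).le
    rw [this j hj, Real.zero_rpow (by positivity)]; ring
  rcases hY0.eq_or_lt with h0 | hY0
  · have : ∀ j ∈ g, B j = 0 := (Finset.sum_eq_zero_iff_of_nonneg hB).1 h0.symm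
    rw [← h0, Real.zero_rpow (by positivity : 1 / q ≠ 0), mul_zero]
    refine (Finset.sum_eq_zero fun j hj => ?_).le
    rw [this j hj, Real.zero_rpow (by positivity : 1 / q ≠ 0)]; ring
  have hXp : 0 < X ^ (1 / p') := by positivity
  have hYp : 0 < Y ^ (1 / q) := by positivity
  have key : ∀ j ∈ g, N j ^ (1 / p - 1 / q) * (A j ^ (1 / p') * B j ^ (1 / q)) ≤
      X ^ (1 / p') * Y ^ (1 / q) *
        ((1 / p - 1 / q) * N j + 1 / p' * (A j / X) + 1 / q * (B j / Y)) := fun j hj => by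
    have := Real.geom_mean_le_arith_mean3_weighted w1 (by positivity : 0 ≤ 1 / p')
      (by positivity : 0 ≤ 1 / q) (hN j hj) (div_nonneg (hA j hj) hX0.le)
      (div_nonneg (hB j hj) hY0.le) hw
    rw [Real.div_rpow (hA j hj) hX0.le, Real.div_rpow (hB j hj) hY0.le] at this
    calc _ = X ^ (1 / p') * Y ^ (1 / q) * (N j ^ (1 / p - 1 / q) * (A j ^ (1 / p') / X ^ (1 / p')) *
          (B j ^ (1 / q) / Y ^ (1 / q))) := by field_simp
      _ ≤ _ := mul_le_mul_of_nonneg_left this (by positivity)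
  refine (Finset.sum_le_sum key).trans ?_
  rw [← Finset.mul_sum, Finset.sum_add_distrib, Finset.sum_add_distrib, ← Finset.mul_sum,
    ← Finset.mul_sum, ← Finset.mul_sum, ← Finset.sum_div, ← Finset.sum_div, ← hX, ← hY,
    div_self hX0.ne', div_self hY0.ne']
  refine mul_le_of_le_one_right (by positivity) ?_
  have := mul_le_mul_of_nonneg_left hs w1
  linarith

/-- The `L_s` norm over `[x, y]`. -/
noncomputable def lnrm (s : ℝ) (w : ℝ → ℝ) (x y : ℝ) : ℝ := (∫ t in x..y, |w t| ^ s) ^ (1 / s)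

theorem integral_abs_rpow_nonneg (hxy : x ≤ y) (s : ℝ) (w : ℝ → ℝ) : 0 ≤ ∫ t in x..y, |w t| ^ s :=
  intervalIntegral.integral_nonneg hxy fun _ _ => Real.rpow_nonneg (abs_nonneg _) _

theorem lnrm_nonneg (hxy : x ≤ y) (s : ℝ) (w : ℝ → ℝ) : 0 ≤ lnrm s w x y :=
  Real.rpow_nonneg (integral_abs_rpow_nonneg hxy s w) _

theorem nrm_indicator_eq {s : ℝ} (hs : 0 < s) (hxy : x ≤ y) (w : ℝ → ℝ) :
    nrm s ((Icc x y).indicator w) = lnrm s w x y := by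
  rw [nrm, lnrm, integral_abs_indicator_rpow hs hxy]

/-- The error made in replacing the weights `u, v` by `u', v'` on `[x, y]`. -/
noncomputable def err (p' q : ℝ) (u v u' v' : ℝ → ℝ) (x y : ℝ) : ℝ :=
  lnrm p' (fun t => u t - u' t) x y * (lnrm q v x y + 2 * lnrm q v' x y) +
    lnrm p' u' x y * lnrm q (fun t => v t - v' t) x y

theorem kap_le_add_err (h : p.HolderConjugate p') (hq : 1 < q) (hxy : x ≤ y) (hu : MemL p' u)
    (hv : MemL q v) (hu' : MemL p' u') (hv' : MemL q v') :
    kap p q u v D x y ≤ kap p q u' v' D x y + err p' q u v u' v' x y := by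
  have hq0 : 0 < q := by linarith
  have hp'0 := h.symm.pos
  have := hK_perturb (D := D) h hq (hu'.indicator' (S := Icc x y) measurableSet_Icc)
    (hv'.indicator' (S := Icc x y) measurableSet_Icc)
    (hu.indicator' (S := Icc x y) measurableSet_Icc)
    (hv.indicator' (S := Icc x y) measurableSet_Icc)
  have e : ∀ w w' : ℝ → ℝ, (fun t => (Icc x y).indicator w t - (Icc x y).indicator w' t) =
      (Icc x y).indicator fun t => w t - w' t := fun w w' => by
    ext t; simp only [Set.indicator]; split_ifs <;> simp
  rw [e, e, nrm_indicator_eq hp'0 hxy, nrm_indicator_eq hp'0 hxy, nrm_indicator_eq hq0 hxy,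
    nrm_indicator_eq hq0 hxy, nrm_indicator_eq hq0 hxy] at this
  exact this

theorem hK_congr {D : Prop} (hu : u =ᵐ[volume] u') (hv : v =ᵐ[volume] v') :
    hK p q D u v = hK p q D u' v' := by
  have e1 : ∀ f : ℝ → ℝ, (fun t => f t * u t) =ᵐ[volume] fun t => f t * u' t := fun f => by
    filter_upwards [hu] with t ht; rw [ht]
  have e2 : ∀ f, nrm q (opT u v f) = nrm q (opT u' v' f) := fun f => nrm_congr (by
    filter_upwards [hv] with t ht
    rw [opT, opT, ht, prim_congr (e1 f)])
  have e3 : ∀ f, Adm p D u f ↔ Adm p D u' f := fun f =>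
    ⟨fun h => ⟨h.memL, h.nrm_le, fun hD => by rw [← integral_congr_ae (e1 f), h.integral_eq hD]⟩,
      fun h => ⟨h.memL, h.nrm_le, fun hD => by rw [integral_congr_ae (e1 f), h.integral_eq hD]⟩⟩
  simp_rw [hK, e2, e3]

/-- Because `1 / r = 1 / p' + 1 / q`, the explicit value for constant weights is a multiple of the
local `L_r` norm of the product, whose `r`-th powers are additive over intervals. Values at the
endpoints do not matter, these being null sets. -/
theorem kap_step (h : p.HolderConjugate p') (hpq : p ≤ q) (hr : 1 / r = 1 / p' + 1 / q)
    (hxy : x < y) {c d : ℝ} (hc : ∀ t ∈ Ioo x y, u t = c ∧ v t = d) :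
    kap p q u v False x y ≤ 2 * cConst p q * lnrm r (fun t => u t * v t) x y ∧
    cConst p q * lnrm r (fun t => u t * v t) x y ≤ kap p q u v True x y := by
  have hq0 : 0 < q := by linarith [h.pos]
  have hp'0 := h.symm.pos
  have hr0 : 0 < r := by
    have : 0 < 1 / r := by rw [hr]; positivity
    exact one_div_pos.1 this
  have e : ∀ w : ℝ → ℝ, ∀ c : ℝ, (∀ t ∈ Ioo x y, w t = c) →
      (Icc x y).indicator w =ᵐ[volume] (Icc x y).indicator fun _ => c := fun w c hw => by
    filter_upwards [compl_mem_ae_iff.2 (measure_singleton x),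
      compl_mem_ae_iff.2 (measure_singleton y)] with t h1 h2
    by_cases ht : t ∈ Icc x y
    · rw [indicator_of_mem ht, indicator_of_mem ht, hw t ⟨lt_of_le_of_ne ht.1 (Ne.symm h1),
        lt_of_le_of_ne ht.2 h2⟩]
    · rw [indicator_of_notMem ht, indicator_of_notMem ht]
  have hl : lnrm r (fun t => u t * v t) x y = |c * d| * (y - x) ^ (1 / p' + 1 / q) := by
    rw [lnrm, intervalIntegral.integral_congr_Ioo_of_le hxy.le (g := fun _ => |c * d| ^ r) fun t ht => by
      simp only [(hc t ht).1, (hc t ht).2], intervalIntegral.integral_const, smul_eq_mul,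
      Real.mul_rpow (by linarith) (by positivity), ← Real.rpow_mul (abs_nonneg _),
      mul_one_div_cancel hr0.ne', Real.rpow_one, hr, mul_comm]
  have hk := hK_const h hpq hxy c d
  rw [hl, kap, kap, hK_congr (e u c fun t ht => (hc t ht).1) (e v d fun t ht => (hc t ht).2),
    hK_congr (e u c fun t ht => (hc t ht).1) (e v d fun t ht => (hc t ht).2), ← mul_assoc,
    ← mul_assoc]
  exact hk

/-- `sum_holder` with the local integrals of `|u| ^ p'` and `|v| ^ q`. The family `g` may omit
intervals, since the integrals are nonnegative. -/
theorem sum_lnrm_le {a b : ℝ} {m : ℕ} {w : ℕ → ℝ} (h : p.HolderConjugate p') (hpq : p ≤ q)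
    (hw : Part a b m w) {g : Finset ℕ} (hg : g ⊆ Finset.range (m + 1)) {N : ℕ → ℝ}
    (hN : ∀ j ∈ g, 0 ≤ N j) (hs : ∑ j ∈ g, N j ≤ 1) (hu : MemL p' u) (hv : MemL q v) :
    ∑ j ∈ g, N j ^ (1 / p - 1 / q) * (lnrm p' u (w j) (w (j + 1)) * lnrm q v (w j) (w (j + 1))) ≤
      lnrm p' u a b * lnrm q v a b := by
  have hq0 : 0 < q := by linarith [h.pos]
  have hle : ∀ j ∈ g, w j ≤ w (j + 1) := fun j hj =>
    (hw.lt j (by simpa [Nat.lt_succ_iff] using hg hj)).le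
  have hnn : ∀ (s : ℝ) (f : ℝ → ℝ), ∀ j ∈ g, 0 ≤ ∫ t in w j..w (j + 1), |f t| ^ s := fun s f j hj =>
    integral_abs_rpow_nonneg (hle j hj) s f
  have hsum : ∀ (s : ℝ) (f : ℝ → ℝ), 0 < s → MemL s f →
      ∑ j ∈ g, ∫ t in w j..w (j + 1), |f t| ^ s ≤ ∫ t in a..b, |f t| ^ s := fun s f hs hf => by
    rw [hw.integral_eq_sum fun i _ => (hf.integrable_rpow hs).intervalIntegrable]
    refine Finset.sum_le_sum_of_subset_of_nonneg hg fun j hj _ => ?_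
    exact integral_abs_rpow_nonneg (hw.lt j (by simpa [Nat.lt_succ_iff] using hj)).le s f
  refine (sum_holder h hpq g hN (hnn p' u) (hnn q v) hs).trans ?_
  refine mul_le_mul (Real.rpow_le_rpow (Finset.sum_nonneg (hnn p' u)) (hsum p' u h.symm.pos hu)
    (one_div_nonneg.2 h.symm.pos.le)) (Real.rpow_le_rpow (Finset.sum_nonneg (hnn q v))
      (hsum q v hq0 hv) (by positivity)) (Real.rpow_nonneg (Finset.sum_nonneg (hnn q v)) _)
    (Real.rpow_nonneg ?_ _)
  exact (Finset.sum_nonneg (hnn p' u)).trans (hsum p' u h.symm.pos hu)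

/-- `err` is a combination of products of one local `L_{p'}` norm and one local `L_q` norm, so
`sum_lnrm_le` applies to each product. The resulting bound does not depend on the number of
intervals. -/
theorem sum_err_le {a b : ℝ} {m : ℕ} {w : ℕ → ℝ} (h : p.HolderConjugate p') (hpq : p ≤ q)
    (hw : Part a b m w) {g : Finset ℕ} (hg : g ⊆ Finset.range (m + 1)) {N : ℕ → ℝ}
    (hN : ∀ j ∈ g, 0 ≤ N j) (hs : ∑ j ∈ g, N j ≤ 1) (hu : MemL p' u) (hv : MemL q v)
    (hu' : MemL p' u') (hv' : MemL q v') :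
    ∑ j ∈ g, N j ^ (1 / p - 1 / q) * err p' q u v u' v' (w j) (w (j + 1)) ≤
      err p' q u v u' v' a b := by
  have h1 := sum_lnrm_le h hpq hw hg hN hs (u := fun t => u t - u' t) (hu.sub hu') hv
  have h2 := sum_lnrm_le h hpq hw hg hN hs (u := fun t => u t - u' t) (hu.sub hu') hv'
  have h3 := sum_lnrm_le h hpq hw hg hN hs hu' (v := fun t => v t - v' t) (hv.sub hv')
  have e : ∀ j, N j ^ (1 / p - 1 / q) * err p' q u v u' v' (w j) (w (j + 1)) =
      N j ^ (1 / p - 1 / q) * (lnrm p' (fun t => u t - u' t) (w j) (w (j + 1)) *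
        lnrm q v (w j) (w (j + 1))) +
      2 * (N j ^ (1 / p - 1 / q) * (lnrm p' (fun t => u t - u' t) (w j) (w (j + 1)) *
        lnrm q v' (w j) (w (j + 1)))) +
      N j ^ (1 / p - 1 / q) * (lnrm p' u' (w j) (w (j + 1)) *
        lnrm q (fun t => v t - v' t) (w j) (w (j + 1))) := fun j => by rw [err]; ring
  simp_rw [e]
  rw [Finset.sum_add_distrib, Finset.sum_add_distrib, ← Finset.mul_sum, err]
  linarith

/-- The main term of the estimate over a family of intervals. -/
theorem sum_main_le {a b : ℝ} {m : ℕ} {w : ℕ → ℝ} (h : p.HolderConjugate p') (hpq : p ≤ q)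
    (hr : 1 / r = 1 / p' + 1 / q)
    (hw : Part a b m w) {g : Finset ℕ} (hg : g ⊆ Finset.range (m + 1)) {N : ℕ → ℝ}
    (hN : ∀ j ∈ g, 0 ≤ N j) (hs : ∑ j ∈ g, N j ≤ 1) {f : ℝ → ℝ} (hf : MemL r f) :
    ∑ j ∈ g, N j ^ (1 / p - 1 / q) * lnrm r f (w j) (w (j + 1)) ≤ lnrm r f a b := by
  have hq0 : 0 < q := by linarith [h.pos]
  have hp'0 := h.symm.pos
  have hr0 : 0 < r := by
    have : 0 < 1 / r := by rw [hr]; positivity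
    exact one_div_pos.1 this
  have hnn : ∀ j ∈ g, 0 ≤ ∫ t in w j..w (j + 1), |f t| ^ r := fun j hj =>
    integral_abs_rpow_nonneg (hw.lt j (by simpa [Nat.lt_succ_iff] using hg hj)).le r f
  have hsum : ∑ j ∈ g, ∫ t in w j..w (j + 1), |f t| ^ r ≤ ∫ t in a..b, |f t| ^ r := by
    rw [hw.integral_eq_sum fun i _ => (hf.integrable_rpow hr0).intervalIntegrable]
    refine Finset.sum_le_sum_of_subset_of_nonneg hg fun j hj _ => ?_
    exact integral_abs_rpow_nonneg (hw.lt j (by simpa [Nat.lt_succ_iff] using hj)).le r f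
  have hsplit : ∀ X : ℝ, 0 ≤ X → X ^ (1 / r) = X ^ (1 / p') * X ^ (1 / q) := fun X hX => by
    rw [hr, Real.rpow_add_of_nonneg hX (by positivity) (by positivity)]
  have := sum_holder h hpq g hN hnn hnn hs
  rw [← hsplit _ (Finset.sum_nonneg hnn)] at this
  refine le_trans (Finset.sum_le_sum fun j hj => ?_)
    (this.trans (Real.rpow_le_rpow (Finset.sum_nonneg hnn) hsum (by positivity)))
  rw [← hsplit _ (hnn j hj), lnrm]

end local_norms

/-! ### Intervals with one free end, on the right or, after reflection, on the left -/

section reflect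

variable {a b p p' q r : ℝ} {u v u' v' : ℝ → ℝ} {x y lam : ℝ} {F G : ℝ → ℝ}

theorem MemL.reflect {s : ℝ} {w : ℝ → ℝ} (hw : MemL s w) : MemL s fun t => w (-t) :=
  hw.comp_measurePreserving (Measure.measurePreserving_neg volume)

theorem Weights.reflect (W : Weights a b p p' q u v) :
    Weights (-b) (-a) p p' q (fun t => u (-t)) (fun t => v (-t)) := by
  have hm : ∀ t, t ∈ Icc (-b) (-a) ↔ -t ∈ Icc a b := fun t => by
    constructor <;> rintro ⟨h1, h2⟩ <;> constructor <;> linarith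
  exact ⟨neg_lt_neg W.hab, W.conj, W.hpq, W.hu.reflect, W.hv.reflect,
    fun t ht => W.upos _ ((hm t).1 ht), fun t ht => W.vpos _ ((hm t).1 ht),
    fun t ht => W.uzero _ (fun h => ht ((hm t).2 h)),
    fun t ht => W.vzero _ (fun h => ht ((hm t).2 h))⟩

/-- Reversing the orientation changes the sign of both derivatives; the sign change of `G`
compensates in both equations, so `lam` is preserved. -/
theorem Sol.reflect {U V : ℝ → ℝ} (S : Sol p' q U V lam x y F G) (hp' : 1 < p') (hq : 1 < q)
    (hU : Integrable U) (hV : Integrable V) :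
    Sol p' q (fun t => U (-t)) (fun t => V (-t)) lam (-y) (-x) (fun t => F (-t))
      (fun t => -G (-t)) := by
  have hm : MapsTo (fun t : ℝ => -t) (Icc (-y) (-x)) (Icc x y) := fun t ht =>
    ⟨by linarith [ht.2], by linarith [ht.1]⟩
  refine ⟨S.contF.comp continuous_neg.continuousOn hm,
    (S.contG.comp continuous_neg.continuousOn hm).neg, fun s hs => ?_, fun s hs => ?_⟩
  · have hxy : x ≤ y := by linarith [hs.1, hs.2]
    have e := S.sub_F hp' hU (hm hs) (right_mem_Icc.2 hxy)
    simp_rw [spow_neg, mul_neg]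
    rw [intervalIntegral.integral_neg,
      intervalIntegral.integral_comp_neg (fun t => U t * spow p' (G t)), neg_neg]
    linarith
  · have hxy : x ≤ y := by linarith [hs.1, hs.2]
    have e := S.sub_G hq hV (hm hs) (right_mem_Icc.2 hxy)
    rw [intervalIntegral.integral_comp_neg (fun t => V t * spow q (F t)), neg_neg]
    linarith

theorem lnrm_reflect (s : ℝ) (w : ℝ → ℝ) (x y : ℝ) :
    lnrm s (fun t => w (-t)) (-y) (-x) = lnrm s w x y := by
  rw [lnrm, lnrm, intervalIntegral.integral_comp_neg (fun t => |w t| ^ s), neg_neg, neg_neg]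

/-- The `q`-th root of the energy inequality, divided by `N ^ (1 / q)`. In this form the
contributions of many intervals can be counted and added by `sum_holder`. -/
theorem one_le_of_energy_le {N κ : ℝ} (hp : 0 < p) (hq : 0 < q) (hlam : 0 < lam) (hN : 0 < N)
    (hκ : 0 ≤ κ) (h : N ≤ lam * (κ ^ q * N ^ (q / p))) :
    1 ≤ lam ^ (1 / q) * (N ^ (1 / p - 1 / q) * κ) := by
  have h1 := Real.rpow_le_rpow hN.le h (by positivity : 0 ≤ 1 / q)
  rw [Real.mul_rpow hlam.le (by positivity), Real.mul_rpow (by positivity) (by positivity),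
    ← Real.rpow_mul hκ, mul_one_div_cancel hq.ne', Real.rpow_one, ← Real.rpow_mul hN.le,
    show q / p * (1 / q) = 1 / p by field_simp] at h1
  rw [Real.rpow_sub hN]
  have h2 : 0 < N ^ (1 / q) := by positivity
  rw [← mul_le_mul_iff_left₀ h2]
  calc 1 * N ^ (1 / q) = N ^ (1 / q) := one_mul _
    _ ≤ lam ^ (1 / q) * (κ * N ^ (1 / p)) := h1
    _ = _ := by field_simp

/-- The contribution of an interval at one end of which `F` vanishes and at the other `G`. -/
theorem Sol.one_le (W : Weights a b p p' q u v) (hr : 1 / r = 1 / p' + 1 / q)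
    (hxy : x < y) (hlam : 0 < lam)
    (S : Sol p' q (pw p' u) (pw q v) lam x y F G)
    (hend : (F x = 0 ∧ G y = 0) ∨ (G x = 0 ∧ F y = 0))
    (hN : 0 < ∫ t in x..y, pw p' u t * |G t| ^ p') (hu' : MemL p' u') (hv' : MemL q v')
    {c d : ℝ} (hc : ∀ t ∈ Ioo x y, u' t = c ∧ v' t = d) :
    1 ≤ lam ^ (1 / q) * ((∫ t in x..y, pw p' u t * |G t| ^ p') ^ (1 / p - 1 / q) *
      (2 * cConst p q * lnrm r (fun t => u' t * v' t) x y + err p' q u v u' v' x y)) := by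
  have hp' := W.one_lt_p'
  have hq := W.one_lt_q
  have hq0 : 0 < q := by linarith
  have hen := S.energy hp' hq W.integrable_U W.integrable_V hxy.le
  set N := ∫ t in x..y, pw p' u t * |G t| ^ p' with hNdef
  have key : ∃ κ, 0 ≤ κ ∧ N ≤ lam * (κ ^ q * N ^ (q / p)) ∧
      κ ≤ 2 * cConst p q * lnrm r (fun t => u' t * v' t) x y + err p' q u v u' v' x y := by
    rcases hend with ⟨h1, h2⟩ | ⟨h1, h2⟩
    · rw [h1, h2, mul_zero, zero_mul, sub_zero, zero_add] at hen
      refine ⟨kap p q u v False x y, kap_nonneg, ?_, ?_⟩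
      · conv_lhs => rw [hen]
        exact mul_le_mul_of_nonneg_left (S.integral_le_kap W hxy.le h1 False.elim) hlam.le
      · exact (kap_le_add_err W.conj hq hxy.le W.hu W.hv hu' hv').trans
          (add_le_add_left (kap_step W.conj W.hpq hr hxy hc).1 _)
    · rw [h1, h2, mul_zero, zero_mul, sub_zero, zero_add] at hen
      -- The free end is on the left here; reflection moves it to the right, where the best constant
      -- is defined.
      have W' := W.reflect
      have S' := S.reflect hp' hq W.integrable_U W.integrable_V
      have hxy' : -y < -x := neg_lt_neg hxy
      refine ⟨kap p q (fun t => u (-t)) (fun t => v (-t)) False (-y) (-x), kap_nonneg, ?_, ?_⟩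
      · have := S'.integral_le_kap (D := False) W' hxy'.le (by simpa using h2) False.elim
        simp only [abs_neg] at this
        have e' : ∫ t in -y..-x, pw q (fun t => v (-t)) t * |F (-t)| ^ q =
            ∫ t in x..y, pw q v t * |F t| ^ q := by
          have := intervalIntegral.integral_comp_neg (a := -y) (b := -x)
            (fun t => pw q v t * |F t| ^ q)
          rw [neg_neg, neg_neg] at this
          rw [← this]; rfl
        have e : ∫ t in -y..-x, pw p' (fun t => u (-t)) t * |G (-t)| ^ p' = N := by
          rw [hNdef]
          have := intervalIntegral.integral_comp_neg (a := -y) (b := -x)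
            (fun t => pw p' u t * |G t| ^ p')
          rw [neg_neg, neg_neg] at this
          rw [← this]; rfl
        rw [e, e'] at this
        conv_lhs => rw [hen]
        exact mul_le_mul_of_nonneg_left this hlam.le
      · have h3 := kap_le_add_err (D := False) W.conj hq hxy'.le W'.hu W'.hv hu'.reflect hv'.reflect
        have h4 := (kap_step (u := fun t => u' (-t)) (v := fun t => v' (-t)) W.conj W.hpq hr hxy'
          (c := c) (d := d) fun t ht => hc (-t) ⟨by linarith [ht.2], by linarith [ht.1]⟩).1
        rw [lnrm_reflect r (fun t => u' t * v' t)] at h4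
        have h5 : err p' q (fun t => u (-t)) (fun t => v (-t)) (fun t => u' (-t)) (fun t => v' (-t))
            (-y) (-x) = err p' q u v u' v' x y := by
          simp only [err, lnrm_reflect p' (fun t => u t - u' t), lnrm_reflect q v,
            lnrm_reflect q v', lnrm_reflect p' u', lnrm_reflect q (fun t => v t - v' t)]
        rw [h5] at h3
        linarith
  obtain ⟨κ, h0, h1, h2⟩ := key
  refine (one_le_of_energy_le W.conj.pos hq0 hlam hN h0 h1).trans ?_
  gcongr

end reflect

/-! ### The partition at the zeros of both components -/

section fine

variable {a b p p' q r : ℝ} {u v u' v' : ℝ → ℝ} {x y lam : ℝ} {F G : ℝ → ℝ} {n m : ℕ}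

/-- A Rolle argument: `F' = U G_{(p')}` with `U` positive, so a `G` without zeros would make `F`
strictly monotone. -/
theorem Sol.exists_zero_G (W : Weights a b p p' q u v) (hx : a ≤ x) (hxy : x < y) (hy : y ≤ b)
    (S : Sol p' q (pw p' u) (pw q v) lam x y F G) (h : F x = F y) : ∃ t ∈ Ioo x y, G t = 0 := by
  have hp' := W.one_lt_p'
  by_contra! hcon
  have hsign : ∀ s ∈ Ioo x y, ∀ t ∈ Ioo x y, 0 < G s → 0 < G t := fun s hs t ht h0 => by
    by_contra hle
    have hsub : uIcc s t ⊆ Ioo x y := ordConnected_Ioo.uIcc_subset hs ht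
    obtain ⟨c, hc, h1⟩ := intermediate_value_uIcc (S.contG.mono (hsub.trans Ioo_subset_Icc_self))
      (show (0:ℝ) ∈ uIcc (G s) (G t) from mem_uIcc.2 (Or.inr ⟨not_lt.1 hle, h0.le⟩))
    exact hcon c (hsub hc) h1
  have hi := intervalIntegrable_mul_spow hp' W.integrable_U (s := x) (t := y) (H := G)
    (by rw [uIcc_of_le hxy.le]; exact S.contG)
  have e := S.sub_F hp' W.integrable_U (left_mem_Icc.2 hxy.le) (right_mem_Icc.2 hxy.le)
  rw [h, sub_self] at e
  have hU : ∀ t ∈ Ioo x y, 0 < pw p' u t := fun t ht =>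
    W.U_pos ⟨hx.trans ht.1.le, ht.2.le.trans hy⟩
  have hmid : (x + y) / 2 ∈ Ioo x y := ⟨by linarith, by linarith⟩
  rcases lt_or_gt_of_ne (hcon _ hmid) with h1 | h1
  · have : 0 < ∫ t in x..y, -(pw p' u t * spow p' (G t)) :=
      integral_pos_of_pos_on hxy hi.neg fun t ht => by
        have h2 : G t < 0 := by
          rcases lt_or_gt_of_ne (hcon t ht) with h2 | h2
          · exact h2
          · exact absurd (hsign t ht _ hmid h2) (not_lt.2 h1.le)
        have := mul_neg_of_pos_of_neg (hU t ht) (spow_neg_of_neg hp' h2)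
        linarith
    rw [intervalIntegral.integral_neg] at this
    linarith
  · have : 0 < ∫ t in x..y, pw p' u t * spow p' (G t) :=
      integral_pos_of_pos_on hxy hi fun t ht =>
        mul_pos (hU t ht) (spow_pos hp' (hsign _ hmid t ht h1))
    linarith

/-- The partition of `[a, b]` at the zeros of `F` and of `G`. -/
theorem exists_fine_nodal (W : Weights a b p p' q u v) (hl : lam ∈ spectralNumbers a b p q u v n) :
    ∃ (F G : ℝ → ℝ) (w : ℕ → ℝ), Sol p' q (pw p' u) (pw q v) lam a b F G ∧ Part a b (2 * n) w ∧
      ∫ t in a..b, pw p' u t * |G t| ^ p' = 1 ∧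
      ∀ j ≤ 2 * n, ((F (w j) = 0 ∧ G (w (j + 1)) = 0) ∨ (G (w j) = 0 ∧ F (w (j + 1)) = 0)) ∧
        0 < ∫ t in w j..w (j + 1), pw p' u t * |G t| ^ p' := by
  have hp' := W.one_lt_p'
  have hq := W.one_lt_q
  have hlam := (exists_nodal W hl).1
  obtain ⟨F, G, hS, hFa, hGb, hN, hn⟩ := (mem_spectralNumbers_iff W).1 hl
  obtain ⟨z, hz, hz0, hzne⟩ := exists_part_of_encard W.hab hn
  have hF0 : ∀ i ≤ n, F (z i) = 0 := fun i hi => by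
    rcases Nat.eq_zero_or_pos i with rfl | h1
    · rw [hz.zero, hFa]
    · exact hz0 i h1 hi
  -- `m i` is a zero of `G` inside the `i`-th nodal interval. On the last interval it is the
  -- endpoint `b`, which does not split the interval, so there are `2 * n + 1` pieces.
  have hmex : ∀ i, ∃ m, i ≤ n → z i < m ∧ m ≤ z (i + 1) ∧ G m = 0 ∧ (i < n → m < z (i + 1)) ∧
      (i = n → m = b) := fun i => by
    by_cases hi : i < n
    · obtain ⟨m, hm, h0⟩ := (hS.mono hp' hq W.integrable_U W.integrable_V
        (hz.mem (i := i) (by omega)).1 (hz.lt i hi.le).le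
        (hz.mem (i := i + 1) (by omega)).2).exists_zero_G W (hz.mem (i := i) (by omega)).1
        (hz.lt i hi.le) (hz.mem (i := i + 1) (by omega)).2
        (by rw [hF0 i hi.le, hF0 (i + 1) hi])
      exact ⟨m, fun _ => ⟨hm.1, hm.2.le, h0, fun _ => hm.2, fun h => absurd h hi.ne⟩⟩
    · refine ⟨b, fun h => ?_⟩
      obtain rfl : i = n := by omega
      exact ⟨hz.last ▸ hz.lt i le_rfl, hz.last.ge, hGb, fun h => absurd h hi, fun _ => rfl⟩
  choose m hm using hmex
  set w : ℕ → ℝ := fun j => if j % 2 = 0 then z (j / 2) else m (j / 2) with hw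
  have we : ∀ i, w (2 * i) = z i := fun i => by
    simp [hw]
  have wo : ∀ i, w (2 * i + 1) = m i := fun i => by
    simp only [hw, show (2 * i + 1) % 2 = 1 by omega, show (2 * i + 1) / 2 = i by omega]
    simp
  have hP : Part a b (2 * n) w := by
    refine ⟨?_, ?_, fun j hj => ?_⟩
    · rw [← mul_zero 2, we, hz.zero]
    · rw [wo, (hm n le_rfl).2.2.2.2 rfl]
    · rcases Nat.even_or_odd' j with ⟨i, rfl | rfl⟩
      · rw [we, wo]; exact (hm i (by omega)).1
      · rw [wo, show 2 * i + 1 + 1 = 2 * (i + 1) by ring, we]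
        exact (hm i (by omega)).2.2.2.1 (by omega)
  refine ⟨F, G, w, hS, hP, hN, fun j hj => ?_⟩
  have hends : (F (w j) = 0 ∧ G (w (j + 1)) = 0) ∨ (G (w j) = 0 ∧ F (w (j + 1)) = 0) := by
    rcases Nat.even_or_odd' j with ⟨i, rfl | rfl⟩
    · left
      rw [we, wo]
      exact ⟨hF0 i (by omega), (hm i (by omega)).2.2.1⟩
    · right
      rw [wo, show 2 * i + 1 + 1 = 2 * (i + 1) by ring, we]
      exact ⟨(hm i (by omega)).2.2.1, hF0 (i + 1) (by omega)⟩
  have hne : ∀ t ∈ Ioo (w j) (w (j + 1)), F t ≠ 0 := by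
    rcases Nat.even_or_odd' j with ⟨i, rfl | rfl⟩
    · rw [we, wo]
      exact fun t ht => hzne i (by omega) t ⟨ht.1, ht.2.trans_le (hm i (by omega)).2.1⟩
    · rw [wo, show 2 * i + 1 + 1 = 2 * (i + 1) by ring, we]
      exact fun t ht => hzne i (by omega) t ⟨(hm i (by omega)).1.trans ht.1, ht.2⟩
  refine ⟨hends, ?_⟩
  have m1 := hP.mem (i := j) (by omega)
  have m2 := hP.mem (i := j + 1) (by omega)
  have hlt := hP.lt j hj
  rw [(hS.mono hp' hq W.integrable_U W.integrable_V m1.1 hlt.le m2.2).energy hp' hq W.integrable_U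
    W.integrable_V hlt.le]
  have e1 : F (w (j + 1)) * G (w (j + 1)) = 0 := by
    rcases hends with h | h
    · rw [h.2, mul_zero]
    · rw [h.2, zero_mul]
  have e2 : F (w j) * G (w j) = 0 := by
    rcases hends with h | h
    · rw [h.1, zero_mul]
    · rw [h.1, mul_zero]
  rw [e1, e2, sub_zero, zero_add]
  refine mul_pos hlam (integral_pos_of_pos_on hlt (hS.intervalIntegrable_F W m1 m2) fun t ht => ?_)
  exact mul_pos (W.V_pos ⟨m1.1.trans ht.1.le, ht.2.le.trans m2.2⟩)
    (Real.rpow_pos_of_pos (abs_pos.2 (hne t ht)) _)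

end fine

/-! ### Bounds through step weights -/

/-- Weights that are constant on the intervals of a partition. -/
structure StepPair (a b p' q : ℝ) (m : ℕ) (y : ℕ → ℝ) (u v : ℝ → ℝ) : Prop where
  part : Part a b m y
  memu : MemL p' u
  memv : MemL q v
  const : ∀ k ≤ m, ∃ c d, ∀ t ∈ Ioo (y k) (y (k + 1)), u t = c ∧ v t = d

section bounds

variable {a b p p' q r : ℝ} {u v u' v' : ℝ → ℝ} {lam : ℝ} {n m : ℕ} {y : ℕ → ℝ}

/-- An interval without nodes lies in one interval of the partition. -/
theorem Part.exists_subinterval (hy : Part a b m y) {α β : ℝ} (hα : a ≤ α) (hαβ : α < β) (hβ : β ≤ b)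
    (h : ∀ k ≤ m + 1, y k ∉ Ioo α β) : ∃ k ≤ m, y k ≤ α ∧ β ≤ y (k + 1) := by
  obtain ⟨k, hk, h1, h2⟩ := hy.exists_mem (t := (α + β) / 2) ⟨by linarith, by linarith⟩
  refine ⟨k, hk, ?_, ?_⟩
  · by_contra hcon
    exact h k (by omega) ⟨not_le.1 hcon, by linarith⟩
  · by_contra hcon
    exact h (k + 1) (by omega) ⟨by linarith, not_le.1 hcon⟩

theorem StepPair.exists_const (hs : StepPair a b p' q m y u' v') {α β : ℝ} (hα : a ≤ α)
    (hαβ : α < β) (hβ : β ≤ b) (h : ∀ k ≤ m + 1, y k ∉ Ioo α β) :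
    ∃ c d, ∀ t ∈ Ioo α β, u' t = c ∧ v' t = d := by
  obtain ⟨k, hk, h1, h2⟩ := hs.part.exists_subinterval hα hαβ hβ h
  obtain ⟨c, d, hcd⟩ := hs.const k hk
  exact ⟨c, d, fun t ht => hcd t ⟨h1.trans_lt ht.1, ht.2.trans_le h2⟩⟩

/-- Few intervals of one partition contain nodes of another. -/
theorem Part.card_filter_le {w : ℕ → ℝ} {N : ℕ} (hw : Part a b N w) (y : ℕ → ℝ) (m : ℕ) :
    ((Finset.range (N + 1)).filter fun j => ∃ k ≤ m, y k ∈ Ioo (w j) (w (j + 1))).card ≤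
      m + 1 := by
  classical
  set S := (Finset.range (N + 1)).filter fun j => ∃ k ≤ m, y k ∈ Ioo (w j) (w (j + 1)) with hS
  have hex : ∀ j, ∃ k, j ∈ S → k ≤ m ∧ y k ∈ Ioo (w j) (w (j + 1)) := fun j => by
    by_cases hj : j ∈ S
    · obtain ⟨k, hk⟩ := (Finset.mem_filter.1 hj).2
      exact ⟨k, fun _ => hk⟩
    · exact ⟨0, fun h => absurd h hj⟩
  choose f hf using hex
  have := Finset.card_le_card_of_injOn (s := S) (t := Finset.range (m + 1)) f
    (fun j hj => by
      have := (hf j hj).1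
      simp; omega) fun i hi j hj hij => by
    by_contra hne
    have h1 := (hf i hi).2
    have h2 := (hf j hj).2
    rw [hij] at h1
    have hi' : i ≤ N := by simpa [Nat.lt_succ_iff] using (Finset.mem_filter.1 hi).1
    have hj' : j ≤ N := by simpa [Nat.lt_succ_iff] using (Finset.mem_filter.1 hj).1
    rcases Nat.lt_or_gt_of_ne hne with hlt | hlt
    · have := hw.le (i := i + 1) (j := j) hlt (by omega)
      linarith [h1.2, h2.1]
    · have := hw.le (i := j + 1) (j := i) hlt (by omega)
      linarith [h2.2, h1.1]
  simpa using this

/-- Lower bound for spectral numbers. -/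
theorem le_of_mem_spectralNumbers (W : Weights a b p p' q u v) (hr : 1 / r = 1 / p' + 1 / q)
    (hs : StepPair a b p' q m y u' v') (huv : MemL r fun t => u' t * v' t)
    (hl : lam ∈ spectralNumbers a b p q u v n) :
    (2 * n + 1 : ℝ) - (m + 2) ≤ lam ^ (1 / q) *
      (2 * cConst p q * lnrm r (fun t => u' t * v' t) a b + err p' q u v u' v' a b) := by
  classical
  have hp' := W.one_lt_p'
  have hq := W.one_lt_q
  have hq0 : 0 < q := by linarith
  have hlam := (exists_nodal W hl).1
  have hC := cConst_pos W.conj hq0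
  obtain ⟨F, G, w, hS, hw, hN1, hpc⟩ := exists_fine_nodal W hl
  set N : ℕ → ℝ := fun j => ∫ t in w j..w (j + 1), pw p' u t * |G t| ^ p' with hN
  have hsum : ∑ j ∈ Finset.range (2 * n + 1), N j = 1 := by
    rw [← hN1, hw.integral_eq_sum fun i hi => hS.intervalIntegrable_G W (hw.mem (by omega))
      (hw.mem (by omega))]
  -- A piece without a node of the step partition sees constant weights. At most `m + 2` pieces
  -- contain one, a number independent of `n`, and these are discarded.
  set bad := (Finset.range (2 * n + 1)).filter fun j => ∃ k ≤ m + 1, y k ∈ Ioo (w j) (w (j + 1))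
    with hbad
  set g := (Finset.range (2 * n + 1)).filter fun j => ¬ ∃ k ≤ m + 1, y k ∈ Ioo (w j) (w (j + 1))
    with hg
  have hcard : bad.card + g.card = 2 * n + 1 := by
    rw [hbad, hg, Finset.card_filter_add_card_filter_not, Finset.card_range]
  have hbc : bad.card ≤ m + 2 := hw.card_filter_le y (m + 1)
  have hgsub : g ⊆ Finset.range (2 * n + 1) := Finset.filter_subset _ _
  have hgle : ∀ j ∈ g, j ≤ 2 * n := fun j hj => by simpa [Nat.lt_succ_iff] using hgsub hj
  have hNnn : ∀ j ∈ g, 0 ≤ N j := fun j hj => (hpc j (hgle j hj)).2.le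
  have hNs : ∑ j ∈ g, N j ≤ 1 := by
    rw [← hsum]
    refine Finset.sum_le_sum_of_subset_of_nonneg hgsub fun j hj _ => (hpc j ?_).2.le
    simpa [Nat.lt_succ_iff] using hj
  have hone : ∀ j ∈ g, 1 ≤ lam ^ (1 / q) * (N j ^ (1 / p - 1 / q) *
      (2 * cConst p q * lnrm r (fun t => u' t * v' t) (w j) (w (j + 1)) +
        err p' q u v u' v' (w j) (w (j + 1)))) := fun j hj => by
    have hj' := hgle j hj
    have m1 := hw.mem (i := j) (by omega)
    have m2 := hw.mem (i := j + 1) (by omega)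
    have hno := (Finset.mem_filter.1 hj).2
    push Not at hno
    obtain ⟨c, d, hcd⟩ := hs.exists_const m1.1 (hw.lt j hj') m2.2 hno
    exact (hS.mono hp' hq W.integrable_U W.integrable_V m1.1 (hw.lt j hj').le m2.2).one_le W hr
      (hw.lt j hj') hlam (hpc j hj').1 (hpc j hj').2 hs.memu hs.memv hcd
  have h1 : (g.card : ℝ) ≤ lam ^ (1 / q) * ∑ j ∈ g, N j ^ (1 / p - 1 / q) *
      (2 * cConst p q * lnrm r (fun t => u' t * v' t) (w j) (w (j + 1)) +
        err p' q u v u' v' (w j) (w (j + 1))) := by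
    rw [Finset.mul_sum, Finset.cast_card]
    exact Finset.sum_le_sum hone
  have h2 := sum_main_le W.conj W.hpq hr hw hgsub hNnn hNs huv
  have h3 := sum_err_le W.conj W.hpq hw hgsub hNnn hNs W.hu W.hv hs.memu hs.memv
  have h4 : ∑ j ∈ g, N j ^ (1 / p - 1 / q) *
      (2 * cConst p q * lnrm r (fun t => u' t * v' t) (w j) (w (j + 1)) +
        err p' q u v u' v' (w j) (w (j + 1))) ≤
      2 * cConst p q * lnrm r (fun t => u' t * v' t) a b + err p' q u v u' v' a b := by
    have e : ∀ j, N j ^ (1 / p - 1 / q) *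
        (2 * cConst p q * lnrm r (fun t => u' t * v' t) (w j) (w (j + 1)) +
          err p' q u v u' v' (w j) (w (j + 1))) =
        2 * cConst p q * (N j ^ (1 / p - 1 / q) *
          lnrm r (fun t => u' t * v' t) (w j) (w (j + 1))) +
        N j ^ (1 / p - 1 / q) * err p' q u v u' v' (w j) (w (j + 1)) := fun j => by ring
    simp_rw [e]
    rw [Finset.sum_add_distrib, ← Finset.mul_sum]
    have := mul_le_mul_of_nonneg_left h2 (show 0 ≤ 2 * cConst p q by positivity)
    linarith
  have h5 : (2 * n + 1 : ℝ) - (m + 2) ≤ g.card := by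
    have : (bad.card : ℝ) + g.card = 2 * n + 1 := by exact_mod_cast hcard
    have h6 : (bad.card : ℝ) ≤ m + 2 := by exact_mod_cast hbc
    linarith
  exact h5.trans (h1.trans (mul_le_mul_of_nonneg_left h4 (Real.rpow_nonneg hlam.le _)))

/-- A common refinement of two partitions. -/
theorem exists_common_refinement {z : ℕ → ℝ} (hz : Part a b n z) (hy : Part a b m y) :
    ∃ (N : ℕ) (x : ℕ → ℝ), N ≤ n + m ∧ Part a b N x ∧ ∀ j ≤ N,
      (∀ i ≤ n + 1, z i ∉ Ioo (x j) (x (j + 1))) ∧ ∀ k ≤ m + 1, y k ∉ Ioo (x j) (x (j + 1)) := by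
  classical
  have hab : a < b := by
    have := hz.lt_of_lt (i := 0) (j := n + 1) (by omega) le_rfl
    rwa [hz.zero, hz.last] at this
  set S : Finset ℝ := (Finset.Icc 1 n).image z ∪ (Finset.Icc 1 m).image y with hS
  -- An auxiliary function whose zeros are the interior nodes of both partitions, so that
  -- `exists_part_of_encard` puts them in order.
  set F : ℝ → ℝ := fun t => if t ∈ S then 0 else 1 with hF
  have hmemI : ∀ {l : ℕ} {x : ℕ → ℝ}, Part a b l x → ∀ i ∈ Finset.Icc 1 l, x i ∈ Ioo a b := by
    intro l x hx i hi
    rw [Finset.mem_Icc] at hi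
    have h1 := hx.lt_of_lt (i := 0) (j := i) (by omega) (by omega)
    have h2 := hx.lt_of_lt (i := i) (j := l + 1) (by omega) le_rfl
    rw [hx.zero] at h1
    rw [hx.last] at h2
    exact ⟨h1, h2⟩
  have e : {t ∈ Ioo a b | F t = 0} = (S : Set ℝ) := by
    ext t
    have : F t = 0 ↔ t ∈ S := by simp only [hF]; split_ifs with h <;> simp [h]
    simp only [mem_ofPred_eq, this, Finset.mem_coe]
    refine ⟨fun h => h.2, fun h => ⟨?_, h⟩⟩
    rw [hS, Finset.mem_union, Finset.mem_image, Finset.mem_image] at h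
    rcases h with ⟨i, hi, rfl⟩ | ⟨i, hi, rfl⟩
    · exact hmemI hz i hi
    · exact hmemI hy i hi
  obtain ⟨x, hx, -, hne⟩ := exists_part_of_encard (n := S.card) hab (F := F)
    (by rw [e, Set.encard_coe_eq_coe_finsetCard])
  have hnotin : ∀ {l : ℕ} {w : ℕ → ℝ}, Part a b l w → (∀ i ∈ Finset.Icc 1 l, w i ∈ S) →
      ∀ j ≤ S.card, ∀ i ≤ l + 1, w i ∉ Ioo (x j) (x (j + 1)) := by
    intro l w hw hwS j hj i hi hmem
    rcases Nat.eq_zero_or_pos i with rfl | hi0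
    · rw [hw.zero] at hmem
      exact absurd (hx.mem (i := j) (by omega)).1 (not_le.2 hmem.1)
    · rcases hi.eq_or_lt with rfl | hlt
      · rw [hw.last] at hmem
        exact absurd (hx.mem (i := j + 1) (by omega)).2 (not_le.2 hmem.2)
      · exact hne j hj _ hmem (by
          simp only [hF, if_pos (hwS i (Finset.mem_Icc.2 ⟨hi0, by omega⟩))])
  refine ⟨S.card, x, ?_, hx, fun j hj => ⟨hnotin hz (fun i hi => ?_) j hj,
    hnotin hy (fun i hi => ?_) j hj⟩⟩
  · refine (Finset.card_union_le _ _).trans (add_le_add ?_ ?_)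
    · exact Finset.card_image_le.trans (by simp)
    · exact Finset.card_image_le.trans (by simp)
  · exact Finset.mem_union_left _ (Finset.mem_image_of_mem _ hi)
  · exact Finset.mem_union_right _ (Finset.mem_image_of_mem _ hi)

/-- Lower bound for the common best constant of an equalizing partition. -/
theorem le_of_equal_partition (W : Weights a b p p' q u v) (hr : 1 / r = 1 / p' + 1 / q)
    (hs : StepPair a b p' q m y u' v') (huv : MemL r fun t => u' t * v' t) {z : ℕ → ℝ} {θ : ℝ}
    (hz : Part a b n z) (hθ : 0 < θ)
    (hzv : ∀ i ≤ n, kap p q u v (i < n) (z i) (z (i + 1)) = θ) :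
    cConst p q * lnrm r (fun t => u' t * v' t) a b ≤
      (n + m + 1 : ℝ) ^ (1 / r) * θ + err p' q u' v' u v a b := by
  have hp' := W.one_lt_p'
  have hp'0 := W.conj.symm.pos
  have hq := W.one_lt_q
  have hq0 : 0 < q := by linarith
  have hr0 : 0 < r := by
    have : 0 < 1 / r := by rw [hr]; positivity
    exact one_div_pos.1 this
  have hC := cConst_pos W.conj hq0
  obtain ⟨N, x, hN, hx, hxn⟩ := exists_common_refinement hz hs.part
  set f : ℝ → ℝ := fun t => u' t * v' t with hf
  set T : ℕ → ℝ := fun j => ∫ t in x j..x (j + 1), |f t| ^ r with hT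
  have hle : ∀ j ∈ Finset.range (N + 1), j ≤ N := fun j hj => by
    simpa [Nat.lt_succ_iff] using hj
  have hTnn : ∀ j ∈ Finset.range (N + 1), 0 ≤ T j := fun j hj =>
    integral_abs_rpow_nonneg (hx.lt j (hle j hj)).le r f
  set X := ∫ t in a..b, |f t| ^ r with hX
  have hXT : X = ∑ j ∈ Finset.range (N + 1), T j :=
    hx.integral_eq_sum fun i _ => (huv.integrable_rpow hr0).intervalIntegrable
  have hXnn : 0 ≤ X := integral_abs_rpow_nonneg W.hab.le r f
  have hnn : ∀ (α β : ℝ), α ≤ β → 0 ≤ err p' q u' v' u v α β := fun α β h => by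
    have h1 := lnrm_nonneg h p' fun t => u' t - u t
    have h2 := lnrm_nonneg h q v'
    have h3 := lnrm_nonneg h q v
    have h4 := lnrm_nonneg h p' u
    have h5 := lnrm_nonneg h q fun t => v' t - v t
    rw [err]; positivity
  rcases hXnn.eq_or_lt with h0 | hXpos
  · rw [lnrm, ← hX, ← h0, Real.zero_rpow (by positivity), mul_zero]
    have := hnn a b W.hab.le
    positivity
  -- These weights turn Hölder's inequality into an equality: as `(1 / p - 1 / q) + 1 / r = 1`, the
  -- sum of `M j ^ (1 / p - 1 / q) * T j ^ (1 / r)` is exactly `X ^ (1 / r)`.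
  set M : ℕ → ℝ := fun j => T j / X with hM
  have hMnn : ∀ j ∈ Finset.range (N + 1), 0 ≤ M j := fun j hj => div_nonneg (hTnn j hj) hXnn
  have hMs : ∑ j ∈ Finset.range (N + 1), M j = 1 := by
    rw [hM, ← Finset.sum_div, ← hXT, div_self hXpos.ne']
  -- A piece of the refinement lies in a single interval of `z`; the two-sided constant is the
  -- smaller one and is monotone in the interval, so it is at most `θ` also when that interval is
  -- the last.
  have hpiece : ∀ j ∈ Finset.range (N + 1), cConst p q * T j ^ (1 / r) ≤
      θ + err p' q u' v' u v (x j) (x (j + 1)) := fun j hj => by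
    have hj' := hle j hj
    have m1 := hx.mem (i := j) (by omega)
    have m2 := hx.mem (i := j + 1) (by omega)
    have hlt := hx.lt j hj'
    obtain ⟨c, d, hcd⟩ := hs.exists_const m1.1 hlt m2.2 (hxn j hj').2
    obtain ⟨i, hi, h1, h2⟩ := hz.exists_subinterval m1.1 hlt m2.2 (hxn j hj').1
    calc cConst p q * T j ^ (1 / r) ≤ kap p q u' v' True (x j) (x (j + 1)) :=
          (kap_step W.conj W.hpq hr hlt hcd).2
      _ ≤ kap p q u v True (x j) (x (j + 1)) + err p' q u' v' u v (x j) (x (j + 1)) :=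
          kap_le_add_err W.conj hq hlt.le hs.memu hs.memv W.hu W.hv
      _ ≤ θ + err p' q u' v' u v (x j) (x (j + 1)) := by
          refine add_le_add_left ?_ _
          rw [← hzv i hi]
          exact (le_hK_true W.conj hq0 (W.memU _ _) (W.memV _ _)).trans (kap_mono W h1 h2)
  have hw : (1 / p - 1 / q) + 1 / r = 1 := by
    have := W.conj.inv_add_inv_eq_one
    rw [hr, one_div, one_div, one_div]; linarith
  have w1 : 0 ≤ 1 / p - 1 / q :=
    sub_nonneg.2 (one_div_le_one_div_of_le W.conj.pos W.hpq)
  have hmain : X ^ (1 / r) = ∑ j ∈ Finset.range (N + 1), M j ^ (1 / p - 1 / q) * T j ^ (1 / r) := by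
    have e : ∀ j ∈ Finset.range (N + 1), M j ^ (1 / p - 1 / q) * T j ^ (1 / r) =
        M j * X ^ (1 / r) := fun j hj => by
      have : T j = M j * X := by rw [hM]; field_simp
      rw [this, Real.mul_rpow (hMnn j hj) hXnn, ← mul_assoc,
        ← Real.rpow_add_of_nonneg (hMnn j hj) w1 (by positivity), hw, Real.rpow_one]
    rw [Finset.sum_congr rfl e, ← Finset.sum_mul, hMs, one_mul]
  have hcount : ∑ j ∈ Finset.range (N + 1), M j ^ (1 / p - 1 / q) ≤ (n + m + 1 : ℝ) ^ (1 / r) := by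
    have := sum_holder W.conj W.hpq (Finset.range (N + 1)) (A := fun _ => 1) (B := fun _ => 1) hMnn
      (fun _ _ => zero_le_one) (fun _ _ => zero_le_one) hMs.le
    simp only [Real.one_rpow, mul_one, Finset.sum_const, Finset.card_range, nsmul_eq_mul] at this
    refine this.trans ?_
    rw [← Real.rpow_add_of_nonneg (by positivity) (by positivity) (by positivity), ← hr]
    refine Real.rpow_le_rpow (by positivity) ?_ (by positivity)
    have : (N : ℝ) ≤ n + m := by exact_mod_cast hN
    push_cast; linarith
  have herr := sum_err_le W.conj W.hpq hx (Finset.Subset.refl _) hMnn hMs.le hs.memu hs.memv W.hu W.hv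
  calc cConst p q * lnrm r f a b = ∑ j ∈ Finset.range (N + 1), M j ^ (1 / p - 1 / q) *
        (cConst p q * T j ^ (1 / r)) := by
        rw [lnrm, ← hX, hmain, Finset.mul_sum]
        exact Finset.sum_congr rfl fun j _ => by ring
    _ ≤ ∑ j ∈ Finset.range (N + 1), M j ^ (1 / p - 1 / q) *
        (θ + err p' q u' v' u v (x j) (x (j + 1))) := Finset.sum_le_sum fun j hj =>
          mul_le_mul_of_nonneg_left (hpiece j hj) (Real.rpow_nonneg (hMnn j hj) _)
    _ = (∑ j ∈ Finset.range (N + 1), M j ^ (1 / p - 1 / q)) * θ +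
        ∑ j ∈ Finset.range (N + 1), M j ^ (1 / p - 1 / q) *
          err p' q u' v' u v (x j) (x (j + 1)) := by
        rw [Finset.sum_mul, ← Finset.sum_add_distrib]
        exact Finset.sum_congr rfl fun j _ => by ring
    _ ≤ _ := add_le_add (mul_le_mul_of_nonneg_right hcount hθ.le) herr

end bounds

/-! ### Approximation of the weights by step functions -/

section approx

variable {a b p p' q r : ℝ} {u v u' v' : ℝ → ℝ}

theorem nrm_eq_toReal {s : ℝ} (hs : 0 < s) {f : ℝ → ℝ} (hf : AEStronglyMeasurable f volume) :
    nrm s f = (eLpNorm f (ENNReal.ofReal s) volume).toReal := by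
  rw [← lpNorm_eq_nrm hs hf, lpNorm, if_pos hf]

theorem holderTriple_ofReal (hp' : 0 < p') (hq : 0 < q) (hr : 1 / r = 1 / p' + 1 / q) :
    ENNReal.HolderTriple (ENNReal.ofReal p') (ENNReal.ofReal q) (ENNReal.ofReal r) := by
  have hr0 : 0 < r := by
    have : 0 < 1 / r := by rw [hr]; positivity
    exact one_div_pos.1 this
  refine ⟨?_⟩
  rw [← ENNReal.ofReal_inv_of_pos hp', ← ENNReal.ofReal_inv_of_pos hq,
    ← ENNReal.ofReal_inv_of_pos hr0, ← ENNReal.ofReal_add (by positivity) (by positivity)]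
  congr 1
  rw [← one_div, ← one_div, ← one_div, hr]

/-- Hölder's inequality for a product. -/
theorem MemL.mul_memL (hp' : 0 < p') (hq : 0 < q) (hr : 1 / r = 1 / p' + 1 / q) (hu : MemL p' u)
    (hv : MemL q v) :
    MemL r (fun t => u t * v t) ∧ nrm r (fun t => u t * v t) ≤ nrm p' u * nrm q v := by
  have hr0 : 0 < r := by
    have : 0 < 1 / r := by rw [hr]; positivity
    exact one_div_pos.1 this
  have := holderTriple_ofReal hp' hq hr
  have hm : MemLp (u • v) (ENNReal.ofReal r) volume := MemLp.smul (p := ENNReal.ofReal p')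
    (q := ENNReal.ofReal q) hv hu
  have h2 : eLpNorm (u • v) (ENNReal.ofReal r) volume ≤
      eLpNorm u (ENNReal.ofReal p') volume * eLpNorm v (ENNReal.ofReal q) volume :=
    eLpNorm_smul_le_mul_eLpNorm hv.1 hu.1
  have e : u • v = fun t => u t * v t := by ext t; simp
  rw [e] at hm h2
  refine ⟨hm, ?_⟩
  rw [nrm_eq_toReal hr0 hm.1, nrm_eq_toReal hp' hu.1, nrm_eq_toReal hq hv.1, ← ENNReal.toReal_mul]
  exact ENNReal.toReal_mono (ENNReal.mul_ne_top hu.2.ne hv.2.ne) h2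

/-- Approximation by functions that are constant on the intervals of a fine uniform partition. -/
theorem exists_step_approx {s : ℝ} (hs : 1 ≤ s) (hab : a < b) {w : ℝ → ℝ} (hw : MemL s w)
    (hw0 : ∀ t ∉ Icc a b, w t = 0) {δ : ℝ} (hδ : 0 < δ) :
    ∃ m₀ : ℕ, ∀ m ≥ m₀, ∃ w' : ℝ → ℝ, MemL s w' ∧ nrm s (fun t => w t - w' t) ≤ δ ∧
      ∀ k ≤ m, ∃ c, ∀ t ∈ Ioo (a + (b - a) / (m + 1) * (k : ℕ))
        (a + (b - a) / (m + 1) * ((k + 1 : ℕ) : ℝ)), w' t = c := by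
  have hs0 : 0 < s := by linarith
  obtain ⟨g, hgs, hgw, hgc, hgm⟩ := hw.exists_hasCompactSupport_eLpNorm_sub_le (by simp)
    (ε := ENNReal.ofReal (δ / 2)) (by simpa using hδ)
  have hd : MemL s fun t => w t - g t := hw.sub hgm
  have hgw' : nrm s (fun t => w t - g t) ≤ δ / 2 := by
    rw [nrm_eq_toReal hs0 hd.1]
    exact ENNReal.toReal_le_of_le_ofReal (by positivity) hgw
  set K := nrm s (unit a b) with hK
  have hK0 : 0 ≤ K := nrm_nonneg _ _
  set δ' := δ / (2 * (K + 1)) with hδ'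
  have hδ'0 : 0 < δ' := by positivity
  obtain ⟨η, hη, hgη⟩ := Metric.uniformContinuous_iff.1
    (hgs.uniformContinuous_of_continuous hgc) δ' hδ'0
  obtain ⟨C, hC⟩ := hgs.exists_bound_of_continuous hgc
  obtain ⟨m₀, hm₀⟩ := exists_nat_gt ((b - a) / η)
  -- Every sufficiently fine mesh is admitted, so that both weights can be approximated on the same
  -- one.
  refine ⟨m₀, fun m hm => ?_⟩
  set h := (b - a) / (m + 1) with hh
  have hba : 0 < b - a := by linarith
  have hh0 : 0 < h := by positivity
  have hhη : h < η := by
    rw [hh, div_lt_iff₀ (by positivity)]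
    rw [div_lt_iff₀ hη] at hm₀
    have : (m₀ : ℝ) ≤ m := by exact_mod_cast hm
    nlinarith
  set G : ℝ → ℝ := fun t => g (a + h * (⌊(t - a) / h⌋ : ℤ)) with hG
  have hGm : Measurable G := by
    refine hgc.measurable.comp (measurable_const.add (measurable_const.mul ?_))
    exact (measurable_from_top (f := fun z : ℤ => (z : ℝ))).comp
      (Int.measurable_floor.comp ((measurable_id.sub_const a).div_const h))
  have hnear : ∀ t, |g t - G t| ≤ δ' := fun t => by
    have h1 := Int.floor_le ((t - a) / h)
    have h2 := Int.lt_floor_add_one ((t - a) / h)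
    rw [le_div_iff₀ hh0] at h1
    rw [div_lt_iff₀ hh0] at h2
    have := hgη (a := t) (b := a + h * (⌊(t - a) / h⌋ : ℤ)) (by
      rw [Real.dist_eq, abs_lt]; constructor <;> nlinarith)
    rw [Real.dist_eq] at this
    exact this.le
  have hunit : MemL s (unit a b) := memL_indicator_const
  have hw' : MemL s fun t => unit a b t * G t :=
    memL_mul_of_bounded hunit hGm.aestronglyMeasurable (C := C) fun t => hC _
  have hdiff : MemL s fun t => unit a b t * (g t - G t) :=
    memL_mul_of_bounded hunit (hgc.measurable.sub hGm).aestronglyMeasurable hnear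
  have hdiff' := nrm_mul_le_of_bounded hs0 hunit hnear
  have hwg : MemL s ((Icc a b).indicator fun t => w t - g t) :=
    hd.indicator' measurableSet_Icc
  refine ⟨fun t => unit a b t * G t, hw', ?_, fun k hk => ⟨g (a + h * k), fun t ht => ?_⟩⟩
  · have e : (fun t => w t - unit a b t * G t) = fun t =>
        (Icc a b).indicator (fun t => w t - g t) t + unit a b t * (g t - G t) := by
      ext t
      by_cases ht : t ∈ Icc a b
      · rw [unit, indicator_of_mem ht, indicator_of_mem ht]; ring
      · rw [unit, indicator_of_notMem ht, indicator_of_notMem ht, hw0 t ht]; ring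
    rw [e]
    refine (nrm_add_le hs hwg hdiff).trans ?_
    have h1 := (nrm_indicator_le hs0 hd (Icc a b)).trans hgw'
    have h2 : δ' * K ≤ δ / 2 := by
      rw [hδ', div_mul_eq_mul_div, div_le_div_iff₀ (by positivity) two_pos]
      nlinarith
    have h3 : nrm s ((Icc a b).indicator fun t => w t - g t) ≤ δ / 2 := h1
    linarith
  · have hfl : ⌊(t - a) / h⌋ = (k : ℤ) := by
      rw [Int.floor_eq_iff]
      push_cast at ht ⊢
      constructor
      · rw [le_div_iff₀ hh0]; linarith [ht.1]
      · rw [div_lt_iff₀ hh0]; linarith [ht.2]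
    have htm : t ∈ Icc a b := by
      have hk' : (k : ℝ) + 1 ≤ m + 1 := by exact_mod_cast Nat.succ_le_succ hk
      have h1 : h * (m + 1) = b - a := by rw [hh]; field_simp
      have h2 : h * (k + 1) ≤ h * (m + 1) := mul_le_mul_of_nonneg_left hk' hh0.le
      have h3 : 0 ≤ h * k := by positivity
      have ht1 := ht.1
      have ht2 := ht.2
      push_cast at ht2
      constructor <;> linarith
    simp only [hG, hfl, unit, indicator_of_mem htm, one_mul, Int.cast_natCast]

theorem lnrm_le_nrm {s x y : ℝ} (hs : 0 < s) (hxy : x ≤ y) {w : ℝ → ℝ} (hw : MemL s w) :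
    lnrm s w x y ≤ nrm s w := by
  rw [← nrm_indicator_eq hs hxy]
  exact nrm_indicator_le hs hw _

theorem lnrm_le_add {s x y : ℝ} (hs : 1 ≤ s) (hxy : x ≤ y) {w w' : ℝ → ℝ} (hw : MemL s w)
    (hw' : MemL s w') : lnrm s w x y ≤ lnrm s w' x y + nrm s fun t => w t - w' t := by
  have hs0 : 0 < s := by linarith
  have hd : MemL s fun t => w t - w' t := hw.sub hw'
  rw [← nrm_indicator_eq hs0 hxy, ← nrm_indicator_eq hs0 hxy]
  have e : (Icc x y).indicator w = fun t => (Icc x y).indicator w' t +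
      (Icc x y).indicator (fun t => w t - w' t) t := by
    ext t; simp only [Set.indicator]; split_ifs <;> simp
  rw [e]
  exact (nrm_add_le hs (hw'.indicator' measurableSet_Icc) (hd.indicator' measurableSet_Icc)).trans
    (add_le_add_right (nrm_indicator_le hs0 hd _) _)

theorem err_le {x y δ A B : ℝ} (hp' : 0 < p') (hq : 0 < q) (hxy : x ≤ y) (hu : MemL p' u)
    (hv : MemL q v) (hu' : MemL p' u') (hv' : MemL q v') (hδ : 0 ≤ δ)
    (h1 : nrm p' (fun t => u t - u' t) ≤ δ) (h2 : nrm q (fun t => v t - v' t) ≤ δ)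
    (hA : nrm p' u' ≤ A) (hB : nrm q v ≤ B) (hB' : nrm q v' ≤ B) :
    err p' q u v u' v' x y ≤ δ * (A + 3 * B) := by
  have hdu : MemL p' fun t => u t - u' t := hu.sub hu'
  have hdv : MemL q fun t => v t - v' t := hv.sub hv'
  have a1 := (lnrm_le_nrm hp' hxy hdu).trans h1
  have a2 := (lnrm_le_nrm hq hxy hdv).trans h2
  have a3 := (lnrm_le_nrm hp' hxy hu').trans hA
  have a4 := (lnrm_le_nrm hq hxy hv).trans hB
  have a5 := (lnrm_le_nrm hq hxy hv').trans hB'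
  have b1 := lnrm_nonneg hxy q v
  have b2 := lnrm_nonneg hxy q v'
  have b3 := lnrm_nonneg hxy q fun t => v t - v' t
  have hA0 : 0 ≤ A := (nrm_nonneg _ _).trans hA
  rw [err]
  calc _ ≤ δ * (B + 2 * B) + A * δ := by
        refine add_le_add (mul_le_mul a1 (by linarith) (by linarith) hδ)
          (mul_le_mul a3 a2 b3 hA0)
    _ = _ := by ring

/-- Approximation of a pair of weights by step functions. -/
theorem exists_stepPair (W : Weights a b p p' q u v) (hr : 1 / r = 1 / p' + 1 / q) {ε : ℝ}
    (hε : 0 < ε) :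
    ∃ (m : ℕ) (y : ℕ → ℝ) (u' v' : ℝ → ℝ), StepPair a b p' q m y u' v' ∧
      MemL r (fun t => u' t * v' t) ∧ err p' q u v u' v' a b ≤ ε ∧ err p' q u' v' u v a b ≤ ε ∧
      lnrm r (fun t => u' t * v' t) a b ≤ lnrm r (fun t => u t * v t) a b + ε ∧
      lnrm r (fun t => u t * v t) a b ≤ lnrm r (fun t => u' t * v' t) a b + ε := by
  have hp' := W.one_lt_p'
  have hp'0 : 0 < p' := by linarith
  have hq := W.one_lt_q
  have hq0 : 0 < q := by linarith
  have hr0 : 0 < r := by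
    have : 0 < 1 / r := by rw [hr]; positivity
    exact one_div_pos.1 this
  have hr1 : 1 ≤ r := by
    have h1 := W.conj.inv_add_inv_eq_one
    have h2 : 1 / q ≤ 1 / p := one_div_le_one_div_of_le W.conj.pos W.hpq
    have : 1 / r ≤ 1 := by rw [hr, one_div p']; rw [one_div p] at h2; linarith
    rwa [div_le_one hr0] at this
  have hab := W.hab
  set A := nrm p' u + 1 with hA
  set B := nrm q v + 1 with hB
  have hA0 : 0 < A := by have := nrm_nonneg p' u; linarith
  have hB0 : 0 < B := by have := nrm_nonneg q v; linarith
  -- The errors `err` and the change of the product in `L_r` are all at most `δ * (A + 3 * B)`; `δ ≤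
  -- 1` keeps the norms of the step weights below `A` and `B`.
  set δ := min 1 (ε / (A + 3 * B)) with hδ
  have hδ0 : 0 < δ := by positivity
  have hδ1 : δ ≤ 1 := min_le_left _ _
  have hδε : δ * (A + 3 * B) ≤ ε := by
    have := min_le_right 1 (ε / (A + 3 * B))
    rwa [← hδ, le_div_iff₀ (by positivity)] at this
  obtain ⟨m₁, h₁⟩ := exists_step_approx hp'.le hab W.hu W.uzero hδ0
  obtain ⟨m₂, h₂⟩ := exists_step_approx hq.le hab W.hv W.vzero hδ0
  set m := max m₁ m₂ with hm
  obtain ⟨u', hu', hue, huc⟩ := h₁ m (le_max_left _ _)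
  obtain ⟨v', hv', hve, hvc⟩ := h₂ m (le_max_right _ _)
  have hnu : nrm p' u' ≤ A := by
    have hd : MemL p' fun t => u' t - u t := hu'.sub W.hu
    have := nrm_add_le hp'.le W.hu hd
    rw [nrm_sub_comm u' u] at this
    simp only [add_sub_cancel] at this
    linarith
  have hnv : nrm q v' ≤ B := by
    have hd : MemL q fun t => v' t - v t := hv'.sub W.hv
    have := nrm_add_le hq.le W.hv hd
    rw [nrm_sub_comm v' v] at this
    simp only [add_sub_cancel] at this
    linarith
  have hh0 : 0 < (b - a) / (m + 1 : ℝ) := by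
    have : 0 < b - a := by linarith
    positivity
  have huv := hu'.mul_memL hp'0 hq0 hr hv'
  have huv0 := W.hu.mul_memL hp'0 hq0 hr W.hv
  have hdiff : nrm r (fun t => u' t * v' t - u t * v t) ≤ ε := by
    have d1 : MemL p' fun t => u' t - u t := hu'.sub W.hu
    have d2 : MemL q fun t => v' t - v t := hv'.sub W.hv
    have m1 := hu'.mul_memL hp'0 hq0 hr d2
    have m2 := d1.mul_memL hp'0 hq0 hr W.hv
    have e : (fun t => u' t * v' t - u t * v t) = fun t =>
        u' t * (v' t - v t) + (u' t - u t) * v t := by ext t; ring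
    rw [e]
    refine (nrm_add_le hr1 m1.1 m2.1).trans ?_
    rw [nrm_sub_comm] at hue hve
    have n1 : nrm p' u' * nrm q (fun t => v' t - v t) ≤ A * δ :=
      mul_le_mul hnu hve (nrm_nonneg _ _) hA0.le
    have n2 : nrm p' (fun t => u' t - u t) * nrm q v ≤ δ * B :=
      mul_le_mul hue (by linarith) (nrm_nonneg _ _) hδ0.le
    have := mul_pos hδ0 hB0
    linarith [m1.2, m2.2, mul_add δ A (3 * B)]
  refine ⟨m, fun k => a + (b - a) / (m + 1) * (k : ℝ), u', v', ⟨⟨by simp, ?_, fun i _ => ?_⟩, hu', hv',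
    fun k hk => ?_⟩, huv.1, ?_, ?_, ?_, ?_⟩
  · push_cast
    field_simp
    ring
  · push_cast
    nlinarith
  · obtain ⟨c, hc⟩ := huc k hk
    obtain ⟨d, hd⟩ := hvc k hk
    exact ⟨c, d, fun t ht => ⟨hc t ht, hd t ht⟩⟩
  · exact (err_le hp'0 hq0 hab.le W.hu W.hv hu' hv' hδ0.le hue hve hnu (by linarith) hnv).trans hδε
  · rw [nrm_sub_comm] at hue hve
    exact (err_le hp'0 hq0 hab.le hu' hv' W.hu W.hv hδ0.le hue hve (by linarith) hnv
      (by linarith)).trans hδε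
  · exact (lnrm_le_add hr1 hab.le huv.1 huv0.1).trans (add_le_add_right hdiff _)
  · have := lnrm_le_add hr1 hab.le huv0.1 huv.1
    rw [nrm_sub_comm] at this
    linarith

end approx

/-! ### Passage to the limit -/

section limit

variable {a b p p' q r : ℝ} {u v : ℝ → ℝ}

theorem tendsto_nat_div_add (c : ℝ) :
    Tendsto (fun n : ℕ => (n : ℝ) / (n + c)) atTop (𝓝 1) := by
  have h : Tendsto (fun n : ℕ => 1 + c / (n : ℝ)) atTop (𝓝 (1 + 0)) :=
    tendsto_const_nhds.add (tendsto_const_div_atTop_nhds_zero_nat c)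
  rw [add_zero] at h
  have h' := h.inv₀ one_ne_zero
  rw [inv_one] at h'
  refine h'.congr' ?_
  filter_upwards [eventually_gt_atTop 0] with n hn
  have hn' : (n : ℝ) ≠ 0 := by positivity
  rw [one_add_div hn', inv_div]

/-- Since `w + s = 1`, the quotient is the product of powers of two ratios, both tending to one. -/
theorem tendsto_nat_div_rpow_mul_rpow {w s : ℝ} (hws : w + s = 1) (m : ℝ) (hm : 0 ≤ m) :
    Tendsto (fun n : ℕ => (n : ℝ) / (((n : ℝ) + 1) ^ w * ((n : ℝ) + m) ^ s)) atTop (𝓝 1) := by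
  have h1 := (tendsto_nat_div_add 1).rpow_const (p := w) (Or.inl one_ne_zero)
  have h2 := (tendsto_nat_div_add m).rpow_const (p := s) (Or.inl one_ne_zero)
  have h := h1.mul h2
  rw [Real.one_rpow, Real.one_rpow, one_mul] at h
  refine h.congr' ?_
  filter_upwards [eventually_gt_atTop 0] with n hn
  have hn' : (0 : ℝ) < n := by positivity
  rw [Real.div_rpow hn'.le (by positivity), Real.div_rpow hn'.le (by positivity),
    div_mul_div_comm, ← Real.rpow_add hn', hws, Real.rpow_one]

/-- The asymptotics of the least spectral numbers. -/
theorem tendsto_of_isLeast (W : Weights a b p p' q u v) (hr : 1 / r = 1 / p' + 1 / q)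
    {lam : ℕ → ℝ} (hlam : ∀ n, IsLeast (spectralNumbers a b p q u v n) (lam n)) :
    Tendsto (fun n : ℕ => (n : ℝ) * lam n ^ (-(1 / q))) atTop
      (𝓝 (cConst p q * lnrm r (fun t => u t * v t) a b)) := by
  have hq := W.one_lt_q
  have hq0 : 0 < q := by linarith
  have hr0 : 0 < 1 / r := by
    have := W.one_lt_p'
    rw [hr]; positivity
  have hc := cConst_pos W.conj hq0
  have hws : (1 / p - 1 / q) + 1 / r = 1 := by
    have := W.conj.inv_add_inv_eq_one
    rw [hr]; simp only [one_div]; linarith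
  set c := cConst p q
  set R := lnrm r (fun t => u t * v t) a b
  have hpos : ∀ n, 0 < lam n ∧ ∃ z θ, 0 < θ ∧ Part a b n z ∧
      (∀ i ≤ n, kap p q u v (i < n) (z i) (z (i + 1)) = θ) ∧
      lam n ^ (1 / q) * θ ≤ (n + 1 : ℝ) ^ (1 / p - 1 / q) := fun n => by
    obtain ⟨l, hl, hl0, h⟩ := exists_least W n
    rw [(hlam n).unique hl]
    exact ⟨hl0, h⟩
  rw [tendsto_order]
  constructor
  -- Lower bound: the equalizing partition bounds `lam n` above in terms of `θ`, and the step
  -- weights bound `θ` below. `ε` is chosen so that `(c + 1) * ε` is half the gap.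
  · intro x hx
    obtain ⟨ε, hε, hxε⟩ : ∃ ε, 0 < ε ∧ x < c * (R - ε) - ε := by
      refine ⟨(c * R - x) / (2 * (c + 1)), div_pos (by linarith) (by positivity), ?_⟩
      have : (c * R - x) / (2 * (c + 1)) * (c + 1) = (c * R - x) / 2 := by field_simp
      linarith
    obtain ⟨m, y, u', v', hs, huv, he₁, he₂, hR₁, hR₂⟩ := exists_stepPair W hr hε
    set D := c * (R - ε) - ε
    have hlim := (tendsto_nat_div_rpow_mul_rpow hws (m + 1) (by positivity)).mul_const D
    rw [one_mul] at hlim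
    filter_upwards [(tendsto_order.1 hlim).1 x hxε] with n hn
    obtain ⟨hl0, z, θ, hθ, hz, hzv, hlθ⟩ := hpos n
    refine hn.trans_le ?_
    have hkey := le_of_equal_partition W hr hs huv hz hθ hzv
    have hD : D ≤ (n + (m + 1) : ℝ) ^ (1 / r) * θ := by
      have : c * (R - ε) ≤ c * lnrm r (fun t => u' t * v' t) a b :=
        mul_le_mul_of_nonneg_left (by linarith) hc.le
      rw [← add_assoc]
      linarith
    have hL : 0 < lam n ^ (1 / q) := Real.rpow_pos_of_pos hl0 _
    rw [Real.rpow_neg hl0.le, div_mul_eq_mul_div, mul_div_assoc]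
    refine mul_le_mul_of_nonneg_left ?_ (Nat.cast_nonneg n)
    have hA : 0 < ((n : ℝ) + 1) ^ (1 / p - 1 / q) := by positivity
    have hB : 0 < (n + (m + 1) : ℝ) ^ (1 / r) := by positivity
    rw [div_le_iff₀ (by positivity), inv_mul_eq_div, le_div_iff₀ hL]
    calc D * lam n ^ (1 / q) ≤ (n + (m + 1) : ℝ) ^ (1 / r) * θ * lam n ^ (1 / q) :=
          mul_le_mul_of_nonneg_right hD hL.le
      _ = (n + (m + 1) : ℝ) ^ (1 / r) * (lam n ^ (1 / q) * θ) := by ring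
      _ ≤ (n + (m + 1) : ℝ) ^ (1 / r) * (n + 1 : ℝ) ^ (1 / p - 1 / q) :=
          mul_le_mul_of_nonneg_left hlθ hB.le
      _ = _ := mul_comm _ _
  -- Upper bound: `lam n` is a spectral number, so counting its pieces applies. The factor `2` in `2
  -- * n + 1` cancels against the `2` in the constant for one free end.
  · intro x hx
    obtain ⟨ε, hε, hxε⟩ : ∃ ε, 0 < ε ∧ c * (R + ε) + ε < x := by
      refine ⟨(x - c * R) / (2 * (c + 1)), div_pos (by linarith) (by positivity), ?_⟩
      have : (x - c * R) / (2 * (c + 1)) * (c + 1) = (x - c * R) / 2 := by field_simp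
      linarith
    obtain ⟨m, y, u', v', hs, huv, he₁, he₂, hR₁, hR₂⟩ := exists_stepPair W hr hε
    set D := c * (R + ε) + ε
    have hlim := (tendsto_nat_div_add (-(m + 1 : ℝ) / 2)).mul_const D
    rw [one_mul] at hlim
    filter_upwards [(tendsto_order.1 hlim).2 x hxε, eventually_gt_atTop (m + 1)] with n hn hnm
    obtain ⟨hl0, -⟩ := hpos n
    refine lt_of_le_of_lt ?_ hn
    have hkey := le_of_mem_spectralNumbers W hr hs huv (hlam n).1
    have hnm' : (m : ℝ) + 1 < n := by exact_mod_cast hnm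
    have hL : 0 < lam n ^ (1 / q) := Real.rpow_pos_of_pos hl0 _
    rw [Real.rpow_neg hl0.le, div_mul_eq_mul_div, mul_div_assoc]
    refine mul_le_mul_of_nonneg_left ?_ (Nat.cast_nonneg n)
    rw [le_div_iff₀ (by linarith), inv_mul_eq_div, div_le_iff₀ hL]
    have h1 : c * lnrm r (fun t => u' t * v' t) a b ≤ c * (R + ε) :=
      mul_le_mul_of_nonneg_left hR₁ hc.le
    have h2 := mul_le_mul_of_nonneg_left (show 2 * c * lnrm r (fun t => u' t * v' t) a b +
      err p' q u v u' v' a b ≤ 2 * D by linarith) hL.le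
    linarith

end limit

end HardySystem

theorem theorem3 (a b p q r : ℝ) (hab : a < b) (hp : 1 < p) (hpq : p ≤ q)
    (hr : 1 / r = 1 / p.conjExponent + 1 / q)
    (u v : ℝ → ℝ) (hu : ∀ x ∈ Icc a b, 0 < u x) (hv : ∀ x ∈ Icc a b, 0 < v x)
    (huL : MemLp u (ENNReal.ofReal p.conjExponent) (volume.restrict (Icc a b)))
    (hvL : MemLp v (ENNReal.ofReal q) (volume.restrict (Icc a b))) :
    ∃ lamMin : ℕ → ℝ,
      (∀ n, IsLeast (HardySystem.spectralNumbers a b p q u v n) (lamMin n) ∧ 0 < lamMin n) ∧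
      Tendsto (fun n : ℕ => (n : ℝ) * lamMin n ^ (-(1 / q))) atTop
        (𝓝 (HardySystem.cConst p q * (∫ t in Icc a b, |u t * v t| ^ r) ^ (1 / r))) := by
  -- The weights are extended by zero, since the best constants are defined on the whole line.
  have hue : EqOn ((Icc a b).indicator u) u (Icc a b) := fun t ht => indicator_of_mem ht u
  have hve : EqOn ((Icc a b).indicator v) v (Icc a b) := fun t ht => indicator_of_mem ht v
  have W : HardySystem.Weights a b p p.conjExponent q ((Icc a b).indicator u)
      ((Icc a b).indicator v) :=
    { hab := hab
      conj := Real.HolderConjugate.conjExponent hp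
      hpq := hpq
      hu := (memLp_indicator_iff_restrict measurableSet_Icc).2 huL
      hv := (memLp_indicator_iff_restrict measurableSet_Icc).2 hvL
      upos := fun t ht => by rw [hue ht]; exact hu t ht
      vpos := fun t ht => by rw [hve ht]; exact hv t ht
      uzero := fun t ht => indicator_of_notMem ht u
      vzero := fun t ht => indicator_of_notMem ht v }
  choose lam hlam hpos _ using fun n => HardySystem.exists_least W n
  have hlim := HardySystem.tendsto_of_isLeast W hr hlam
  refine ⟨lam, fun n => ⟨?_, hpos n⟩, ?_⟩
  · rw [HardySystem.spectralNumbers_eq_of_eqOn hue hve]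
    exact hlam n
  · have e : HardySystem.lnrm r (fun t => (Icc a b).indicator u t * (Icc a b).indicator v t) a b =
        (∫ t in Icc a b, |u t * v t| ^ r) ^ (1 / r) := by
      rw [HardySystem.lnrm, intervalIntegral.integral_of_le hab.le, ← integral_Icc_eq_integral_Ioc,
        setIntegral_congr_fun measurableSet_Icc fun t ht => by rw [hue ht, hve ht]]
    rwa [e] at hlim
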